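/- Let $B_0,B_1,B_2\subset\mathbb{N}$ be finite nonempty sets (the supports of $P_0,P_1,Q$ in a parameterization $x=P_0(t)/Q(t)$, $y=P_1(t)/Q(t)$), let $A_i=\{(0,1)\}\cup\{(b,0): b\in B_i\}\subset\mathbb{R}^2$ (the supports of $f_0=xr-P_0(t)$, $f_1=yr-P_1(t)$, $f_2=r-Q(t)$), and let $C_i=\mathrm{CH}(A_i)$ and $C=C_0+C_1+C_2$. A Minkowski cell is a 2-dimensional sum $R=R_0+R_1+R_2$ of convex polytopes $R_i$ with vertices in $A_i$. A mixed subdivision of $C$ is a finite family $S$ of Minkowski cells that cover $C$ and intersect properly: for any two cells $R,R'$ the set $R_i\cap R'_i$ is a (possibly empty) common face of $R_i$ and $R'_i$ for each $i$, and if $R\cap R'\neq\emptyset$, then it is a face of both with the same Minkowski description in both. $S$ is tight if $\sum_i\dim R_i=2$ for each of its cells. It is regular if, for some lifting functions $\omega_i:A_i\to\mathbb{R}$, its cells, with their Minkowski descriptions, are the projections of the 2-dimensional faces of the lower hull of the sum of the lifted polytopes $\mathrm{CH}\{(a,\omega_i(a)):a\in A_i\}$; it is induced by a linear lifting if each $\omega_i$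 can be chosen to be the restriction of a linear function on $\mathbb{R}^2$. For a tight mixed subdivision $S$ and $i\in\{0,1,2\}$ let $e_i(S)$ be the total area of the cells $R\in S$ with $R_i=\{(0,1)\}$ and the other two summands 1-dimensional. The point obtained by $S$ is $e(S)=(e_0(S),e_1(S))$, the exponent vector in $x,y$ of the monomial of the resultant of $f_0,f_1,f_2$ that corresponds to $S$. The implicit polygon $N(\phi)$ predicted by the supports is the convex hull of the points $e(S)$ over the regular tight mixed subdivisions $S$ of $C$. Say that $b\in B_j$ is used by $S$ if $(b,0)$ is a vertex of the summand $R_j$ of some $R\in S$. (1) Let $S$ be a tight mixed subdivision of $C$ and let $b_i\in B_i$, $\min B_i<b_i<\max B_i$, be such that $(b_i,2)=(b_i,0)+(0,1)+(0,1)$, with $(b_i,0)$ from the $i$-th summand, is a 0-dimensional face of $S$. Then $e(S)$ is a convex combination of points $e(S')$ obtained by tight mixed subdivisions $S'\ne S$ such that every $b\in B_j$ ($j\in\{0,1,2\}$) used by $S'$ is either an endpoint ($\min B_j$ or $\max B_j$) or is used by $S$ and is not the point $b_i$ of $B_i$. In particular $S$ is not needed for the vertices of $N(\phi)$: if $e(S)$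 is a vertex of $N(\phi)$, then $e(S)=e(S')$ for such an $S'$. (2) Only subdivisions induced by linear liftings matter: every tight mixed subdivision $S$ of $C$, regular or not, has $e(S)\in N(\phi)$, and $N(\phi)$ is the convex hull of the points $e(S)$ over the tight mixed subdivisions $S$ of $C$ that are induced by linear liftings. -/

import Mathlib

open scoped Pointwise

/-- Affine dimension of a nonempty subset of the plane. -/
noncomputable def affDim (X : Set (ℝ × ℝ)) : ℕ :=
  Module.finrank ℝ (vectorSpan ℝ X)

/-- A triple of subsets of the plane, read as the description `R 0 + R 1 + R 2` of a Minkowski sum.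
Cells and faces of mixed subdivisions are such labelled sums. -/
abbrev MinkowskiTriple := Fin 3 → Set (ℝ × ℝ)

/-- The Minkowski sum itself. -/
def MinkowskiTriple.total (R : MinkowskiTriple) : Set (ℝ × ℝ) :=
  R 0 + R 1 + R 2

/-- `F` is a face of the Minkowski sum `R`, with its Minkowski description: every summand of `F` is
the face of the corresponding summand of `R` on which one and the same linear functional is
maximal. -/
def MinkowskiTriple.IsFace (F R : MinkowskiTriple) : Prop :=
  ∃ l : (ℝ × ℝ) →L[ℝ] ℝ, ∀ i, F i = l.toExposed (R i)

/-- A Minkowski cell for the supports `A`: a full-dimensional sum of convex polytopes, the `i`-th of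
them with vertices in `A i`. -/
def IsMinkowskiCell (A R : MinkowskiTriple) : Prop :=
  (∀ i, ∃ V : Set (ℝ × ℝ), V ⊆ A i ∧ V.Nonempty ∧ R i = convexHull ℝ V) ∧ affDim R.total = 2

/-- Two Minkowski cells intersect properly: corresponding summands intersect in a (possibly empty)
common face, and if the two cells meet, they meet in a common face which has the same Minkowski
description in both. -/
def IntersectProperly (R R' : MinkowskiTriple) : Prop :=
  (∀ i, IsExposed ℝ (R i) (R i ∩ R' i) ∧ IsExposed ℝ (R' i) (R i ∩ R' i)) ∧
  ((R.total ∩ R'.total).Nonempty →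
    ∃ F : MinkowskiTriple, F.IsFace R ∧ F.IsFace R' ∧ R.total ∩ R'.total = F.total)

/-- A mixed subdivision of `CH(A 0) + CH(A 1) + CH(A 2)`: a finite family of Minkowski cells which
cover this polygon and pairwise intersect properly (so distinct cells have disjoint interiors). -/
def IsMixedSubdivision (A : MinkowskiTriple) (S : Finset MinkowskiTriple) : Prop :=
  (∀ R ∈ S, IsMinkowskiCell A R) ∧
  (⋃ R ∈ S, R.total) = MinkowskiTriple.total (fun i => convexHull ℝ (A i)) ∧
  (∀ R ∈ S, ∀ R' ∈ S, IntersectProperly R R')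

/-- A tight mixed subdivision: in every cell the dimensions of the summands add up to the dimension
of the cell, which is `2`. -/
def IsTightMixedSubdivision (A : MinkowskiTriple) (S : Finset MinkowskiTriple) : Prop :=
  IsMixedSubdivision A S ∧ ∀ R ∈ S, ∑ i, affDim (R i) = 2

/-- The face of the lower hull of the lifted Minkowski sum, with summands
`CH {(a, ω i a) | a ∈ A i}`, on which the functional `(p, h) ↦ l p + h` is minimal, projected to the
plane and with its Minkowski description. -/
def lowerFace (A : MinkowskiTriple) (ω : Fin 3 → ℝ × ℝ → ℝ) (l : (ℝ × ℝ) →L[ℝ] ℝ) :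
    MinkowskiTriple :=
  fun i => convexHull ℝ {a ∈ A i | ∀ a' ∈ A i, l a + ω i a ≤ l a' + ω i a'}

/-- `S` is induced by the lifting `ω`: its cells are the projections of the full-dimensional faces
of the lower hull of the lifted Minkowski sum. -/
def IsInducedBy (A : MinkowskiTriple) (ω : Fin 3 → ℝ × ℝ → ℝ) (S : Finset MinkowskiTriple) : Prop :=
  ∀ R : MinkowskiTriple, R ∈ S ↔ ∃ l, R = lowerFace A ω l ∧ affDim R.total = 2

/-- `S` is regular: it is induced by some lifting. -/
def IsRegularSubdivision (A : MinkowskiTriple) (S : Finset MinkowskiTriple) : Prop :=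
  ∃ ω : Fin 3 → ℝ × ℝ → ℝ, IsInducedBy A ω S

/-- `S` is induced by a linear lifting: the lifting is a linear function on each support. -/
def IsLinearlyInduced (A : MinkowskiTriple) (S : Finset MinkowskiTriple) : Prop :=
  ∃ ω : Fin 3 → ((ℝ × ℝ) →ₗ[ℝ] ℝ), IsInducedBy A (fun i => ω i) S

/-- The supports in the variables `(t, r)` of `f₀ = x r - P₀(t)`, `f₁ = y r - P₁(t)`,
`f₂ = r - Q(t)`, where `B 0`, `B 1`, `B 2` are the supports of `P₀`, `P₁`, `Q`:
`A i = {(0, 1)} ∪ {(b, 0) | b ∈ B i}`. -/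
def curveSupports (B : Fin 3 → Finset ℕ) : MinkowskiTriple :=
  fun i => insert ((0 : ℝ), (1 : ℝ)) {p | ∃ b ∈ B i, p = ((b : ℝ), (0 : ℝ))}

/-- `R` is an `i`-mixed cell whose vertex summand is `(0, 1)`, the exponent of the monomial of `fᵢ`
that depends on `r`; the other two summands are segments. -/
def IsApexMixed (i : Fin 3) (R : MinkowskiTriple) : Prop :=
  R i = {((0 : ℝ), (1 : ℝ))} ∧ ∀ j, j ≠ i → affDim (R j) = 1

open Classical in
/-- `eᵢ`: the total area of the `i`-mixed cells of `S` with vertex summand `(0, 1)`. -/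
noncomputable def mixedExponent (S : Finset MinkowskiTriple) (i : Fin 3) : ℝ :=
  ∑ R ∈ S with IsApexMixed i R, MeasureTheory.volume.real R.total

/-- The point `(e₀, e₁)` obtained by `S`: the exponents of `x` and `y` in the monomial of the
resultant of `f₀, f₁, f₂` that corresponds to `S`. -/
noncomputable def obtainedPoint (S : Finset MinkowskiTriple) : ℝ × ℝ :=
  (mixedExponent S 0, mixedExponent S 1)

/-- The implicit polygon for the supports `B`: the convex hull of the exponents `(e₀, e₁)` of `x, y`
in the extreme monomials of the resultant, which are those that correspond to the regular tight
mixed subdivisions. -/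
def implicitPolygon (B : Fin 3 → Finset ℕ) : Set (ℝ × ℝ) :=
  convexHull ℝ {q | ∃ S, IsTightMixedSubdivision (curveSupports B) S ∧
    IsRegularSubdivision (curveSupports B) S ∧ q = obtainedPoint S}

/-- The point `(b, 2) = (b, 0) + (0, 1) + (0, 1)`, with `(b, 0)` taken from the `i`-th summand, is a
0-dimensional face of `S`. -/
def IsZeroFaceOnL (S : Finset MinkowskiTriple) (i : Fin 3) (b : ℕ) : Prop :=
  ∃ R ∈ S, MinkowskiTriple.IsFace
    (fun j => if j = i then {((b : ℝ), (0 : ℝ))} else {((0 : ℝ), (1 : ℝ))}) R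

/-- The exponent `b` of the `j`-th support is used in defining `S`: `(b, 0)` is a vertex of the
`j`-th summand of some cell. -/
def IsUsed (S : Finset MinkowskiTriple) (j : Fin 3) (b : ℕ) : Prop :=
  ∃ R ∈ S, ((b : ℝ), (0 : ℝ)) ∈ (R j).extremePoints ℝ

/-- `b` is an endpoint of the Newton segment of `B j`. -/
def IsEndpoint (B : Fin 3 → Finset ℕ) (j : Fin 3) (b : ℕ) : Prop :=
  b ∈ B j ∧ ((∀ c ∈ B j, b ≤ c) ∨ ∀ c ∈ B j, c ≤ b)

/-- `S'` is a tight mixed subdivision defined by exponents each of which is an endpoint of its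
Newton segment, or is used in defining `S` and is not the exponent `b` of the `i`-th support. -/
def IsReplacement (B : Fin 3 → Finset ℕ) (S : Finset MinkowskiTriple) (i : Fin 3) (b : ℕ)
    (S' : Finset MinkowskiTriple) : Prop :=
  IsTightMixedSubdivision (curveSupports B) S' ∧
  ∀ j c, IsUsed S' j c → IsEndpoint B j c ∨ (IsUsed S j c ∧ ¬(j = i ∧ c = b))

/-! Everything follows from one claim: the point obtained by any tight mixed subdivision `S` lies in
the hull of the points obtained by linear liftings (`IsTightMixedSubdivision.obtainedPoint_mem`).
Linear liftings are regular, which gives part (2). They use only endpoints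
(`IsLinearlyInduced.isEndpoint`), so their subdivisions are admissible replacements and differ from
an `S` that uses an inner exponent, which gives part (1).

If the claim failed, a linear functional, written as weights `w` on the exponents and perturbed to
be generic, would be strictly larger at `S` than at every linear lifting. So it suffices to find,
for generic `w`, a linear lifting that maximizes `∑ w i * e i` (`exists_linear_le`). The sum of the
three exponents is the same for all tight subdivisions. With `w r < w q < w p` the task is therefore
to minimize `(w p - w q) * e q + (w p - w r) * e r`, and a lower and an upper bound, both equal to a
sum of two `endLoss` terms (one per end), are matched.

Lower bound, for every tight subdivision: follow the horizontal line at height `3 / 2`. On the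
boundary between two cells one summand is at a base point, one on a slanted edge and one at the
apex. Each crossed cell is one of four moves, and the apex-mixed cells, all of which are crossed,
have as area the distance by which the lowest position advances. This turns `S` into a path of
states (`IsTightMixedSubdivision.exists_path`). If the `p`-th segment sticks out strictly at an end,
the `p`-th summand is lowest there, and before it reaches the apex the exponents `e q`, `e r` must
already have collected a definite amount (`Path.first_apex`). Adding both ends gives
`Path.endLoss_add_endLoss_le`.

Upper bound, for a linear lifting with `-w` as slopes in the second coordinate and tiny distinct
slopes in the first: a functional `(x, y)` selects the apex of the `i`-th support below a concave
graph `dualGraph`, with one kink near `0`, and the base above it. Cells with large `x` or `-x` come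
from crossings of three lines. A cell counted in `e q` or `e r` can only arise where the graph of
`p` first falls to one of the others, so there is at most one on each side, and its area realizes
the loss (`IsGenericLift.le_endLoss`). -/

theorem sum_eq_of_distinct {A : Type*} [AddCommMonoid A] {i j k : Fin 3} (hij : i ≠ j)
    (hik : i ≠ k) (hjk : j ≠ k) (f : Fin 3 → A) : ∑ l, f l = f i + f j + f k := by
  have : (Finset.univ : Finset (Fin 3)) = {i, j, k} := by
    ext l
    simp only [Finset.mem_univ, Finset.mem_insert, Finset.mem_singleton, true_iff]
    omega
  rw [this, Finset.sum_insert (by simp [hij, hik]), Finset.sum_insert (by simp [hjk]),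
    Finset.sum_singleton, add_assoc]

/-! ### Horizontal sections as sequences of moves -/

/-- The position of a generic horizontal section of a mixed subdivision on the boundary of a cell:
the `a`-th summand is at `(x, 0)`, the `b`-th on the edge from `(y, 0)` to the apex, and the `c`-th
at the apex. -/
@[ext] structure SliceState where
  a : Fin 3
  b : Fin 3
  c : Fin 3
  x : ℝ
  y : ℝ

namespace SliceState

/-- The three labels are distinct, and the coordinates lie in the given intervals. -/
def Valid (m M : Fin 3 → ℝ) (s : SliceState) : Prop :=
  (s.a ≠ s.b ∧ s.a ≠ s.c ∧ s.b ≠ s.c) ∧ (m s.a ≤ s.x ∧ s.x ≤ M s.a) ∧ m s.b ≤ s.y ∧ s.y ≤ M s.b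

/-- Reflection of the section. -/
def reflect (s : SliceState) : SliceState := ⟨s.a, s.b, s.c, -s.x, -s.y⟩

/-- Crossing a cell of a tight mixed subdivision from left to right, together with the area that the
cell contributes to the exponents. -/
inductive Step : SliceState → SliceState → (Fin 3 → ℝ) → Prop
  | moveMid (a b c : Fin 3) (x y y' : ℝ) : y ≤ y' → Step ⟨a, b, c, x, y⟩ ⟨a, b, c, x, y'⟩ 0
  | moveLow (a b c : Fin 3) (x x' y : ℝ) : x ≤ x' →
      Step ⟨a, b, c, x, y⟩ ⟨a, b, c, x', y⟩ (Pi.single c (x' - x))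
  | swapLow (a b c : Fin 3) (x y : ℝ) : x ≤ y →
      Step ⟨a, b, c, x, y⟩ ⟨b, a, c, y, x⟩ (Pi.single c (y - x))
  | swapTop (a b c : Fin 3) (x y z : ℝ) : y ≤ z → Step ⟨a, b, c, x, y⟩ ⟨a, c, b, x, z⟩ 0

/-- A sequence of steps through valid states, with the total contribution to the exponents. -/
inductive Path (m M : Fin 3 → ℝ) : SliceState → SliceState → (Fin 3 → ℝ) → Prop
  | refl (s : SliceState) : s.Valid m M → Path m M s s 0
  | snoc (s t r : SliceState) (e w : Fin 3 → ℝ) :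
      Path m M s t e → Step t r w → r.Valid m M → Path m M s r (e + w)

variable {m M : Fin 3 → ℝ} {s t r : SliceState} {e e' w : Fin 3 → ℝ}

theorem Path.valid_right (h : Path m M s t e) : t.Valid m M := by
  cases h <;> assumption

theorem Path.valid_left (h : Path m M s t e) : s.Valid m M := by
  induction h <;> assumption

theorem Step.nonneg (h : Step s t w) (i : Fin 3) : 0 ≤ w i := by
  cases h with
  | moveMid => simp
  | moveLow a b c x x' y h =>
    by_cases hi : i = c
    · subst hi; simpa using h
    · simp [hi]
  | swapLow a b c x y h =>
    by_cases hi : i = c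
    · subst hi; simpa using h
    · simp [hi]
  | swapTop => simp

theorem Path.nonneg (h : Path m M s t e) (i : Fin 3) : 0 ≤ e i := by
  induction h with
  | refl => simp
  | snoc t r e w _ h _ ih => exact add_nonneg ih (h.nonneg i)

/-- The lowest position advances only in `moveLow` and `swapLow`, and each advance is charged in
full to the label at the apex. Hence the total telescopes. -/
theorem Path.sum_eq (h : Path m M s t e) : ∑ i, e i = t.x - s.x := by
  induction h with
  | refl => simp
  | snoc t r e w _ h _ ih =>
    have : ∑ i, w i = r.x - t.x := by cases h <;> simp
    simp only [Pi.add_apply, Finset.sum_add_distrib, ih, this]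
    ring

theorem Path.trans (h : Path m M s t e) (h' : Path m M t r e') : Path m M s r (e + e') := by
  induction h' with
  | refl => simpa using h
  | snoc r q e' w _ hw hq ih => rw [← add_assoc]; exact .snoc _ _ _ _ _ ih hw hq

theorem Valid.reflect (h : s.Valid m M) : s.reflect.Valid (-M) (-m) := by
  obtain ⟨h, ⟨h1, h2⟩, h3, h4⟩ := h
  exact ⟨h, ⟨neg_le_neg h2, neg_le_neg h1⟩, neg_le_neg h4, neg_le_neg h3⟩

theorem Step.reflect (h : Step s t w) : Step t.reflect s.reflect w := by
  cases h with
  | moveMid a b c x y y' h => exact .moveMid a b c _ _ _ (neg_le_neg h)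
  | moveLow a b c x x' y h =>
    have := Step.moveLow a b c (-x') (-x) (-y) (neg_le_neg h)
    rwa [neg_sub_neg] at this
  | swapLow a b c x y h =>
    have := Step.swapLow b a c (-y) (-x) (neg_le_neg h)
    rwa [neg_sub_neg] at this
  | swapTop a b c x y z h => exact .swapTop a c b _ _ _ (neg_le_neg h)

/-- Reading the section from right to left keeps the charges and exchanges the two ends, so only the
left end needs a direct analysis. -/
theorem Path.reflect (h : Path m M s t e) : Path (-M) (-m) t.reflect s.reflect e := by
  induction h with
  | refl h => exact .refl _ h.reflect
  | snoc t r e w h hw hr ih =>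
    have h1 := Path.snoc _ _ _ _ _ (.refl _ hr.reflect) hw.reflect h.valid_right.reflect
    rw [zero_add] at h1
    rw [add_comm]
    exact h1.trans ih

/-! ### Lower bounds for the exponents along a path -/

/-- Either the `α`-th summand has not been at the apex yet, or the exponents were already large when
it was so for the first time. -/
theorem Path.first_apex_of_le (h : Path m M s t e) {α β γ : Fin 3} (hαβ : α ≠ β) (hαγ : α ≠ γ)
    (hβγ : β ≠ γ) (hm : m α < m β) (hm' : m β ≤ m γ) (hs : s.a = α) (hx : s.x = m α)
    {u v : ℝ} (hu : 0 ≤ u) (hv : 0 ≤ v) :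
    (t.c ≠ α ∧ e α = 0 ∧ ((t.c = γ ∧ e β = 0) ∨ t.c = β ∨
      (t.c = γ ∧ (t.a = β → m γ ≤ t.x) ∧ (t.b = β → m γ ≤ t.y)))) ∨
    ∃ r e₁ e₂, Path m M s r e₁ ∧ Path m M r t e₂ ∧ r.c = α ∧ e = e₁ + e₂ ∧
      min (u * (m γ - m α)) (v * (m β - m α)) ≤ u * e₁ β + v * e₁ γ := by
  have cov : ∀ i : Fin 3, i = α ∨ i = β ∨ i = γ := by
    intro i; omega
  -- The invariant before `α` reaches the apex has three cases. Either `γ` is at the apex and `β`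
  -- has never been charged, or `β` is at the apex, or `γ` is at the apex and `β` has a position at
  -- or beyond `m γ`.
  induction h with
  | refl h =>
    left
    obtain ⟨⟨h1, h2, h3⟩, -⟩ := h
    refine ⟨fun h => h2 (hs.trans h.symm), rfl, ?_⟩
    rcases cov s.c with h | h | h
    · exact absurd (hs.trans h.symm) h2
    · exact .inr (.inl h)
    · exact .inl ⟨h, rfl⟩
  | snoc t r e w h hw hr ih =>
    rcases ih with ih | ⟨q, e₁, e₂, h1, h2, h3, h4, h5⟩
    swap
    · exact .inr ⟨q, e₁, e₂ + w, h1, .snoc _ _ _ _ _ h2 hw hr, h3, by rw [h4, add_assoc], h5⟩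
    by_cases hc : r.c = α
    · right
      refine ⟨r, e + w, 0, .snoc _ _ _ _ _ h hw hr, .refl _ hr, hc, by simp, ?_⟩
      obtain ⟨ih1, ih2, ih3⟩ := ih
      have hsum := h.sum_eq
      have hb := h.nonneg β
      have hg := h.nonneg γ
      have hsum' : e α + e β + e γ = t.x - s.x := by
        rw [← hsum]
        have : (Finset.univ : Finset (Fin 3)) = {α, β, γ} := by
          ext i; simpa using cov i
        rw [this, Finset.sum_insert (by simp [hαβ, hαγ]), Finset.sum_insert (by simp [hβγ]),
          Finset.sum_singleton, add_assoc]
      have hval := h.valid_right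
      -- Since `e α = 0`, the two other exponents add up to `t.x - m α`, and `t.x` is at least the
      -- left end of the lowest label. If that label is `γ`, or is `β` already beyond `m γ`, the
      -- first bound holds. Otherwise `β` is lowest and has not been charged, and `γ` alone has
      -- paid.
      have key : m γ - m α ≤ e β + e γ ∨ (e β = 0 ∧ m β - m α ≤ e γ) := by
        cases hw with
        | moveMid a b c x y y' h => exact absurd hc ih1
        | moveLow a b c x x' y h => exact absurd hc ih1
        | swapLow a b c x y h => exact absurd hc ih1
        | swapTop a b c x y z h =>
          simp only [SliceState.Valid] at *
          subst hc
          obtain ⟨⟨h1, h2, h3⟩, ⟨h4, h5⟩, h6, h7⟩ := hval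
          rcases cov a with ha | ha | ha
          · exact absurd ha h1
          · rcases ih3 with ih3 | ih3 | ih3
            · right
              refine ⟨ih3.2, ?_⟩
              rw [ha] at h4
              linarith [ih3.2]
            · exact absurd (ha.trans ih3.symm) h2
            · left; have := ih3.2.1 ha; linarith
          · left
            rw [ha] at h4
            linarith
      have w0 : w = 0 := by
        cases hw with
        | moveMid => exact absurd hc ih1
        | moveLow => exact absurd hc ih1
        | swapLow => exact absurd hc ih1
        | swapTop => rfl
      subst w0
      simp only [add_zero]
      rcases key with key | ⟨k1, k2⟩
      · rcases le_total u v with huv | huv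
        · exact (min_le_left _ _).trans (by nlinarith)
        · exact (min_le_right _ _).trans (by nlinarith)
      · rw [k1]
        exact (min_le_right _ _).trans (by nlinarith)
    · left
      obtain ⟨ih1, ih2, ih3⟩ := ih
      refine ⟨hc, ?_, ?_⟩
      · have : w α = 0 := by
          cases hw with
          | moveMid => rfl
          | moveLow => simp [Ne.symm hc]
          | swapLow => simp [Ne.symm hc]
          | swapTop => rfl
        simp [ih2, this]
      · have hval := h.valid_right
        simp only [SliceState.Valid] at *
        cases hw with
        | moveMid a b c x y y' hle =>
          simp only [Pi.add_apply, Pi.zero_apply, add_zero] at *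
          rcases ih3 with ih3 | ih3 | ih3
          · exact .inl ih3
          · exact .inr (.inl ih3)
          · exact .inr (.inr ⟨ih3.1, ih3.2.1, fun h' => (ih3.2.2 h').trans hle⟩)
        | moveLow a b c x x' y hle =>
          rcases ih3 with ih3 | ih3 | ih3
          · left
            refine ⟨ih3.1, ?_⟩
            have hcγ : c = γ := ih3.1
            have : β ≠ c := by rw [hcγ]; exact hβγ
            simp [ih3.2, this]
          · exact .inr (.inl ih3)
          · exact .inr (.inr ⟨ih3.1, fun h' => (ih3.2.1 h').trans hle, ih3.2.2⟩)
        | swapLow a b c x y hle =>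
          rcases ih3 with ih3 | ih3 | ih3
          · left
            refine ⟨ih3.1, ?_⟩
            have hcγ : c = γ := ih3.1
            have : β ≠ c := by rw [hcγ]; exact hβγ
            simp [ih3.2, this]
          · exact .inr (.inl ih3)
          · exact .inr (.inr ⟨ih3.1, ih3.2.2, ih3.2.1⟩)
        | swapTop a b c x y z hle =>
          rcases cov b with hb | hb | hb
          · exact absurd hb hc
          · exact .inr (.inl hb)
          -- Here `β` leaves the apex and is replaced by `γ`. It lands to the right of the former
          -- position of `γ`, which is at least `m γ`.
          · right; right
            refine ⟨hb, fun h' => ?_, fun _ => ?_⟩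
            · exfalso
              simp only at *
              rcases cov c with h'' | h'' | h''
              · exact ih1 h''
              · exact hval.1.2.1 (h'.trans h''.symm)
              · exact hval.1.2.2 (hb.trans h''.symm)
            · have := hval.2.2.1
              simp only at *
              rw [hb] at this
              linarith

/-- The conclusion kept here is symmetric under exchanging `β` with `γ` and `u` with `v`, so the
order of `m β` and `m γ` does not matter. -/
theorem Path.first_apex (h : Path m M s t e) {α β γ : Fin 3} (hαβ : α ≠ β) (hαγ : α ≠ γ)
    (hβγ : β ≠ γ) (hβ : m α < m β) (hγ : m α < m γ) (hs : s.a = α) (hx : s.x = m α)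
    {u v : ℝ} (hu : 0 ≤ u) (hv : 0 ≤ v) :
    (t.c ≠ α ∧ e α = 0) ∨
    ∃ r e₁ e₂, Path m M s r e₁ ∧ Path m M r t e₂ ∧ r.c = α ∧ e = e₁ + e₂ ∧
      min (u * (m γ - m α)) (v * (m β - m α)) ≤ u * e₁ β + v * e₁ γ := by
  rcases le_total (m β) (m γ) with hle | hle
  · rcases h.first_apex_of_le hαβ hαγ hβγ hβ hle hs hx hu hv with h | h
    · exact .inl ⟨h.1, h.2.1⟩
    · exact .inr h
  · rcases h.first_apex_of_le hαγ hαβ hβγ.symm hγ hle hs hx hv hu with h | h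
    · exact .inl ⟨h.1, h.2.1⟩
    · right
      simpa only [min_comm, add_comm] using h

/-- The loss in the exponents caused by one end of the section. -/
def endLoss (P Q u v : ℝ) : ℝ := min (u * max Q 0) (v * max P 0)

theorem endLoss_eq_zero {P Q u v : ℝ} (hu : 0 ≤ u) (hv : 0 ≤ v) (h : P ≤ 0 ∨ Q ≤ 0) :
    endLoss P Q u v = 0 := by
  unfold endLoss
  rcases h with h | h
  · rw [max_eq_right h, mul_zero, min_eq_right (by positivity)]
  · rw [max_eq_right h, mul_zero, min_eq_left (by positivity)]

theorem eq_of_minimal {α β γ i : Fin 3} {f : Fin 3 → ℝ} (h : f α < f β) (h' : f α < f γ)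
    (hi : ∀ j, f i ≤ f j) (hβγ : β ≠ γ := by assumption) : i = α := by
  have hαβ : α ≠ β := by rintro rfl; exact lt_irrefl _ h
  have hαγ : α ≠ γ := by rintro rfl; exact lt_irrefl _ h'
  have cov : i = α ∨ i = β ∨ i = γ := by omega
  rcases cov with rfl | rfl | rfl
  · rfl
  · exact absurd (hi α) (not_le.2 h)
  · exact absurd (hi α) (not_le.2 h')

/-- The bound on the exponents by what happens at the left end of the section. -/
theorem Path.endLoss_le (h : Path m M s t e) {α β γ : Fin 3} (hαβ : α ≠ β) (hαγ : α ≠ γ)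
    (hβγ : β ≠ γ) (hs : s.x = m s.a) (hs' : ∀ i, m s.a ≤ m i) (ht' : ∀ i, m i ≤ t.x)
    {u v : ℝ} (hu : 0 ≤ u) (hv : 0 ≤ v) :
    endLoss (m β - m α) (m γ - m α) u v ≤ u * e β + v * e γ := by
  have hb := h.nonneg β
  have hg := h.nonneg γ
  -- Unless `α` is strictly leftmost the loss is zero and nonnegativity of the exponents suffices.
  by_cases hh : m α < m β ∧ m α < m γ
  · have hsa : s.a = α := eq_of_minimal hh.1 hh.2 hs'
    unfold endLoss
    rw [max_eq_left (by linarith), max_eq_left (by linarith)]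
    rcases h.first_apex hαβ hαγ hβγ hh.1 hh.2 hsa (by rw [hs, hsa]) hu hv with
      h1 | ⟨r, e₁, e₂, h1, h2, h3, h4, h5⟩
    · have hsum := h.sum_eq
      rw [sum_eq_of_distinct hαβ hαγ hβγ, h1.2, hs, hsa] at hsum
      have := ht' β
      have := ht' γ
      rcases le_total u v with huv | huv
      · exact (min_le_left _ _).trans (by nlinarith)
      · exact (min_le_right _ _).trans (by nlinarith)
    · refine h5.trans ?_
      rw [h4]
      have := h2.nonneg β
      have := h2.nonneg γ
      simp only [Pi.add_apply]
      gcongr <;> linarith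
  · rw [endLoss_eq_zero hu hv]
    · positivity
    · by_contra! hc
      exact hh ⟨by linarith, by linarith⟩

/-- The inequalities between the exponents obtained along a path from the left end to the right end
of the section. -/
theorem Path.endLoss_add_endLoss_le (h : Path m M s t e) {α β γ : Fin 3} (hαβ : α ≠ β)
    (hαγ : α ≠ γ) (hβγ : β ≠ γ) (hs : s.x = m s.a) (hs' : ∀ i, m s.a ≤ m i)
    (ht : t.x = M t.a) (ht' : ∀ i, M i ≤ M t.a) (hmM : ∀ i, m i ≤ M i)
    {u v : ℝ} (hu : 0 ≤ u) (hv : 0 ≤ v) :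
    endLoss (m β - m α) (m γ - m α) u v + endLoss (M α - M β) (M α - M γ) u v ≤
      u * e β + v * e γ := by
  have E1 : ∀ i, (-M) t.reflect.a ≤ (-M) i := fun i => neg_le_neg (ht' i)
  have E2 : t.reflect.x = (-M) t.reflect.a := by simp [SliceState.reflect, ht]
  have P1 : (-M) β - (-M) α = M α - M β := by simp; ring
  have P2 : (-M) γ - (-M) α = M α - M γ := by simp; ring
  have hb := h.nonneg β
  have hg := h.nonneg γ
  by_cases hl : m α < m β ∧ m α < m γ
  swap
  · rw [endLoss_eq_zero (P := m β - m α) hu hv, zero_add, ← P1, ← P2]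
    · refine h.reflect.endLoss_le hαβ hαγ hβγ E2 E1 (fun i => ?_) hu hv
      have := hmM i
      have := hs' i
      simp only [SliceState.reflect, Pi.neg_apply, hs]
      linarith
    · by_contra! hc
      exact hl ⟨by linarith, by linarith⟩
  by_cases hr : M β < M α ∧ M γ < M α
  swap
  · rw [endLoss_eq_zero (P := M α - M β) hu hv, add_zero]
    · refine h.endLoss_le hαβ hαγ hβγ hs hs' (fun i => ?_) hu hv
      rw [ht]
      exact (hmM i).trans (ht' i)
    · by_contra! hc
      exact hr ⟨by linarith, by linarith⟩
  have hsa : s.a = α := eq_of_minimal hl.1 hl.2 hs'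
  have hta : t.reflect.a = α := eq_of_minimal (neg_lt_neg hr.1) (neg_lt_neg hr.2) E1
  have hsx : s.x = m α := by rw [hs, hsa]
  have htx : t.reflect.x = (-M) α := by rw [E2, hta]
  unfold endLoss
  rw [max_eq_left (by linarith), max_eq_left (by linarith), max_eq_left (by linarith),
    max_eq_left (by linarith)]
  rcases h.first_apex hαβ hαγ hβγ hl.1 hl.2 hsa hsx hu hv with
    ⟨-, h1⟩ | ⟨r, e₁, e₂, h1, h2, h3, h4, h5⟩
  -- If `α` never reaches the apex, `e β + e γ` is the whole length `M α - m α`. This covers `(m β -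
  -- m α) + (M α - M β)` because `m β ≤ M β`, and likewise for `γ`.
  · have hsum := h.sum_eq
    have htx' : t.x = M α := by simpa [SliceState.reflect] using htx
    rw [sum_eq_of_distinct hαβ hαγ hβγ, h1, hsx, htx'] at hsum
    have := hmM β
    have := hmM γ
    rcases le_total u v with huv | huv
    · refine (add_le_add (min_le_left _ _) (min_le_left _ _)).trans ?_
      nlinarith
    · refine (add_le_add (min_le_right _ _) (min_le_right _ _)).trans ?_
      nlinarith
  -- Otherwise the path is cut at the first apex state `r`, and the rest is read from the right.
  -- There `α` must have reached the apex too, since it is at the apex in `r`. The two losses are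
  -- collected on disjoint pieces of the path.
  · rcases h2.reflect.first_apex hαβ hαγ hβγ (neg_lt_neg hr.1) (neg_lt_neg hr.2) hta htx hu hv with
      ⟨k1, -⟩ | ⟨r', e₃, e₄, k1, k2, k3, k4, k5⟩
    · exact absurd h3 k1
    · rw [P1, P2] at k5
      refine (add_le_add h5 k5).trans ?_
      have := k2.nonneg β
      have := k2.nonneg γ
      rw [h4, k4]
      simp only [Pi.add_apply]
      nlinarith

end SliceState

/-! ### Polytopes with vertices in a support -/

/-- A horizontal segment on the `x`-axis. -/
def baseEdge (b c : ℝ) : Set (ℝ × ℝ) := {p | b ≤ p.1 ∧ p.1 ≤ c ∧ p.2 = 0}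

/-- The triangle (or segment) with apex `(0, 1)` over a segment of the `x`-axis. -/
def apexCone (b c : ℝ) : Set (ℝ × ℝ) :=
  {p | 0 ≤ p.2 ∧ p.2 ≤ 1 ∧ b * (1 - p.2) ≤ p.1 ∧ p.1 ≤ c * (1 - p.2)}

theorem convex_apexCone (b c : ℝ) : Convex ℝ (apexCone b c) := by
  intro x hx y hy s t hs ht hst
  obtain ⟨h1, h2, h3, h4⟩ := hx
  obtain ⟨k1, k2, k3, k4⟩ := hy
  obtain rfl : t = 1 - s := by linarith
  have e1 := mul_le_mul_of_nonneg_left h2 hs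
  have e2 := mul_le_mul_of_nonneg_left k2 ht
  have e3 := mul_le_mul_of_nonneg_left h3 hs
  have e4 := mul_le_mul_of_nonneg_left k3 ht
  have e5 := mul_le_mul_of_nonneg_left h4 hs
  have e6 := mul_le_mul_of_nonneg_left k4 ht
  refine ⟨?_, ?_, ?_, ?_⟩ <;> simp only [Prod.fst_add, Prod.snd_add, Prod.smul_fst, Prod.smul_snd,
    smul_eq_mul]
  · positivity
  · linarith
  · linarith
  · linarith

theorem baseEdge_eq_segment {b c : ℝ} (h : b ≤ c) :
    baseEdge b c = segment ℝ ((b, 0) : ℝ × ℝ) (c, 0) := by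
  rw [← Prod.image_mk_segment_left, segment_eq_Icc h]
  ext ⟨x, y⟩
  simp only [baseEdge, Set.mem_ofPred_eq, Set.mem_image, Set.mem_Icc, Prod.mk.injEq]
  constructor
  · rintro ⟨h1, h2, h3⟩; exact ⟨x, ⟨h1, h2⟩, rfl, h3.symm⟩
  · rintro ⟨z, ⟨h1, h2⟩, rfl, rfl⟩; exact ⟨h1, h2, rfl⟩

theorem mem_apexCone_iff {b c : ℝ} (h : b ≤ c) {p : ℝ × ℝ} :
    p ∈ apexCone b c ↔ ∃ x t : ℝ, b ≤ x ∧ x ≤ c ∧ 0 ≤ t ∧ t ≤ 1 ∧ p = (x * (1 - t), t) := by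
  constructor
  · rintro ⟨h1, h2, h3, h4⟩
    rcases h2.lt_or_eq with h2 | h2
    · have : 0 < 1 - p.2 := by linarith
      refine ⟨p.1 / (1 - p.2), p.2, (le_div_iff₀ this).2 h3, (div_le_iff₀ this).2 h4, h1, h2.le, ?_⟩
      rw [div_mul_cancel₀ _ this.ne']
    · refine ⟨b, p.2, le_rfl, h, h1, h2.le, ?_⟩
      rw [h2] at h3 h4 ⊢
      simp only [sub_self, mul_zero] at *
      exact Prod.ext (le_antisymm h4 h3) h2
  · rintro ⟨x, t, h1, h2, h3, h4, rfl⟩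
    have : 0 ≤ 1 - t := by linarith
    exact ⟨h3, h4, mul_le_mul_of_nonneg_right h1 this, mul_le_mul_of_nonneg_right h2 this⟩

theorem apexCone_subset {b c : ℝ} (h : b ≤ c) {W : Set (ℝ × ℝ)} (hW : Convex ℝ W)
    (h1 : ((0 : ℝ), (1 : ℝ)) ∈ W) (hb : (b, (0 : ℝ)) ∈ W) (hc : (c, (0 : ℝ)) ∈ W) :
    apexCone b c ⊆ W := by
  intro p hp
  obtain ⟨x, t, hx1, hx2, ht1, ht2, rfl⟩ := (mem_apexCone_iff h).1 hp
  have : (x, (0 : ℝ)) ∈ W := by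
    apply hW.segment_subset hb hc
    rw [← baseEdge_eq_segment h]
    exact ⟨hx1, hx2, rfl⟩
  have := hW this h1 (by linarith : 0 ≤ 1 - t) ht1 (by ring)
  convert this using 1
  ext <;> simp; ring

theorem apexCone_self (b : ℝ) : apexCone b b = segment ℝ ((0, 1) : ℝ × ℝ) (b, 0) := by
  apply Set.Subset.antisymm
  · exact apexCone_subset le_rfl (convex_segment _ _) (left_mem_segment _ _ _)
      (right_mem_segment _ _ _) (right_mem_segment _ _ _)
  · apply (convex_apexCone b b).segment_subset
    · exact ⟨by simp, by simp, by simp, by simp⟩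
    · exact ⟨by simp, by simp, by simp, by simp⟩

theorem affDim_singleton (p : ℝ × ℝ) : affDim {p} = 0 := by
  simp [affDim]

theorem affDim_segment {p q : ℝ × ℝ} (h : p ≠ q) : affDim (segment ℝ p q) = 1 := by
  rw [affDim, vectorSpan_segment]
  exact finrank_span_singleton (by simpa [sub_eq_zero] using h.symm)

/-- A linear function which is constant on a two-dimensional set vanishes. -/
theorem eq_zero_of_affDim_eq_two {X : Set (ℝ × ℝ)} (hX : affDim X = 2) (f : ℝ × ℝ →ₗ[ℝ] ℝ)
    (hf : ∀ p ∈ X, ∀ q ∈ X, f p = f q) : f = 0 := by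
  have h1 : vectorSpan ℝ X = ⊤ := by
    apply Submodule.eq_top_of_finrank_eq
    rw [show Module.finrank ℝ (ℝ × ℝ) = 2 by simp]
    exact hX
  have h2 : vectorSpan ℝ X ≤ LinearMap.ker f := by
    rw [vectorSpan_def, Submodule.span_le]
    rintro _ ⟨p, hp, q, hq, rfl⟩
    simp [hf p hp q hq]
  rw [h1, top_le_iff, LinearMap.ker_eq_top] at h2
  exact h2

theorem affDim_eq_two_of_forall {X : Set (ℝ × ℝ)}
    (h : ∀ a b : ℝ, (∀ p ∈ X, ∀ q ∈ X, a * p.1 + b * p.2 = a * q.1 + b * q.2) → a = 0 ∧ b = 0) :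
    affDim X = 2 := by
  have : vectorSpan ℝ X = ⊤ := by
    by_contra hne
    obtain ⟨f, hf, hf'⟩ := Submodule.exists_le_ker_of_lt_top _ (lt_top_iff_ne_top.2 hne)
    have key : ∀ p : ℝ × ℝ, f p = f (1, 0) * p.1 + f (0, 1) * p.2 := by
      intro p
      have : p = p.1 • ((1, 0) : ℝ × ℝ) + p.2 • ((0, 1) : ℝ × ℝ) := by ext <;> simp
      conv_lhs => rw [this]
      rw [map_add, map_smul, map_smul, smul_eq_mul, smul_eq_mul]; ring
    apply hf
    obtain ⟨h1, h2⟩ := h (f (1, 0)) (f (0, 1)) (fun p hp q hq => by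
      rw [← key, ← key, ← sub_eq_zero, ← map_sub]
      exact hf' (vsub_mem_vectorSpan ℝ hp hq))
    ext <;> simp [h1, h2]
  rw [affDim, this, finrank_top]
  simp

theorem affDim_apexCone {b c : ℝ} (h : b < c) : affDim (apexCone b c) = 2 := by
  apply affDim_eq_two_of_forall
  intro s t H
  have a1 : ((0 : ℝ), (1 : ℝ)) ∈ apexCone b c := ⟨by simp, by simp, by simp, by simp⟩
  have a2 : (b, (0 : ℝ)) ∈ apexCone b c := ⟨by simp, by simp, by simp, by simpa using h.le⟩
  have a3 : (c, (0 : ℝ)) ∈ apexCone b c := ⟨by simp, by simp, by simpa using h.le, by simp⟩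
  have e1 := H _ a2 _ a3
  have e2 := H _ a1 _ a3
  simp only [mul_zero, add_zero, mul_one, zero_add] at e1 e2
  have : s = 0 := by
    have : s * (c - b) = 0 := by linarith
    rcases mul_eq_zero.1 this with h' | h'
    · exact h'
    · linarith
  subst this
  simpa using e2

theorem affDim_baseEdge {b c : ℝ} (h : b < c) : affDim (baseEdge b c) = 1 := by
  rw [baseEdge_eq_segment h.le]
  exact affDim_segment (by simpa using h.ne)

theorem affDim_apexCone_self (b : ℝ) : affDim (apexCone b b) = 1 := by
  rw [apexCone_self]
  exact affDim_segment (by simp)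

theorem baseEdge_self (b : ℝ) : baseEdge b b = {(b, 0)} := by
  ext ⟨x, y⟩
  simp only [baseEdge, Set.mem_ofPred_eq, Set.mem_singleton_iff, Prod.mk.injEq]
  constructor
  · rintro ⟨h1, h2, h3⟩; exact ⟨le_antisymm h2 h1, h3⟩
  · rintro ⟨rfl, rfl⟩; exact ⟨le_rfl, le_rfl, rfl⟩

/-- Apart from the apex all vertices lie on one line, so the hull depends only on whether the apex
occurs and on the leftmost and rightmost base points. The case `b = c` is allowed and gives a point
or a slanted edge. -/
theorem convexHull_support_cases {T : Set ℝ} (hT : T.Finite) {V : Set (ℝ × ℝ)}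
    (hV : V ⊆ insert ((0 : ℝ), (1 : ℝ)) ((fun b => (b, (0 : ℝ))) '' T)) (hne : V.Nonempty) :
    convexHull ℝ V = {((0 : ℝ), (1 : ℝ))} ∨
    ∃ b ∈ T, ∃ c ∈ T, b ≤ c ∧ (b, (0 : ℝ)) ∈ V ∧ (c, (0 : ℝ)) ∈ V ∧
      (∀ x, (x, (0 : ℝ)) ∈ V → b ≤ x ∧ x ≤ c) ∧
      ((((0 : ℝ), (1 : ℝ)) ∉ V ∧ convexHull ℝ V = baseEdge b c) ∨
      (((0 : ℝ), (1 : ℝ)) ∈ V ∧ convexHull ℝ V = apexCone b c)) := by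
  set U : Set ℝ := {b | (b, (0 : ℝ)) ∈ V} with hU
  have hUT : U ⊆ T := by
    intro b hb
    rcases hV hb with h | ⟨b', h, h'⟩
    · simp at h
    · simp only [Prod.mk.injEq, and_true] at h'
      rwa [← h']
  have hUf : U.Finite := hT.subset hUT
  rcases U.eq_empty_or_nonempty with h0 | h0
  · left
    have : V = {((0 : ℝ), (1 : ℝ))} := by
      apply Set.Subset.antisymm _
      · obtain ⟨p, hp⟩ := hne
        rw [Set.singleton_subset_iff]
        rcases hV hp with h | ⟨b, h, rfl⟩
        · rwa [← h]
        · have : b ∈ U := hp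
          simp [h0] at this
      · intro p hp
        rcases hV hp with h | ⟨b, h, rfl⟩
        · exact h
        · have : b ∈ U := hp
          simp [h0] at this
    rw [this, convexHull_singleton]
  · right
    obtain ⟨b, hb, hb'⟩ := Set.exists_min_image U id hUf h0
    obtain ⟨c, hc, hc'⟩ := Set.exists_max_image U id hUf h0
    have hbc : b ≤ c := hb' c hc
    refine ⟨b, hUT hb, c, hUT hc, hbc, hb, hc, fun x hx => ⟨hb' x hx, hc' x hx⟩, ?_⟩
    by_cases hap : ((0 : ℝ), (1 : ℝ)) ∈ V
    · refine .inr ⟨hap, Set.Subset.antisymm (convexHull_min ?_ (convex_apexCone b c)) ?_⟩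
      · intro p hp
        rcases hV hp with h | ⟨x, h, rfl⟩
        · rw [h]; exact ⟨by simp, by simp, by simp, by simp⟩
        · exact ⟨by simp, by simp, by simpa using hb' x hp, by simpa using hc' x hp⟩
      · exact apexCone_subset hbc (convex_convexHull _ _) (subset_convexHull _ _ hap)
          (subset_convexHull _ _ hb) (subset_convexHull _ _ hc)
    · refine .inl ⟨hap, Set.Subset.antisymm (convexHull_min ?_ ?_) ?_⟩
      · intro p hp
        rcases hV hp with h | ⟨x, h, rfl⟩
        · rw [h] at hp; exact absurd hp hap
        · exact ⟨hb' x hp, hc' x hp, rfl⟩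
      · rw [baseEdge_eq_segment hbc]; exact convex_segment _ _
      · rw [baseEdge_eq_segment hbc]
        exact segment_subset_convexHull hb hc

/-- The convex polytopes with vertices in one of the supports, by dimension. -/
inductive IsSummand (T : Set ℝ) : Set (ℝ × ℝ) → ℕ → Prop
  | apex : IsSummand T {((0 : ℝ), (1 : ℝ))} 0
  | base (b : ℝ) : b ∈ T → IsSummand T {(b, (0 : ℝ))} 0
  | edge (b c : ℝ) : b ∈ T → c ∈ T → b < c → IsSummand T (baseEdge b c) 1
  | slant (b : ℝ) : b ∈ T → IsSummand T (apexCone b b) 1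
  | triangle (b c : ℝ) : b ∈ T → c ∈ T → b < c → IsSummand T (apexCone b c) 2

theorem IsSummand.affDim_eq {T : Set ℝ} {X : Set (ℝ × ℝ)} {d : ℕ} (h : IsSummand T X d) :
    affDim X = d := by
  cases h with
  | apex => exact affDim_singleton _
  | base b h => exact affDim_singleton _
  | edge b c _ _ h => exact affDim_baseEdge h
  | slant b _ => exact affDim_apexCone_self b
  | triangle b c _ _ h => exact affDim_apexCone h

theorem isSummand_convexHull {T : Set ℝ} (hT : T.Finite) {V : Set (ℝ × ℝ)}
    (hV : V ⊆ insert ((0 : ℝ), (1 : ℝ)) ((fun b => (b, (0 : ℝ))) '' T)) (hne : V.Nonempty) :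
    IsSummand T (convexHull ℝ V) (affDim (convexHull ℝ V)) := by
  have : ∃ d, IsSummand T (convexHull ℝ V) d := by
    rcases convexHull_support_cases hT hV hne with
      h | ⟨b, hb, c, hc, hbc, -, -, -, ⟨-, h⟩ | ⟨-, h⟩⟩
    · exact ⟨0, h ▸ .apex⟩
    · rw [h]
      rcases hbc.eq_or_lt with rfl | hbc
      · rw [baseEdge_self]; exact ⟨0, .base b hb⟩
      · exact ⟨1, .edge b c hb hc hbc⟩
    · rw [h]
      rcases hbc.eq_or_lt with rfl | hbc
      · exact ⟨1, .slant b hb⟩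
      · exact ⟨2, .triangle b c hb hc hbc⟩
  obtain ⟨d, h⟩ := this
  rw [h.affDim_eq]; exact h

/-! ### Minkowski sums and areas -/

namespace MinkowskiTriple

variable {R : MinkowskiTriple}

theorem mem_total {p : ℝ × ℝ} : p ∈ R.total ↔ ∃ q : Fin 3 → ℝ × ℝ, (∀ i, q i ∈ R i) ∧
    ∑ i, q i = p := by
  simp only [total, Set.mem_add, Fin.sum_univ_three]
  constructor
  · rintro ⟨_, ⟨x, hx, y, hy, rfl⟩, z, hz, rfl⟩
    exact ⟨![x, y, z], by intro i; fin_cases i <;> simpa, rfl⟩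
  · rintro ⟨q, hq, rfl⟩
    exact ⟨_, ⟨_, hq 0, _, hq 1, rfl⟩, _, hq 2, rfl⟩

theorem mem_total_of_distinct {i j k : Fin 3} (hij : i ≠ j) (hik : i ≠ k) (hjk : j ≠ k)
    {p : ℝ × ℝ} : p ∈ R.total ↔ ∃ x ∈ R i, ∃ y ∈ R j, ∃ z ∈ R k, x + y + z = p := by
  rw [mem_total]
  constructor
  · rintro ⟨q, hq, rfl⟩
    exact ⟨_, hq i, _, hq j, _, hq k, (sum_eq_of_distinct hij hik hjk q).symm⟩
  · rintro ⟨x, hx, y, hy, z, hz, rfl⟩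
    refine ⟨fun l => if l = i then x else if l = j then y else z, fun l => ?_, ?_⟩
    · have : l = i ∨ l = j ∨ l = k := by omega
      rcases this with rfl | rfl | rfl
      · simpa
      · simpa [hij.symm]
      · simpa [hik.symm, hjk.symm]
    · rw [sum_eq_of_distinct hij hik hjk]
      simp [hij.symm, hik.symm, hjk.symm]

end MinkowskiTriple

open MeasureTheory in
/-- The area of a parallelogram. -/
theorem volume_real_parallelogram (v p q : ℝ × ℝ) :
    volume.real {z | ∃ s t : ℝ, 0 ≤ s ∧ s ≤ 1 ∧ 0 ≤ t ∧ t ≤ 1 ∧ z = v + s • p + t • q} =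
      |p.1 * q.2 - p.2 * q.1| := by
  set f : ℝ × ℝ →ₗ[ℝ] ℝ × ℝ :=
    Matrix.toLin (Module.Basis.finTwoProd ℝ) (Module.Basis.finTwoProd ℝ) !![p.1, q.1; p.2, q.2]
  have hf : ∀ z, f z = z.1 • p + z.2 • q := by
    intro z
    rw [Matrix.toLin_finTwoProd_apply]
    ext <;> simp <;> ring
  have hset : {z | ∃ s t : ℝ, 0 ≤ s ∧ s ≤ 1 ∧ 0 ≤ t ∧ t ≤ 1 ∧ z = v + s • p + t • q} =
      v +ᵥ (f '' (Set.Icc (0 : ℝ) 1 ×ˢ Set.Icc (0 : ℝ) 1)) := by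
    ext z
    simp only [Set.mem_ofPred_eq, Set.mem_vadd_set, Set.mem_image, Set.mem_prod, Set.mem_Icc, hf,
      vadd_eq_add]
    constructor
    · rintro ⟨s, t, h1, h2, h3, h4, rfl⟩
      exact ⟨_, ⟨(s, t), ⟨⟨h1, h2⟩, h3, h4⟩, rfl⟩, (add_assoc _ _ _).symm⟩
    · rintro ⟨_, ⟨⟨s, t⟩, ⟨⟨h1, h2⟩, h3, h4⟩, rfl⟩, rfl⟩
      exact ⟨s, t, h1, h2, h3, h4, (add_assoc _ _ _).symm⟩
  rw [hset, Measure.real, measure_vadd, Measure.addHaar_image_linearMap, LinearMap.det_toLin,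
    Measure.volume_eq_prod, Measure.prod_prod]
  simp [Matrix.det_fin_two_of, ENNReal.toReal_ofReal]
  ring_nf

theorem IsSummand.of_two {T : Set ℝ} {X : Set (ℝ × ℝ)} (h : IsSummand T X 2) :
    ∃ b ∈ T, ∃ c ∈ T, b < c ∧ X = apexCone b c := by
  cases h with
  | triangle b c hb hc hbc => exact ⟨b, hb, c, hc, hbc, rfl⟩

theorem IsSummand.of_one {T : Set ℝ} {X : Set (ℝ × ℝ)} (h : IsSummand T X 1) :
    (∃ b ∈ T, ∃ c ∈ T, b < c ∧ X = baseEdge b c) ∨ ∃ b ∈ T, X = apexCone b b := by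
  cases h with
  | edge b c hb hc hbc => exact .inl ⟨b, hb, c, hc, hbc, rfl⟩
  | slant b hb => exact .inr ⟨b, hb, rfl⟩

theorem IsSummand.of_zero {T : Set ℝ} {X : Set (ℝ × ℝ)} (h : IsSummand T X 0) :
    X = {((0 : ℝ), (1 : ℝ))} ∨ ∃ b ∈ T, X = {(b, (0 : ℝ))} := by
  cases h with
  | apex => exact .inl rfl
  | base b hb => exact .inr ⟨b, hb, rfl⟩

/-! ### Cells crossed by the line at height 3/2 -/

namespace SliceState

/-- The points of the summands at the given position of the section at height `3 / 2`. -/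
noncomputable def point (s : SliceState) (i : Fin 3) : ℝ × ℝ :=
  if i = s.a then (s.x, 0) else if i = s.b then (s.y / 2, 1 / 2) else (0, 1)

/-- The position on the section. -/
noncomputable def pos (s : SliceState) : ℝ := s.x + s.y / 2

/-- The labels of the state are distinct. -/
def Distinct (s : SliceState) : Prop := s.a ≠ s.b ∧ s.a ≠ s.c ∧ s.b ≠ s.c

theorem sum_point {s : SliceState} (h : s.Distinct) : ∑ i, s.point i = (s.pos, 3 / 2) := by
  rw [sum_eq_of_distinct h.1 h.2.1 h.2.2]
  have h1 := h.1.symm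
  have h2 := h.2.1.symm
  have h3 := h.2.2.symm
  simp only [point, h1, h2, h3, if_true, if_false]
  ext <;> simp [pos]; norm_num

theorem point_mem {s : SliceState} (h : s.Distinct) {R : MinkowskiTriple}
    (ha : (s.x, 0) ∈ R s.a) (hb : (s.y / 2, 1 / 2) ∈ R s.b) (hc : (0, 1) ∈ R s.c) (i : Fin 3) :
    s.point i ∈ R i := by
  obtain ⟨h1, h2, h3⟩ := h
  have : i = s.a ∨ i = s.b ∨ i = s.c := by omega
  rcases this with rfl | rfl | rfl
  · simpa [point]
  · simpa [point, h1.symm] using hb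
  · simpa [point, h2.symm, h3.symm]

/-- The heights `0`, `1 / 2`, `1` of the three summands reveal the labels, and the first coordinates
then reveal the positions. -/
theorem eq_of_point_eq {s t : SliceState} (hs : s.Distinct) (ht : t.Distinct)
    (h : ∀ i, s.point i = t.point i) : s = t := by
  obtain ⟨s1, s2, s3⟩ := hs
  obtain ⟨t1, t2, t3⟩ := ht
  have key : ∀ i, (s.point i).2 = (t.point i).2 := fun i => by rw [h i]
  have hs' : ∀ i, (s.point i).2 = if i = s.a then 0 else if i = s.b then 1 / 2 else 1 := by
    intro i; unfold point; split_ifs <;> rfl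
  have ht' : ∀ i, (t.point i).2 = if i = t.a then 0 else if i = t.b then 1 / 2 else 1 := by
    intro i; unfold point; split_ifs <;> rfl
  simp only [hs', ht'] at key
  have ha : s.a = t.a := by
    have := key s.a
    by_contra hne
    simp only [if_true, hne, if_false] at this
    split_ifs at this <;> norm_num at this
  have hb : s.b = t.b := by
    have := key s.b
    by_contra hne
    have h' : s.b ≠ t.a := by rw [← ha]; exact s1.symm
    simp only [s1.symm, if_true, hne, h', if_false] at this
    norm_num at this
  have hc : s.c = t.c := by omega
  have hx := h s.a
  have hy := h s.b
  simp only [point, if_true, ha, hb, t1.symm, if_false] at hx hy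
  simp only [Prod.mk.injEq, and_true] at hx hy
  exact SliceState.ext ha hb hc hx (by linarith)

end SliceState

open SliceState MeasureTheory

theorem IsApexMixed.affDim_eq_zero {i : Fin 3} {R : MinkowskiTriple} (h : IsApexMixed i R) :
    affDim (R i) = 0 := by
  rw [h.1, affDim_singleton]

open Classical in
/-- The section at height `3 / 2` crosses the cell `R` from the state `s` to the state `t`. -/
structure IsCrossing (m M : Fin 3 → ℝ) (R : MinkowskiTriple) (s t : SliceState)
    (w : Fin 3 → ℝ) : Prop where
  step : Step s t w
  valid_left : s.Valid m M
  valid_right : t.Valid m M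
  mem_left : ∀ i, s.point i ∈ R i
  mem_right : ∀ i, t.point i ∈ R i
  pos_lt : s.pos < t.pos
  bounds : ∀ x, (x, 3 / 2) ∈ R.total → s.pos ≤ x ∧ x ≤ t.pos
  unique : ∀ q q' : Fin 3 → ℝ × ℝ, (∀ i, q i ∈ R i) → (∀ i, q' i ∈ R i) →
    ∑ i, q i = ∑ i, q' i → q = q'
  above : ∃ p ∈ R.total, 3 / 2 < p.2
  below : ∃ p ∈ R.total, p.2 < 3 / 2
  weight : ∀ i, w i = if IsApexMixed i R then volume.real R.total else 0

theorem slant_mem_iff {b : ℝ} {p : ℝ × ℝ} :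
    p ∈ apexCone b b ↔ 0 ≤ p.2 ∧ p.2 ≤ 1 ∧ p.1 = b * (1 - p.2) := by
  simp only [apexCone, Set.mem_ofPred_eq]
  constructor
  · rintro ⟨h1, h2, h3, h4⟩; exact ⟨h1, h2, le_antisymm h4 h3⟩
  · rintro ⟨h1, h2, h3⟩; exact ⟨h1, h2, h3.ge, h3.le⟩

section Crossing

variable {m M : Fin 3 → ℝ} {R : MinkowskiTriple} {a b c : Fin 3}

/-- Supplies the field `unique` of `IsCrossing` in each of the four cases: in a tight cell the
summation map is injective on the summands. -/
theorem unique_of_distinct (hab : a ≠ b) (hac : a ≠ c) (hbc : b ≠ c)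
    (h : ∀ p ∈ R a, ∀ p' ∈ R a, ∀ q ∈ R b, ∀ q' ∈ R b, ∀ r ∈ R c, ∀ r' ∈ R c,
      p.1 + q.1 + r.1 = p'.1 + q'.1 + r'.1 → p.2 + q.2 + r.2 = p'.2 + q'.2 + r'.2 →
      p = p' ∧ q = q' ∧ r = r') (q q' : Fin 3 → ℝ × ℝ) (hq : ∀ i, q i ∈ R i)
    (hq' : ∀ i, q' i ∈ R i) (hs : ∑ i, q i = ∑ i, q' i) : q = q' := by
  rw [sum_eq_of_distinct hab hac hbc, sum_eq_of_distinct hab hac hbc] at hs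
  obtain ⟨h1, h2, h3⟩ := h _ (hq a) _ (hq' a) _ (hq b) _ (hq' b) _ (hq c) _ (hq' c)
    (congrArg Prod.fst hs) (congrArg Prod.snd hs)
  funext i
  have : i = a ∨ i = b ∨ i = c := by omega
  rcases this with rfl | rfl | rfl <;> assumption

theorem volume_real_edge_slant (hab : a ≠ b) (hac : a ≠ c) (hbc : b ≠ c) {x x' y : ℝ}
    (hx : x ≤ x') (ha : R a = baseEdge x x') (hb : R b = apexCone y y)
    (hc : R c = {((0 : ℝ), (1 : ℝ))}) : volume.real R.total = x' - x := by
  have : R.total = {z | ∃ s t : ℝ, 0 ≤ s ∧ s ≤ 1 ∧ 0 ≤ t ∧ t ≤ 1 ∧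
      z = (x + y, 1) + s • ((x' - x, 0) : ℝ × ℝ) + t • ((-y, 1) : ℝ × ℝ)} := by
    ext z
    rw [MinkowskiTriple.mem_total_of_distinct hab hac hbc, ha, hb, hc, baseEdge_eq_segment hx,
      apexCone_self, segment_eq_image', segment_eq_image']
    simp only [Set.mem_image, Set.mem_Icc, Set.mem_singleton_iff, Set.mem_ofPred_eq]
    constructor
    · rintro ⟨_, ⟨s, hs, rfl⟩, _, ⟨t, ht, rfl⟩, _, rfl, rfl⟩
      refine ⟨s, 1 - t, hs.1, hs.2, by linarith, by linarith, ?_⟩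
      ext <;> simp <;> ring
    · rintro ⟨s, t, h1, h2, h3, h4, rfl⟩
      refine ⟨_, ⟨s, ⟨h1, h2⟩, rfl⟩, _, ⟨1 - t, ⟨by linarith, by linarith⟩, rfl⟩, _, rfl, ?_⟩
      ext <;> simp <;> ring
  rw [this, volume_real_parallelogram]
  simp [abs_of_nonneg (sub_nonneg.2 hx)]

theorem volume_real_slant_slant (hab : a ≠ b) (hac : a ≠ c) (hbc : b ≠ c) {x y : ℝ}
    (ha : R a = apexCone x x) (hb : R b = apexCone y y)
    (hc : R c = {((0 : ℝ), (1 : ℝ))}) : volume.real R.total = |y - x| := by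
  have : R.total = {z | ∃ s t : ℝ, 0 ≤ s ∧ s ≤ 1 ∧ 0 ≤ t ∧ t ≤ 1 ∧
      z = (0, 3) + s • ((x, -1) : ℝ × ℝ) + t • ((y, -1) : ℝ × ℝ)} := by
    ext z
    rw [MinkowskiTriple.mem_total_of_distinct hab hac hbc, ha, hb, hc,
      apexCone_self, apexCone_self, segment_eq_image', segment_eq_image']
    simp only [Set.mem_image, Set.mem_Icc, Set.mem_singleton_iff, Set.mem_ofPred_eq]
    constructor
    · rintro ⟨_, ⟨s, hs, rfl⟩, _, ⟨t, ht, rfl⟩, _, rfl, rfl⟩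
      refine ⟨s, t, hs.1, hs.2, ht.1, ht.2, ?_⟩
      ext <;> simp; ring
    · rintro ⟨s, t, h1, h2, h3, h4, rfl⟩
      refine ⟨_, ⟨s, ⟨h1, h2⟩, rfl⟩, _, ⟨t, ⟨h3, h4⟩, rfl⟩, _, rfl, ?_⟩
      ext <;> simp; ring
  rw [this, volume_real_parallelogram]
  congr 1
  simp; ring

open Classical in
theorem weight_eq_zero {w : Fin 3 → ℝ} (hw : w = 0) (h : ∀ i, ¬ IsApexMixed i R) (i : Fin 3) :
    w i = if IsApexMixed i R then volume.real R.total else 0 := by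
  rw [if_neg (h i), hw, Pi.zero_apply]

open Classical in
-- Only the label `c` can be the apex summand, since the other two summands are one-dimensional.
theorem weight_eq_single (hab : a ≠ b) (hac : a ≠ c) (hbc : b ≠ c) {v : ℝ}
    (ha : affDim (R a) = 1) (hb : affDim (R b) = 1) (hc : R c = {((0 : ℝ), (1 : ℝ))})
    (hv : volume.real R.total = v) (i : Fin 3) :
    (Pi.single c v : Fin 3 → ℝ) i = if IsApexMixed i R then volume.real R.total else 0 := by
  have : i = a ∨ i = b ∨ i = c := by omega
  rcases this with rfl | rfl | rfl
  · rw [if_neg (fun h => by have := h.affDim_eq_zero; omega), Pi.single_eq_of_ne hac]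
  · rw [if_neg (fun h => by have := h.affDim_eq_zero; omega), Pi.single_eq_of_ne hbc]
  · rw [if_pos, Pi.single_eq_same, hv]
    refine ⟨hc, fun j hj => ?_⟩
    have : j = a ∨ j = b := by omega
    rcases this with rfl | rfl <;> assumption

theorem singleton_base_ne_apex (x : ℝ) : ({(x, (0 : ℝ))} : Set (ℝ × ℝ)) ≠ {((0 : ℝ), (1 : ℝ))} := by
  intro h
  have := Set.singleton_eq_singleton_iff.1 h
  simp at this

theorem isCrossing_moveMid (hab : a ≠ b) (hac : a ≠ c) (hbc : b ≠ c) {x y y' : ℝ}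
    (hx : m a ≤ x ∧ x ≤ M a) (hy : m b ≤ y ∧ y' ≤ M b) (h : y < y')
    (ha : R a = {(x, (0 : ℝ))}) (hb : R b = apexCone y y')
    (hc : R c = {((0 : ℝ), (1 : ℝ))}) :
    IsCrossing m M R ⟨a, b, c, x, y⟩ ⟨a, b, c, x, y'⟩ 0 where
  step := .moveMid a b c x y y' h.le
  valid_left := ⟨⟨hab, hac, hbc⟩, hx, hy.1, h.le.trans hy.2⟩
  valid_right := ⟨⟨hab, hac, hbc⟩, hx, hy.1.trans h.le, hy.2⟩
  mem_left := point_mem ⟨hab, hac, hbc⟩ (by simp [ha])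
    (by simp only [hb]; refine ⟨?_, ?_, ?_, ?_⟩ <;> norm_num <;> linarith) (by simp [hc])
  mem_right := point_mem ⟨hab, hac, hbc⟩ (by simp [ha])
    (by simp only [hb]; refine ⟨?_, ?_, ?_, ?_⟩ <;> norm_num <;> linarith) (by simp [hc])
  pos_lt := by simp only [pos]; linarith
  bounds z hz := by
    rw [MinkowskiTriple.mem_total_of_distinct hab hac hbc, ha, hb, hc] at hz
    obtain ⟨_, rfl, q, ⟨h1, h2, h3, h4⟩, _, rfl, hq⟩ := hz
    rw [Prod.ext_iff] at hq
    simp only [Prod.fst_add, Prod.snd_add] at hq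
    obtain ⟨e1, e2⟩ := hq
    have : q.2 = 1 / 2 := by linarith
    rw [this] at h3 h4
    simp only [pos]
    constructor <;> linarith
  unique := unique_of_distinct hab hac hbc (by
    rw [ha, hc]
    rintro _ rfl _ rfl q - q' - _ rfl _ rfl h1 h2
    exact ⟨rfl, Prod.ext (by linarith) (by linarith), rfl⟩)
  above := ⟨(x, 0) + (0, 1) + (0, 1), (MinkowskiTriple.mem_total_of_distinct hab hac hbc).2
    ⟨_, by simp [ha], (0, 1), by simp [hb, apexCone], _, by simp [hc], rfl⟩, by norm_num⟩
  below := ⟨(x, 0) + (y, 0) + (0, 1), (MinkowskiTriple.mem_total_of_distinct hab hac hbc).2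
    ⟨_, by simp [ha], (y, 0), by simp [hb, apexCone, h.le], _, by simp [hc], rfl⟩, by norm_num⟩
  weight := weight_eq_zero rfl (by
    intro i hi
    have : i = a ∨ i = b ∨ i = c := by omega
    rcases this with rfl | rfl | rfl
    · exact singleton_base_ne_apex _ (ha.symm.trans hi.1)
    · have := hi.affDim_eq_zero
      rw [hb, affDim_apexCone h] at this
      simp at this
    · have := hi.2 b hbc
      rw [hb, affDim_apexCone h] at this
      simp at this)

theorem isCrossing_moveLow (hab : a ≠ b) (hac : a ≠ c) (hbc : b ≠ c) {x x' y : ℝ}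
    (hx : m a ≤ x ∧ x' ≤ M a) (hy : m b ≤ y ∧ y ≤ M b) (h : x < x')
    (ha : R a = baseEdge x x') (hb : R b = apexCone y y)
    (hc : R c = {((0 : ℝ), (1 : ℝ))}) :
    IsCrossing m M R ⟨a, b, c, x, y⟩ ⟨a, b, c, x', y⟩ (Pi.single c (x' - x)) where
  step := .moveLow a b c x x' y h.le
  valid_left := ⟨⟨hab, hac, hbc⟩, ⟨hx.1, h.le.trans hx.2⟩, hy⟩
  valid_right := ⟨⟨hab, hac, hbc⟩, ⟨hx.1.trans h.le, hx.2⟩, hy⟩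
  mem_left := point_mem ⟨hab, hac, hbc⟩ (by simp [ha, baseEdge, h.le])
    (by simp only [hb]; refine ⟨?_, ?_, ?_, ?_⟩ <;> norm_num <;> linarith) (by simp [hc])
  mem_right := point_mem ⟨hab, hac, hbc⟩ (by simp [ha, baseEdge, h.le])
    (by simp only [hb]; refine ⟨?_, ?_, ?_, ?_⟩ <;> norm_num <;> linarith) (by simp [hc])
  pos_lt := by simp only [pos]; linarith
  bounds z hz := by
    rw [MinkowskiTriple.mem_total_of_distinct hab hac hbc, ha, hb, hc] at hz
    obtain ⟨p, ⟨k1, k2, k3⟩, q, hq', _, rfl, hq⟩ := hz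
    obtain ⟨-, -, h3⟩ := slant_mem_iff.1 hq'
    rw [Prod.ext_iff] at hq
    simp only [Prod.fst_add, Prod.snd_add] at hq
    obtain ⟨e1, e2⟩ := hq
    have : q.2 = 1 / 2 := by linarith
    rw [this] at h3
    simp only [pos]
    constructor <;> linarith
  unique := unique_of_distinct hab hac hbc (by
    rw [ha, hb, hc]
    rintro p ⟨-, -, hp⟩ p' ⟨-, -, hp'⟩ q hq q' hq' _ rfl _ rfl h1 h2
    have h3 : q.2 = q'.2 := by linarith
    have h4 : q.1 = q'.1 := by rw [(slant_mem_iff.1 hq).2.2, (slant_mem_iff.1 hq').2.2, h3]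
    exact ⟨Prod.ext (by linarith) (by linarith), Prod.ext h4 h3, rfl⟩)
  above := ⟨(x, 0) + (0, 1) + (0, 1), (MinkowskiTriple.mem_total_of_distinct hab hac hbc).2
    ⟨_, by simp [ha, baseEdge, h.le], (0, 1), by simp [hb, apexCone], _, by simp [hc], rfl⟩,
    by norm_num⟩
  below := ⟨(x, 0) + (y, 0) + (0, 1), (MinkowskiTriple.mem_total_of_distinct hab hac hbc).2
    ⟨_, by simp [ha, baseEdge, h.le], (y, 0), by simp [hb, apexCone], _, by simp [hc], rfl⟩,
    by norm_num⟩
  weight := weight_eq_single hab hac hbc (by rw [ha, affDim_baseEdge h])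
    (by rw [hb, affDim_apexCone_self]) hc (volume_real_edge_slant hab hac hbc h.le ha hb hc)

/-- The parallelogram has corners `(x + y, 1)`, `(x, 2)`, `(y, 2)`, `(0, 3)`. The section enters
through the edge from `(x + y, 1)` to `(x, 2)` and leaves through the one to `(y, 2)`, so the labels
of base and slanted edge are exchanged. -/
theorem isCrossing_swapLow (hab : a ≠ b) (hac : a ≠ c) (hbc : b ≠ c) {x y : ℝ}
    (hx : m a ≤ x ∧ x ≤ M a) (hy : m b ≤ y ∧ y ≤ M b) (h : x < y)
    (ha : R a = apexCone x x) (hb : R b = apexCone y y)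
    (hc : R c = {((0 : ℝ), (1 : ℝ))}) :
    IsCrossing m M R ⟨a, b, c, x, y⟩ ⟨b, a, c, y, x⟩ (Pi.single c (y - x)) where
  step := .swapLow a b c x y h.le
  valid_left := ⟨⟨hab, hac, hbc⟩, hx, hy⟩
  valid_right := ⟨⟨hab.symm, hbc, hac⟩, hy, hx⟩
  mem_left := point_mem ⟨hab, hac, hbc⟩ (by simp [ha, apexCone])
    (by simp only [hb]; refine ⟨?_, ?_, ?_, ?_⟩ <;> norm_num <;> linarith) (by simp [hc])
  mem_right := point_mem ⟨hab.symm, hbc, hac⟩ (by simp [hb, apexCone])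
    (by simp only [ha]; refine ⟨?_, ?_, ?_, ?_⟩ <;> norm_num <;> linarith) (by simp [hc])
  pos_lt := by simp only [pos]; linarith
  bounds z hz := by
    rw [MinkowskiTriple.mem_total_of_distinct hab hac hbc, ha, hb, hc] at hz
    obtain ⟨p, hp, q, hq', _, rfl, hq⟩ := hz
    obtain ⟨h1, h2, h3⟩ := slant_mem_iff.1 hq'
    obtain ⟨k1, k2, k3⟩ := slant_mem_iff.1 hp
    rw [Prod.ext_iff] at hq
    simp only [Prod.fst_add, Prod.snd_add] at hq
    obtain ⟨e1, e2⟩ := hq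
    have e3 : q.2 = 1 / 2 - p.2 := by linarith
    rw [e3] at h1 h2 h3
    simp only [pos]
    constructor <;> nlinarith
  unique := unique_of_distinct hab hac hbc (by
    rw [ha, hb, hc]
    rintro p hp p' hp' q hq q' hq' _ rfl _ rfl h1 h2
    have e1 := (slant_mem_iff.1 hp).2.2
    have e2 := (slant_mem_iff.1 hp').2.2
    have e3 := (slant_mem_iff.1 hq).2.2
    have e4 := (slant_mem_iff.1 hq').2.2
    have h3 : (y - x) * (q.2 - q'.2) = 0 := by
      have : p.2 = p'.2 + q'.2 - q.2 := by linarith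
      rw [e1, e2, e3, e4, this] at h1
      linarith
    have h4 : q.2 = q'.2 := by
      rcases mul_eq_zero.1 h3 with h | h <;> linarith
    have h5 : p.2 = p'.2 := by linarith
    exact ⟨Prod.ext (by rw [e1, e2, h5]) h5, Prod.ext (by rw [e3, e4, h4]) h4, rfl⟩)
  above := ⟨(x, 0) + (0, 1) + (0, 1), (MinkowskiTriple.mem_total_of_distinct hab hac hbc).2
    ⟨_, by simp [ha, apexCone], (0, 1), by simp [hb, apexCone], _, by simp [hc], rfl⟩,
    by norm_num⟩
  below := ⟨(x, 0) + (y, 0) + (0, 1), (MinkowskiTriple.mem_total_of_distinct hab hac hbc).2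
    ⟨_, by simp [ha, apexCone], (y, 0), by simp [hb, apexCone], _, by simp [hc], rfl⟩,
    by norm_num⟩
  weight := weight_eq_single hab hac hbc (by rw [ha, affDim_apexCone_self])
    (by rw [hb, affDim_apexCone_self]) hc (by
      rw [volume_real_slant_slant hab hac hbc ha hb hc, abs_of_pos (by linarith)])

/-- The parallelogram has corners `(x + y + z, 0)`, `(x + y, 1)`, `(x + z, 1)`, `(x, 2)`. The
section cuts off its top corner, so the slanted edge and the apex exchange labels. -/
theorem isCrossing_swapTop (hab : a ≠ b) (hac : a ≠ c) (hbc : b ≠ c) {x y z : ℝ}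
    (hx : m a ≤ x ∧ x ≤ M a) (hy : m b ≤ y ∧ y ≤ M b) (hz : m c ≤ z ∧ z ≤ M c) (h : y < z)
    (ha : R a = {(x, (0 : ℝ))}) (hb : R b = apexCone y y)
    (hc : R c = apexCone z z) :
    IsCrossing m M R ⟨a, b, c, x, y⟩ ⟨a, c, b, x, z⟩ 0 where
  step := .swapTop a b c x y z h.le
  valid_left := ⟨⟨hab, hac, hbc⟩, hx, hy⟩
  valid_right := ⟨⟨hac, hab, hbc.symm⟩, hx, hz⟩
  mem_left := point_mem ⟨hab, hac, hbc⟩ (by simp [ha])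
    (by simp only [hb]; refine ⟨?_, ?_, ?_, ?_⟩ <;> norm_num <;> linarith)
    (by simp [hc, apexCone])
  mem_right := point_mem ⟨hac, hab, hbc.symm⟩ (by simp [ha])
    (by simp only [hc]; refine ⟨?_, ?_, ?_, ?_⟩ <;> norm_num <;> linarith)
    (by simp [hb, apexCone])
  pos_lt := by simp only [pos]; linarith
  bounds z hz := by
    rw [MinkowskiTriple.mem_total_of_distinct hab hac hbc, ha, hb, hc] at hz
    obtain ⟨_, rfl, p, hp, q, hq', hq⟩ := hz
    obtain ⟨h1, h2, h3⟩ := slant_mem_iff.1 hq'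
    obtain ⟨k1, k2, k3⟩ := slant_mem_iff.1 hp
    rw [Prod.ext_iff] at hq
    simp only [Prod.fst_add, Prod.snd_add] at hq
    obtain ⟨e1, e2⟩ := hq
    have e3 : q.2 = 3 / 2 - p.2 := by linarith
    rw [e3] at h1 h2 h3
    simp only [pos]
    constructor <;> nlinarith
  unique := unique_of_distinct hab hac hbc (by
    rw [ha, hb, hc]
    rintro _ rfl _ rfl p hp p' hp' q hq q' hq' h1 h2
    have e1 := (slant_mem_iff.1 hp).2.2
    have e2 := (slant_mem_iff.1 hp').2.2
    have e3 := (slant_mem_iff.1 hq).2.2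
    have e4 := (slant_mem_iff.1 hq').2.2
    have h3 : (z - y) * (q.2 - q'.2) = 0 := by
      have : p.2 = p'.2 + q'.2 - q.2 := by linarith
      rw [e1, e2, e3, e4, this] at h1
      linarith
    have h4 : q.2 = q'.2 := by
      rcases mul_eq_zero.1 h3 with h | h <;> linarith
    have h5 : p.2 = p'.2 := by linarith
    exact ⟨rfl, Prod.ext (by rw [e1, e2, h5]) h5, Prod.ext (by rw [e3, e4, h4]) h4⟩)
  above := ⟨(x, 0) + (0, 1) + (0, 1), (MinkowskiTriple.mem_total_of_distinct hab hac hbc).2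
    ⟨_, by simp [ha], (0, 1), by simp [hb, apexCone], (0, 1), by simp [hc, apexCone], rfl⟩,
    by norm_num⟩
  below := ⟨(x, 0) + (y, 0) + (z, 0), (MinkowskiTriple.mem_total_of_distinct hab hac hbc).2
    ⟨_, by simp [ha], (y, 0), by simp [hb, apexCone], (z, 0), by simp [hc, apexCone], rfl⟩,
    by norm_num⟩
  weight := weight_eq_zero rfl (by
    intro i hi
    have : i = a ∨ i = b ∨ i = c := by omega
    rcases this with rfl | rfl | rfl
    · exact singleton_base_ne_apex _ (ha.symm.trans hi.1)
    · have := hi.affDim_eq_zero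
      rw [hb, affDim_apexCone_self] at this
      simp at this
    · have := hi.affDim_eq_zero
      rw [hc, affDim_apexCone_self] at this
      simp at this)

/-- The cell does not meet the section and does not contribute to the exponents. -/
def IsOffSection (R : MinkowskiTriple) : Prop :=
  (∀ p ∈ R.total, p.2 ≠ 3 / 2) ∧ ∀ i, ¬ IsApexMixed i R

theorem isOffSection_triangle (hab : a ≠ b) (hac : a ≠ c) (hbc : b ≠ c) {x x' h : ℝ}
    (hx : x < x') (ha : R a = apexCone x x') (hh : h ≤ 0 ∨ 2 ≤ h)
    (hb : ∀ p ∈ R b, ∀ q ∈ R c, p.2 + q.2 = h) : IsOffSection R := by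
  constructor
  · intro p hp hp'
    rw [MinkowskiTriple.mem_total_of_distinct hab hac hbc, ha] at hp
    obtain ⟨u, ⟨h1, h2, -, -⟩, v, hv, w, hw, rfl⟩ := hp
    have := hb v hv w hw
    simp only [Prod.snd_add] at hp'
    rcases hh with hh | hh <;> linarith
  · intro i hi
    by_cases hia : i = a
    · subst hia
      have := hi.affDim_eq_zero
      rw [ha, affDim_apexCone hx] at this
      simp at this
    · have := hi.2 a (Ne.symm hia)
      rw [ha, affDim_apexCone hx] at this
      simp at this

theorem isOffSection_edge_slant (hab : a ≠ b) (hac : a ≠ c) (hbc : b ≠ c) {x y y' z : ℝ}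
    (hy : y < y') (ha : R a = {(x, (0 : ℝ))}) (hb : R b = baseEdge y y')
    (hc : R c = apexCone z z) : IsOffSection R := by
  constructor
  · intro p hp hp'
    rw [MinkowskiTriple.mem_total_of_distinct hab hac hbc, ha, hb, hc] at hp
    obtain ⟨_, rfl, v, ⟨-, -, hv⟩, w, ⟨-, hw, -, -⟩, rfl⟩ := hp
    simp only [Prod.snd_add] at hp'
    linarith
  · intro i hi
    have : i = a ∨ i = b ∨ i = c := by omega
    rcases this with rfl | rfl | rfl
    · exact singleton_base_ne_apex _ (ha.symm.trans hi.1)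
    · have := hi.affDim_eq_zero
      rw [hb, affDim_baseEdge hy] at this
      simp at this
    · have := hi.affDim_eq_zero
      rw [hc, affDim_apexCone_self] at this
      simp at this

/-- Every cell of a tight mixed subdivision is crossed by the section, or does not matter. -/
theorem exists_isCrossing_or_isOffSection {T : Fin 3 → Set ℝ} {d : Fin 3 → ℕ}
    (hT : ∀ i, ∀ x ∈ T i, m i ≤ x ∧ x ≤ M i) (hR : ∀ i, IsSummand (T i) (R i) (d i))
    (h2 : affDim R.total = 2) (hd : ∑ i, d i = 2) :
    (∃ s t w, IsCrossing m M R s t w) ∨ IsOffSection R := by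
  have hdim : (∃ i j k, i ≠ j ∧ i ≠ k ∧ j ≠ k ∧ d i = 2 ∧ d j = 0 ∧ d k = 0) ∨
      (∃ i j k, i ≠ j ∧ i ≠ k ∧ j ≠ k ∧ d i = 0 ∧ d j = 1 ∧ d k = 1) := by
    rw [Fin.sum_univ_three] at hd
    have : (d 0 = 2 ∧ d 1 = 0 ∧ d 2 = 0) ∨ (d 0 = 0 ∧ d 1 = 2 ∧ d 2 = 0) ∨
      (d 0 = 0 ∧ d 1 = 0 ∧ d 2 = 2) ∨ (d 0 = 0 ∧ d 1 = 1 ∧ d 2 = 1) ∨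
      (d 0 = 1 ∧ d 1 = 0 ∧ d 2 = 1) ∨ (d 0 = 1 ∧ d 1 = 1 ∧ d 2 = 0) := by omega
    rcases this with h | h | h | h | h | h
    · exact .inl ⟨0, 1, 2, by decide, by decide, by decide, h.1, h.2.1, h.2.2⟩
    · exact .inl ⟨1, 0, 2, by decide, by decide, by decide, h.2.1, h.1, h.2.2⟩
    · exact .inl ⟨2, 0, 1, by decide, by decide, by decide, h.2.2, h.1, h.2.1⟩
    · exact .inr ⟨0, 1, 2, by decide, by decide, by decide, h.1, h.2.1, h.2.2⟩
    · exact .inr ⟨1, 0, 2, by decide, by decide, by decide, h.2.1, h.1, h.2.2⟩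
    · exact .inr ⟨2, 0, 1, by decide, by decide, by decide, h.2.2, h.1, h.2.1⟩
  rcases hdim with ⟨i, j, k, hij, hik, hjk, di, dj, dk⟩ | ⟨i, j, k, hij, hik, hjk, di, dj, dk⟩
  · obtain ⟨x, hx, x', hx', hxx, Ri⟩ := (di ▸ hR i).of_two
    have bi : m i ≤ x ∧ x' ≤ M i := ⟨(hT i x hx).1, (hT i x' hx').2⟩
    rcases (dj ▸ hR j).of_zero with Rj | ⟨y, hy, Rj⟩ <;>
      rcases (dk ▸ hR k).of_zero with Rk | ⟨z, hz, Rk⟩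
    · right
      apply isOffSection_triangle hij hik hjk hxx Ri (h := 2) (by norm_num)
      rw [Rj, Rk]; rintro _ rfl _ rfl; norm_num
    · exact .inl ⟨_, _, _, isCrossing_moveMid hik.symm hjk.symm hij (hT k z hz) bi hxx Rk Ri Rj⟩
    · exact .inl ⟨_, _, _, isCrossing_moveMid hij.symm hjk hik (hT j y hy) bi hxx Rj Ri Rk⟩
    · right
      apply isOffSection_triangle hij hik hjk hxx Ri (h := 0) (by norm_num)
      rw [Rj, Rk]; rintro _ rfl _ rfl; norm_num
  · rcases (dj ▸ hR j).of_one with ⟨y, hy, y', hy', hyy, Rj⟩ | ⟨y, hy, Rj⟩ <;>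
      rcases (dk ▸ hR k).of_one with ⟨z, hz, z', hz', hzz, Rk⟩ | ⟨z, hz, Rk⟩
    -- Two base edges and a point give a horizontal segment, which is not a cell.
    · exfalso
      have := eq_zero_of_affDim_eq_two h2 (LinearMap.snd ℝ ℝ ℝ) (by
        have hi : ∃ r, ∀ p ∈ R i, p.2 = r := by
          rcases (di ▸ hR i).of_zero with Ri | ⟨x, hx, Ri⟩
          · exact ⟨1, by rw [Ri]; rintro _ rfl; rfl⟩
          · exact ⟨0, by rw [Ri]; rintro _ rfl; rfl⟩
        obtain ⟨r, hr⟩ := hi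
        have key : ∀ p ∈ R.total, p.2 = r := by
          intro p hp
          rw [MinkowskiTriple.mem_total_of_distinct hij hik hjk, Rj, Rk] at hp
          obtain ⟨u, hu, v, ⟨-, -, hv⟩, w, ⟨-, -, hw⟩, rfl⟩ := hp
          simp [hr u hu, hv, hw]
        intro p hp q hq
        simp [key p hp, key q hq])
      have := LinearMap.congr_fun this (0, 1)
      simp at this
    · have bj : m j ≤ y ∧ y' ≤ M j := ⟨(hT j y hy).1, (hT j y' hy').2⟩
      rcases (di ▸ hR i).of_zero with Ri | ⟨x, hx, Ri⟩
      · exact .inl ⟨_, _, _, isCrossing_moveLow hjk hij.symm hik.symm bj (hT k z hz) hyy Rj Rk Ri⟩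
      · exact .inr (isOffSection_edge_slant hij hik hjk hyy Ri Rj Rk)
    · have bk : m k ≤ z ∧ z' ≤ M k := ⟨(hT k z hz).1, (hT k z' hz').2⟩
      rcases (di ▸ hR i).of_zero with Ri | ⟨x, hx, Ri⟩
      · exact .inl ⟨_, _, _, isCrossing_moveLow hjk.symm hik.symm hij.symm bk (hT j y hy) hzz
          Rk Rj Ri⟩
      · exact .inr (isOffSection_edge_slant hik hij hjk.symm hzz Ri Rk Rj)
    · rcases lt_trichotomy y z with hyz | hyz | hyz
      · rcases (di ▸ hR i).of_zero with Ri | ⟨x, hx, Ri⟩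
        · exact .inl ⟨_, _, _, isCrossing_swapLow hjk hij.symm hik.symm (hT j y hy) (hT k z hz) hyz
            Rj Rk Ri⟩
        · exact .inl ⟨_, _, _, isCrossing_swapTop hij hik hjk (hT i x hx) (hT j y hy) (hT k z hz)
            hyz Ri Rj Rk⟩
      -- Two slanted edges over the same exponent are parallel, so the sum lies on a line on which
      -- `p.1 + y * p.2` is constant.
      · exfalso
        subst hyz
        have := eq_zero_of_affDim_eq_two h2 (LinearMap.fst ℝ ℝ ℝ + y • LinearMap.snd ℝ ℝ ℝ) (by
          have hi : ∃ r, ∀ p ∈ R i, p.1 + y * p.2 = r := by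
            rcases (di ▸ hR i).of_zero with Ri | ⟨x, hx, Ri⟩
            · exact ⟨y, by rw [Ri]; rintro _ rfl; simp⟩
            · exact ⟨x, by rw [Ri]; rintro _ rfl; simp⟩
          obtain ⟨r, hr⟩ := hi
          have key : ∀ p ∈ R.total, p.1 + y * p.2 = r + y + y := by
            intro p hp
            rw [MinkowskiTriple.mem_total_of_distinct hij hik hjk, Rj, Rk] at hp
            obtain ⟨u, hu, v, hv, w, hw, rfl⟩ := hp
            have e1 := (slant_mem_iff.1 hv).2.2
            have e2 := (slant_mem_iff.1 hw).2.2
            simp only [Prod.fst_add, Prod.snd_add, e1, e2, ← hr u hu]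
            ring
          intro p hp q hq
          simp [key p hp, key q hq])
        have := LinearMap.congr_fun this (1, 0)
        simp at this
      · rcases (di ▸ hR i).of_zero with Ri | ⟨x, hx, Ri⟩
        · exact .inl ⟨_, _, _, isCrossing_swapLow hjk.symm hik.symm hij.symm (hT k z hz) (hT j y hy)
            hyz Rk Rj Ri⟩
        · exact .inl ⟨_, _, _, isCrossing_swapTop hik hij hjk.symm (hT i x hx) (hT k z hz)
            (hT j y hy) hyz Ri Rk Rj⟩

end Crossing

/-! ### From a tight mixed subdivision to a path -/

/-- The exponents as real numbers. -/
def realSupport (B : Fin 3 → Finset ℕ) (i : Fin 3) : Set ℝ := (fun b : ℕ => (b : ℝ)) '' (B i)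

theorem finite_realSupport (B : Fin 3 → Finset ℕ) (i : Fin 3) : (realSupport B i).Finite :=
  (B i).finite_toSet.image _

theorem curveSupports_eq (B : Fin 3 → Finset ℕ) (i : Fin 3) :
    curveSupports B i = insert ((0 : ℝ), (1 : ℝ)) ((fun b => (b, (0 : ℝ))) '' realSupport B i) := by
  ext p
  simp only [curveSupports, realSupport, Set.mem_insert_iff, Set.mem_ofPred_eq, Set.mem_image,
    Finset.mem_coe, exists_exists_and_eq_and]
  constructor
  · rintro (h | ⟨b, hb, rfl⟩)
    · exact .inl h
    · exact .inr ⟨b, hb, rfl⟩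
  · rintro (h | ⟨b, hb, rfl⟩)
    · exact .inl h
    · exact .inr ⟨b, hb, rfl⟩

theorem convex_total {R : MinkowskiTriple} (h : ∀ i, Convex ℝ (R i)) : Convex ℝ R.total :=
  ((h 0).add (h 1)).add (h 2)

theorem IsMinkowskiCell.convex {A R : MinkowskiTriple} (h : IsMinkowskiCell A R) :
    Convex ℝ R.total := by
  refine convex_total fun i => ?_
  obtain ⟨V, -, -, hV⟩ := h.1 i
  rw [hV]
  exact convex_convexHull ℝ V

theorem MinkowskiTriple.IsFace.subset {F R : MinkowskiTriple} (h : F.IsFace R) (i : Fin 3) :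
    F i ⊆ R i := by
  obtain ⟨l, hl⟩ := h
  rw [hl i]
  exact fun x hx => hx.1

section Subdivision

variable {m M : Fin 3 → ℝ} {R R' : MinkowskiTriple} {s t s' t' : SliceState} {w w' : Fin 3 → ℝ}

theorem IsCrossing.left_mem_total (h : IsCrossing m M R s t w) : (s.pos, 3 / 2) ∈ R.total := by
  rw [MinkowskiTriple.mem_total]
  exact ⟨s.point, h.mem_left, sum_point h.valid_left.1⟩

theorem IsCrossing.right_mem_total (h : IsCrossing m M R s t w) : (t.pos, 3 / 2) ∈ R.total := by
  rw [MinkowskiTriple.mem_total]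
  exact ⟨t.point, h.mem_right, sum_point h.valid_right.1⟩

theorem IsCrossing.mem_total (h : IsCrossing m M R s t w) (hc : Convex ℝ R.total) {x : ℝ}
    (h1 : s.pos ≤ x) (h2 : x ≤ t.pos) : (x, 3 / 2) ∈ R.total := by
  apply hc.segment_subset h.left_mem_total h.right_mem_total
  rw [← Prod.image_mk_segment_left, segment_eq_Icc h.pos_lt.le]
  exact ⟨x, ⟨h1, h2⟩, rfl⟩

/-- A face which contains an interior point of the section of a cell is the whole cell. -/
theorem IsCrossing.face_eq (h : IsCrossing m M R s t w) {F : MinkowskiTriple} (hF : F.IsFace R)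
    {x : ℝ} (h1 : s.pos < x) (h2 : x < t.pos) (hx : (x, 3 / 2) ∈ F.total) : F = R := by
  obtain ⟨l, hl⟩ := hF
  have key : ∀ p ∈ R.total, l p ≤ l (x, 3 / 2) := by
    intro p hp
    rw [MinkowskiTriple.mem_total] at hp hx
    obtain ⟨q, hq, rfl⟩ := hp
    obtain ⟨q', hq', hs⟩ := hx
    rw [← hs, map_sum, map_sum]
    refine Finset.sum_le_sum fun i _ => ?_
    have := hq' i
    rw [hl i] at this
    exact this.2 _ (hq i)
  have hlin : ∀ p : ℝ × ℝ, l p = l (1, 0) * p.1 + l (0, 1) * p.2 := by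
    intro p
    have : p = p.1 • ((1, 0) : ℝ × ℝ) + p.2 • ((0, 1) : ℝ × ℝ) := by ext <;> simp
    conv_lhs => rw [this]
    rw [map_add, map_smul, map_smul, smul_eq_mul, smul_eq_mul]; ring
  have k1 := key _ h.left_mem_total
  have k2 := key _ h.right_mem_total
  obtain ⟨p, hp, hp'⟩ := h.above
  obtain ⟨q, hq, hq'⟩ := h.below
  have k3 := key p hp
  have k4 := key q hq
  rw [hlin, hlin (x, _)] at k1 k2 k3 k4
  simp only at k1 k2 k3 k4
  -- The functional is maximal at a point with cell points to its left and right on the section.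
  -- Once its horizontal part vanishes, the cell points above and below the section eliminate the
  -- vertical part.
  have z1 : l (1, 0) = 0 := by
    apply le_antisymm
    · by_contra! hc; nlinarith
    · by_contra! hc; nlinarith
  rw [z1] at k3 k4
  have z2 : l (0, 1) = 0 := by
    apply le_antisymm
    · by_contra! hc; nlinarith
    · by_contra! hc; nlinarith
  funext i
  rw [hl i]
  ext p
  simp only [ContinuousLinearMap.toExposed, Set.mem_ofPred_eq]
  constructor
  · exact fun h => h.1
  · intro hp
    refine ⟨hp, fun r _ => ?_⟩
    rw [hlin, hlin p, z1, z2]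
    simp

/-- A common point interior to both pieces of the section lies on a common face, and such a face is
the whole of each cell. -/
theorem IsCrossing.eq_of_overlap (h : IsCrossing m M R s t w) (h' : IsCrossing m M R' s' t' w')
    (hc : Convex ℝ R.total) (hc' : Convex ℝ R'.total) (hR : IntersectProperly R R')
    (hlt : max s.pos s'.pos < min t.pos t'.pos) : R = R' := by
  obtain ⟨x, hx1, hx2⟩ := exists_between hlt
  rw [max_lt_iff] at hx1
  rw [lt_min_iff] at hx2
  have m1 := h.mem_total hc hx1.1.le hx2.1.le
  have m2 := h'.mem_total hc' hx1.2.le hx2.2.le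
  obtain ⟨F, hF, hF', hFt⟩ := hR.2 ⟨_, m1, m2⟩
  have hx : (x, (3 / 2 : ℝ)) ∈ F.total := by rw [← hFt]; exact ⟨m1, m2⟩
  rw [← h.face_eq hF hx1.1 hx2.1 hx, h'.face_eq hF' hx1.2 hx2.2 hx]

/-- Both decompositions agree with the one through the common face, which has the same description
in both cells. This identifies the exit state of a cell with the entry state of its neighbour. -/
theorem IsCrossing.decomposition_eq (h : IsCrossing m M R s t w)
    (h' : IsCrossing m M R' s' t' w') (hR : IntersectProperly R R') {q q' : Fin 3 → ℝ × ℝ}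
    (hq : ∀ i, q i ∈ R i) (hq' : ∀ i, q' i ∈ R' i) (hs : ∑ i, q i = ∑ i, q' i) : q = q' := by
  have m1 : ∑ i, q i ∈ R.total := MinkowskiTriple.mem_total.2 ⟨q, hq, rfl⟩
  have m2 : ∑ i, q i ∈ R'.total := MinkowskiTriple.mem_total.2 ⟨q', hq', hs.symm⟩
  obtain ⟨F, hF, hF', hFt⟩ := hR.2 ⟨_, m1, m2⟩
  have hx : ∑ i, q i ∈ F.total := by rw [← hFt]; exact ⟨m1, m2⟩
  obtain ⟨r, hr, hr'⟩ := MinkowskiTriple.mem_total.1 hx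
  rw [h.unique q r hq (fun i => hF.subset i (hr i)) hr'.symm,
    h'.unique q' r hq' (fun i => hF'.subset i (hr i)) (by rw [hr', hs])]

end Subdivision

theorem exists_lt_forall_lt (F : Finset ℝ) (a : ℝ) : ∃ x < a, ∀ y ∈ F, y < a → y < x := by
  have h : ∀ᶠ x in nhdsWithin a (Set.Iio a), ∀ y ∈ F, y < a → y < x := by
    rw [Filter.eventually_all_finset]
    intro y _
    by_cases hy : y < a
    · filter_upwards [Ioo_mem_nhdsLT hy] with x hx _ using hx.1
    · exact Filter.Eventually.of_forall fun x h => absurd h hy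
  obtain ⟨x, hx, hx'⟩ := (h.and self_mem_nhdsWithin).exists
  exact ⟨x, hx', hx⟩

theorem isSummand_of_isMinkowskiCell {B : Fin 3 → Finset ℕ} {R : MinkowskiTriple}
    (h : IsMinkowskiCell (curveSupports B) R) (i : Fin 3) :
    IsSummand (realSupport B i) (R i) (affDim (R i)) := by
  obtain ⟨V, hV, hne, hR⟩ := h.1 i
  rw [hR]
  rw [curveSupports_eq] at hV
  exact isSummand_convexHull (finite_realSupport B i) hV hne

theorem base_slant_mem {B : Fin 3 → Finset ℕ} {i j : Fin 3} (hij : i ≠ j) {x y : ℝ}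
    (hx : x ∈ realSupport B i) (hy : y ∈ realSupport B j) :
    (x + y / 2, (3 / 2 : ℝ)) ∈
      MinkowskiTriple.total (fun i => convexHull ℝ (curveSupports B i)) := by
  obtain ⟨k, hik, hjk⟩ : ∃ k : Fin 3, i ≠ k ∧ j ≠ k := by
    have : ∀ i j : Fin 3, ∃ k : Fin 3, i ≠ k ∧ j ≠ k := by decide
    exact this i j
  have apex : ∀ l, ((0 : ℝ), (1 : ℝ)) ∈ convexHull ℝ (curveSupports B l) := fun l =>
    subset_convexHull _ _ (by rw [curveSupports_eq]; exact .inl rfl)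
  have base : ∀ l, ∀ x ∈ realSupport B l, (x, (0 : ℝ)) ∈ convexHull ℝ (curveSupports B l) :=
    fun l x hx => subset_convexHull _ _ (by rw [curveSupports_eq]; exact .inr ⟨x, hx, rfl⟩)
  rw [MinkowskiTriple.mem_total_of_distinct hij hik hjk]
  refine ⟨_, base i x hx, _, (convex_convexHull ℝ _) (base j y hy) (apex j)
    (by norm_num : (0 : ℝ) ≤ 1 / 2) (by norm_num : (0 : ℝ) ≤ 1 / 2) (by norm_num), _, apex k, ?_⟩
  ext <;> simp <;> ring

/-- A valid state satisfies `m a + m b / 2 ≤ pos`. Comparison with the positions for the label pairs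
`(a, b)`, `(b, a)` and `(c, b)` forces `x = m a` and makes `m a` the least left end. -/
theorem left_end_eq {m M : Fin 3 → ℝ} {s : SliceState} (hs : s.Valid m M)
    (h : ∀ i j, i ≠ j → s.pos ≤ m i + m j / 2) : s.x = m s.a ∧ ∀ i, m s.a ≤ m i := by
  obtain ⟨⟨h1, h2, h3⟩, ⟨h4, -⟩, h5, -⟩ := hs
  have e1 := h s.a s.b h1
  have e2 := h s.b s.a h1.symm
  have e3 := h s.c s.b h3.symm
  simp only [pos] at *
  refine ⟨by linarith, fun i => ?_⟩
  have : i = s.a ∨ i = s.b ∨ i = s.c := by omega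
  rcases this with rfl | rfl | rfl <;> linarith

theorem right_end_eq {m M : Fin 3 → ℝ} {s : SliceState} (hs : s.Valid m M)
    (h : ∀ i j, i ≠ j → M i + M j / 2 ≤ s.pos) : s.x = M s.a ∧ ∀ i, M i ≤ M s.a := by
  obtain ⟨⟨h1, h2, h3⟩, ⟨-, h4⟩, -, h5⟩ := hs
  have e1 := h s.a s.b h1
  have e2 := h s.b s.a h1.symm
  have e3 := h s.c s.b h3.symm
  simp only [pos] at *
  refine ⟨by linarith, fun i => ?_⟩
  have : i = s.a ∨ i = s.b ∨ i = s.c := by omega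
  rcases this with rfl | rfl | rfl <;> linarith

/-- The section at height `3 / 2` of a tight mixed subdivision is a path from its left end to its
right end, which collects the exponents. -/
theorem IsTightMixedSubdivision.exists_path {B : Fin 3 → Finset ℕ} {S : Finset MinkowskiTriple}
    (hS : IsTightMixedSubdivision (curveSupports B) S) {m M : Fin 3 → ℝ}
    (hm : ∀ i, IsLeast (realSupport B i) (m i)) (hM : ∀ i, IsGreatest (realSupport B i) (M i)) :
    ∃ s t, Path m M s t (mixedExponent S) ∧ s.x = m s.a ∧ (∀ i, m s.a ≤ m i) ∧
      t.x = M t.a ∧ ∀ i, M i ≤ M t.a := by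
  classical
  obtain ⟨⟨hcell, hcover, hprop⟩, htight⟩ := hS
  have hcases : ∀ R ∈ S, (∃ s t w, IsCrossing m M R s t w) ∨ IsOffSection R := fun R hR =>
    exists_isCrossing_or_isOffSection (fun i x hx => ⟨(hm i).2 hx, (hM i).2 hx⟩)
      (isSummand_of_isMinkowskiCell (hcell R hR)) (hcell R hR).2 (htight R hR)
  set Cr := S.filter fun R => ∃ s t w, IsCrossing m M R s t w with hCr
  have hCr' : ∀ R : MinkowskiTriple, ∃ s t w, R ∈ Cr → IsCrossing m M R s t w := by
    intro R
    by_cases h : R ∈ Cr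
    · obtain ⟨s, t, w, h'⟩ := (Finset.mem_filter.1 h).2
      exact ⟨s, t, w, fun _ => h'⟩
    · exact ⟨⟨0, 0, 0, 0, 0⟩, ⟨0, 0, 0, 0, 0⟩, 0, fun h' => absurd h' h⟩
  choose sL sR w hcr using hCr'
  have hCrS : ∀ R ∈ Cr, R ∈ S := fun R hR => (Finset.mem_filter.1 hR).1
  have hconv : ∀ R ∈ Cr, Convex ℝ R.total := fun R hR => (hcell R (hCrS R hR)).convex
  have hover : ∀ R ∈ Cr, ∀ R' ∈ Cr, max (sL R).pos (sL R').pos < min (sR R).pos (sR R').pos →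
      R = R' := fun R hR R' hR' => (hcr R hR).eq_of_overlap (hcr R' hR') (hconv R hR)
        (hconv R' hR') (hprop R (hCrS R hR) R' (hCrS R' hR'))
  set C := MinkowskiTriple.total (fun i => convexHull ℝ (curveSupports B i)) with hC
  have hCconv : Convex ℝ C := convex_total fun i => convex_convexHull ℝ _
  have hcov : ∀ x : ℝ, (x, (3 / 2 : ℝ)) ∈ C →
      ∃ R ∈ Cr, (sL R).pos ≤ x ∧ x ≤ (sR R).pos := by
    intro x hx
    rw [← hcover, Set.mem_iUnion₂] at hx
    obtain ⟨R, hR, hx⟩ := hx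
    have hRC : R ∈ Cr := by
      refine Finset.mem_filter.2 ⟨hR, (hcases R hR).resolve_right fun h => ?_⟩
      exact h.1 _ hx rfl
    exact ⟨R, hRC, (hcr R hRC).bounds x hx⟩
  have hsub : ∀ R ∈ Cr, R.total ⊆ C := by
    intro R hR p hp
    rw [← hcover]
    exact Set.mem_iUnion₂.2 ⟨R, hCrS R hR, hp⟩
  have hne : Cr.Nonempty := by
    obtain ⟨R, hR, -⟩ := hcov _ (base_slant_mem (by decide : (0 : Fin 3) ≠ 1) (hm 0).1 (hm 1).1)
    exact ⟨R, hR⟩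
  obtain ⟨R₀, hR₀, hmin⟩ := Cr.exists_min_image (fun R => (sL R).pos) hne
  obtain ⟨R₁, hR₁, hmax⟩ := Cr.exists_max_image (fun R => (sR R).pos) hne
  -- Strong induction on the number of crossed cells that end no later than `R`: the path up to `R`
  -- collects exactly their weights.
  have main : ∀ n : ℕ, ∀ R ∈ Cr, (Cr.filter fun R' => (sR R').pos ≤ (sR R).pos).card = n →
      Path m M (sL R₀) (sR R) (∑ R' ∈ Cr with (sR R').pos ≤ (sR R).pos, w R') := by
    intro n
    induction n using Nat.strong_induction_on with
    | _ n ih =>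
    intro R hR hn
    have hRc := hcr R hR
    rcases (hmin R hR).eq_or_lt with heq | hlt
    · have e1 : sL R₀ = sL R := by
        apply eq_of_point_eq (hcr R₀ hR₀).valid_left.1 hRc.valid_left.1
        apply congrFun
        apply (hcr R₀ hR₀).decomposition_eq hRc (hprop _ (hCrS _ hR₀) _ (hCrS _ hR))
          (hcr R₀ hR₀).mem_left hRc.mem_left
        rw [sum_point (hcr R₀ hR₀).valid_left.1, sum_point hRc.valid_left.1, heq]
      have e2 : (Cr.filter fun R' => (sR R').pos ≤ (sR R).pos) = {R} := by
        ext R'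
        simp only [Finset.mem_filter, Finset.mem_singleton]
        constructor
        · rintro ⟨h1, h2⟩
          apply hover R' h1 R hR
          rw [max_eq_left (by rw [← heq]; exact hmin R' h1), min_eq_left h2]
          exact (hcr R' h1).pos_lt
        · rintro rfl
          exact ⟨hR, le_rfl⟩
      rw [e2, Finset.sum_singleton, e1, ← zero_add (w R)]
      exact .snoc _ _ _ _ _ (.refl _ hRc.valid_left) hRc.step hRc.valid_right
    -- The point `x` lies just left of the cell `R`, beyond every earlier right end. The cell that
    -- covers `x` must therefore end exactly where `R` starts.
    · obtain ⟨x, hx, hx'⟩ := exists_lt_forall_lt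
        (insert (sL R₀).pos (Cr.image fun R => (sR R).pos)) (sL R).pos
      have hx0 : (sL R₀).pos < x := hx' _ (Finset.mem_insert_self _ _) hlt
      have hxC : (x, (3 / 2 : ℝ)) ∈ C := by
        apply hCconv.segment_subset (hsub _ hR₀ (hcr R₀ hR₀).left_mem_total)
          (hsub _ hR hRc.left_mem_total)
        rw [← Prod.image_mk_segment_left, segment_eq_Icc hlt.le]
        exact ⟨x, ⟨hx0.le, hx.le⟩, rfl⟩
      obtain ⟨R', hR', h1, h2⟩ := hcov x hxC
      have hR'c := hcr R' hR'
      have hneR : R' ≠ R := by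
        rintro rfl
        linarith
      have h3 : (sR R').pos = (sL R).pos := by
        apply le_antisymm
        · by_contra! hc
          apply hneR
          apply hover R' hR' R hR
          rw [max_eq_right (by linarith)]
          exact lt_min hc hRc.pos_lt
        · by_contra! hc
          have := hx' _ (Finset.mem_insert_of_mem (Finset.mem_image_of_mem _ hR')) hc
          linarith
      have e1 : sR R' = sL R := by
        apply eq_of_point_eq hR'c.valid_right.1 hRc.valid_left.1
        apply congrFun
        apply hR'c.decomposition_eq hRc (hprop _ (hCrS _ hR') _ (hCrS _ hR))
          hR'c.mem_right hRc.mem_left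
        rw [sum_point hR'c.valid_right.1, sum_point hRc.valid_left.1, h3]
      have e2 : (Cr.filter fun Q => (sR Q).pos ≤ (sR R).pos) =
          insert R (Cr.filter fun Q => (sR Q).pos ≤ (sR R').pos) := by
        ext Q
        simp only [Finset.mem_filter, Finset.mem_insert]
        constructor
        · rintro ⟨k1, k2⟩
          by_cases hQ : Q = R
          · exact .inl hQ
          · refine .inr ⟨k1, ?_⟩
            by_contra! hc
            apply hQ
            apply hover Q k1 R hR
            rw [min_eq_left k2]
            exact max_lt (hcr Q k1).pos_lt (by linarith)
        · rintro (rfl | ⟨k1, k2⟩)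
          · exact ⟨hR, le_rfl⟩
          · exact ⟨k1, k2.trans (by rw [h3]; exact hRc.pos_lt.le)⟩
      have e3 : R ∉ (Cr.filter fun Q => (sR Q).pos ≤ (sR R').pos) := by
        simp only [Finset.mem_filter, not_and, not_le]
        intro _
        rw [h3]
        exact hRc.pos_lt
      have hcard := congrArg Finset.card e2
      rw [Finset.card_insert_of_notMem e3, hn] at hcard
      have := ih _ (by omega) R' hR' rfl
      rw [e2, Finset.sum_insert e3, add_comm]
      exact .snoc _ _ _ _ _ this (e1 ▸ hRc.step) hRc.valid_right
  have hfin := main _ R₁ hR₁ rfl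
  rw [Finset.filter_true_of_mem hmax] at hfin
  -- Cells missed by the section are not apex-mixed, so the crossed cells account for all of the
  -- exponents.
  have hexp : ∑ R ∈ Cr, w R = mixedExponent S := by
    funext i
    rw [Finset.sum_apply, mixedExponent, Finset.sum_filter (fun R => IsApexMixed i R)]
    apply Finset.sum_subset_zero_on_sdiff (Finset.filter_subset _ _)
    · intro R hR
      rw [Finset.mem_sdiff] at hR
      apply if_neg
      have : ¬ ∃ s t w, IsCrossing m M R s t w := fun h =>
        hR.2 (Finset.mem_filter.2 ⟨hR.1, h⟩)
      exact ((hcases R hR.1).resolve_left this).2 i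
    · intro R hR
      rw [(hcr R hR).weight i]
  rw [hexp] at hfin
  have hl := left_end_eq (hcr R₀ hR₀).valid_left (fun i j hij => by
    obtain ⟨R, hR, h1, -⟩ := hcov _ (base_slant_mem hij (hm i).1 (hm j).1)
    exact (hmin R hR).trans h1)
  have hr := right_end_eq (hcr R₁ hR₁).valid_right (fun i j hij => by
    obtain ⟨R, hR, -, h2⟩ := hcov _ (base_slant_mem hij (hM i).1 (hM j).1)
    exact h2.trans (hmax R hR))
  exact ⟨_, _, hfin, hl.1, hl.2, hr.1, hr.2⟩

/-! ### Linear liftings induce mixed subdivisions -/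

section LinearLifting

variable {A : MinkowskiTriple} {ω : Fin 3 → ((ℝ × ℝ) →ₗ[ℝ] ℝ)}

/-- The points of a polytope at which a linear function is minimal are the convex hull of the
vertices at which it is minimal. -/
theorem mem_convexHull_argmin {X : Set (ℝ × ℝ)} (hX : X.Finite) (f : (ℝ × ℝ) →ₗ[ℝ] ℝ)
    {x : ℝ × ℝ} : x ∈ convexHull ℝ {a ∈ X | ∀ a' ∈ X, f a ≤ f a'} ↔
      x ∈ convexHull ℝ X ∧ ∀ y ∈ convexHull ℝ X, f x ≤ f y := by
  classical
  rcases X.eq_empty_or_nonempty with rfl | hne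
  · simp
  obtain ⟨a₀, ha₀, hmin⟩ := Set.exists_min_image X f hX hne
  have hlow : ∀ y ∈ convexHull ℝ X, f a₀ ≤ f y := by
    intro y hy
    have : convexHull ℝ X ⊆ {y | f a₀ ≤ f y} :=
      convexHull_min hmin (convex_halfSpace_ge f.isLinear _)
    exact this hy
  constructor
  · intro hx
    refine ⟨convexHull_mono (fun a ha => ha.1) hx, fun y hy => ?_⟩
    have : convexHull ℝ {a ∈ X | ∀ a' ∈ X, f a ≤ f a'} ⊆ {y | f y ≤ f a₀} :=
      convexHull_min (fun a ha => ha.2 a₀ ha₀) (convex_halfSpace_le f.isLinear _)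
    exact (this hx).trans (hlow y hy)
  · rintro ⟨hx, hx'⟩
    have hfx : f x = f a₀ := le_antisymm (hx' _ (subset_convexHull _ _ ha₀)) (hlow x hx)
    lift X to Finset (ℝ × ℝ) using hX
    obtain ⟨w, hw, hw1, hwx⟩ := Finset.mem_convexHull.1 hx
    -- The terms are nonnegative, so every vertex with nonzero weight is a minimizer.
    have hsum : ∑ y ∈ X, w y * (f y - f a₀) = 0 := by
      rw [Finset.centerMass_eq_of_sum_1 _ _ hw1] at hwx
      have h1 : ∑ y ∈ X, w y * f y = f a₀ := by
        rw [← hfx, ← hwx, map_sum]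
        simp
      simp only [mul_sub, Finset.sum_sub_distrib, h1, ← Finset.sum_mul, hw1]
      ring
    have hz := (Finset.sum_eq_zero_iff_of_nonneg (fun y hy =>
      mul_nonneg (hw y hy) (sub_nonneg.2 (hmin y hy)))).1 hsum
    rw [← hwx, ← Finset.centerMass_filter_ne_zero]
    apply Finset.centerMass_mem_convexHull
    · exact fun i hi => hw i (Finset.mem_filter.1 hi).1
    · rw [Finset.sum_filter_ne_zero, hw1]
      exact one_pos
    · intro y hy
      obtain ⟨hy, hwy⟩ := Finset.mem_filter.1 hy
      have : f y = f a₀ := by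
        have := (mul_eq_zero.1 (hz y hy)).resolve_left hwy
        linarith
      exact ⟨hy, fun a' ha' => by rw [id, this]; exact hmin a' ha'⟩

/-- For a linear lifting the functional plus the lifting is linear on the whole hull, so minimality
may be tested at all points and not only at those of the support. -/
theorem mem_lowerFace (hA : ∀ i, (A i).Finite) {l : (ℝ × ℝ) →L[ℝ] ℝ} {i : Fin 3} {x : ℝ × ℝ} :
    x ∈ lowerFace A (fun i => ω i) l i ↔ x ∈ convexHull ℝ (A i) ∧
      ∀ y ∈ convexHull ℝ (A i), l x + ω i x ≤ l y + ω i y :=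
  mem_convexHull_argmin (hA i) ((l : (ℝ × ℝ) →ₗ[ℝ] ℝ) + ω i)

/-- A decomposition of minimal height is unique up to faces. -/
theorem mem_lowerFace_of_sum_eq (hA : ∀ i, (A i).Finite) {l l' : (ℝ × ℝ) →L[ℝ] ℝ}
    {q q' : Fin 3 → ℝ × ℝ} (hq : ∀ i, q i ∈ lowerFace A (fun i => ω i) l i)
    (hq' : ∀ i, q' i ∈ lowerFace A (fun i => ω i) l' i) (h : ∑ i, q i = ∑ i, q' i) (i : Fin 3) :
    q' i ∈ lowerFace A (fun i => ω i) l i := by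
  simp only [mem_lowerFace hA] at *
  have e1 : ∑ i, l (q i) = ∑ i, l (q' i) := by rw [← map_sum, ← map_sum, h]
  have e2 : ∑ i, l' (q i) = ∑ i, l' (q' i) := by rw [← map_sum, ← map_sum, h]
  have h1 : ∀ i ∈ Finset.univ, l (q i) + ω i (q i) ≤ l (q' i) + ω i (q' i) :=
    fun i _ => (hq i).2 _ (hq' i).1
  have h2 : ∀ i ∈ Finset.univ, l' (q' i) + ω i (q' i) ≤ l' (q i) + ω i (q i) :=
    fun i _ => (hq' i).2 _ (hq i).1
  have h3 : ∑ i, (l (q i) + ω i (q i)) = ∑ i, (l (q' i) + ω i (q' i)) := by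
    apply le_antisymm (Finset.sum_le_sum h1)
    have := Finset.sum_le_sum h2
    simp only [Finset.sum_add_distrib] at *
    linarith
  have h4 := (Finset.sum_eq_sum_iff_of_le h1).1 h3 i (Finset.mem_univ i)
  refine ⟨(hq' i).1, fun y hy => ?_⟩
  rw [← h4]
  exact (hq i).2 y hy

/-- On a lower face of `l` the sum `l + ω i` is constant, so minimizing `l' + ω i` there means
maximizing `l - l'`. One functional thus exposes the intersections of all summands at once. -/
theorem intersectProperly_lowerFace (hA : ∀ i, (A i).Finite) (l l' : (ℝ × ℝ) →L[ℝ] ℝ) :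
    IntersectProperly (lowerFace A (fun i => ω i) l) (lowerFace A (fun i => ω i) l') := by
  have key : ∀ l l' : (ℝ × ℝ) →L[ℝ] ℝ, ∀ i,
      (lowerFace A (fun i => ω i) l i ∩ lowerFace A (fun i => ω i) l' i).Nonempty →
      lowerFace A (fun i => ω i) l i ∩ lowerFace A (fun i => ω i) l' i =
        (l - l').toExposed (lowerFace A (fun i => ω i) l i) := by
    rintro l l' i ⟨z, hz, hz'⟩
    ext x
    simp only [ContinuousLinearMap.toExposed, Set.mem_ofPred_eq, Set.mem_inter_iff,
      sub_apply]
    refine and_congr_right fun hx => ?_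
    have hx1 := (mem_lowerFace hA).1 hx
    constructor
    · intro hx' y hy
      have hy1 := (mem_lowerFace hA).1 hy
      have := ((mem_lowerFace hA).1 hx').2 y hy1.1
      have := hy1.2 x hx1.1
      linarith
    · intro h
      rw [mem_lowerFace hA] at hz hz' ⊢
      refine ⟨hx1.1, fun y hy => ?_⟩
      have h1 := h z ((mem_lowerFace hA).2 hz)
      have h2 := hz'.2 y hy
      have h3 := hx1.2 z hz.1
      linarith
  constructor
  · intro i
    refine ⟨fun hne => ⟨l - l', key l l' i hne⟩, fun hne => ⟨l' - l, ?_⟩⟩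
    rw [Set.inter_comm] at hne ⊢
    exact key l' l i hne
  · rintro ⟨p, hp, hp'⟩
    have hne : ∀ i,
        (lowerFace A (fun i => ω i) l i ∩ lowerFace A (fun i => ω i) l' i).Nonempty := by
      obtain ⟨q, hq, rfl⟩ := MinkowskiTriple.mem_total.1 hp
      obtain ⟨q', hq', h⟩ := MinkowskiTriple.mem_total.1 hp'
      exact fun i => ⟨q' i, mem_lowerFace_of_sum_eq hA hq hq' h.symm i, hq' i⟩
    refine ⟨fun i => lowerFace A (fun i => ω i) l i ∩ lowerFace A (fun i => ω i) l' i,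
      ⟨l - l', fun i => key l l' i (hne i)⟩, ⟨l' - l, fun i => ?_⟩, ?_⟩
    · refine (Set.inter_comm _ _).trans ?_
      exact key l' l i (by rw [Set.inter_comm]; exact hne i)
    · ext x
      constructor
      · rintro ⟨hx, hx'⟩
        obtain ⟨q, hq, rfl⟩ := MinkowskiTriple.mem_total.1 hx
        obtain ⟨q', hq', h⟩ := MinkowskiTriple.mem_total.1 hx'
        exact MinkowskiTriple.mem_total.2
          ⟨q', fun i => ⟨mem_lowerFace_of_sum_eq hA hq hq' h.symm i, hq' i⟩, h⟩
      · intro hx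
        obtain ⟨q, hq, rfl⟩ := MinkowskiTriple.mem_total.1 hx
        exact ⟨MinkowskiTriple.mem_total.2 ⟨q, fun i => (hq i).1, rfl⟩,
          MinkowskiTriple.mem_total.2 ⟨q, fun i => (hq i).2, rfl⟩⟩

/-- There are finitely many triples of polytopes with vertices in finite sets. -/
theorem finite_hullTriples (hA : ∀ i, (A i).Finite) :
    {R : MinkowskiTriple | ∀ i, R i ∈ (fun V => convexHull ℝ V) '' {V | V ⊆ A i}}.Finite :=
  Set.Finite.pi' fun i => (hA i).finite_subsets.image _

theorem lowerFace_mem_hullTriples (ω : Fin 3 → ℝ × ℝ → ℝ) (l : (ℝ × ℝ) →L[ℝ] ℝ) :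
    lowerFace A ω l ∈
      {R : MinkowskiTriple | ∀ i, R i ∈ (fun V => convexHull ℝ V) '' {V | V ⊆ A i}} :=
  fun _ => ⟨_, fun _ ha => ha.1, rfl⟩

/-- Every interior point lies in some lower face. -/
theorem exists_mem_lowerFace (hA : ∀ i, (A i).Finite) (ω : Fin 3 → ((ℝ × ℝ) →ₗ[ℝ] ℝ)) {p : ℝ × ℝ}
    (hp : p ∈ interior (MinkowskiTriple.total fun i => convexHull ℝ (A i))) :
    ∃ l, p ∈ (lowerFace A (fun i => ω i) l).total := by
  set C := MinkowskiTriple.total fun i => convexHull ℝ (A i) with hC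
  have hω : ∀ i, Continuous (ω i) := fun i => (ω i).continuous_of_finiteDimensional
  set Q : Set (Fin 3 → ℝ × ℝ) := Set.univ.pi fun i => convexHull ℝ (A i) with hQ
  have hQc : IsCompact Q := isCompact_univ_pi fun i => (hA i).isCompact_convexHull ℝ
  have hcont : Continuous fun q : Fin 3 → ℝ × ℝ => ∑ i, ω i (q i) :=
    continuous_finsetSum _ fun i _ => (hω i).comp (continuous_apply i)
  have hsumc : Continuous fun q : Fin 3 → ℝ × ℝ => ∑ i, q i :=
    continuous_finsetSum _ fun i _ => continuous_apply i
  obtain ⟨q, ⟨hqQ, hqp⟩, hqmin⟩ : ∃ q ∈ Q ∩ {q | ∑ i, q i = p},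
      IsMinOn (fun q : Fin 3 → ℝ × ℝ => ∑ i, ω i (q i)) (Q ∩ {q | ∑ i, q i = p}) q := by
    apply IsCompact.exists_isMinOn _ _ hcont.continuousOn
    · exact hQc.inter_right (isClosed_eq hsumc continuous_const)
    · obtain ⟨q, hq, h⟩ := MinkowskiTriple.mem_total.1 (interior_subset hp)
      exact ⟨q, fun i _ => hq i, h⟩
  obtain ⟨Ω, hΩ⟩ : ∃ Ω, ∀ q ∈ Q, ∑ i, ω i (q i) ≤ Ω := by
    obtain ⟨Ω, hΩ⟩ := (hQc.image hcont).bddAbove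
    exact ⟨Ω, fun q hq => hΩ ⟨q, hq, rfl⟩⟩
  -- The region on and above the lower hull of the lifted sum. A supporting hyperplane at the point
  -- of least height over `p` provides `l`.
  set E : Set ((ℝ × ℝ) × ℝ) := {z | ∃ q ∈ Q, ∑ i, q i = z.1 ∧ ∑ i, ω i (q i) ≤ z.2} with hE
  have hEconv : Convex ℝ E := by
    rintro ⟨x, g⟩ ⟨q, hq, hqx, hqg⟩ ⟨y, h⟩ ⟨r, hr, hry, hrh⟩ s t hs ht hst
    refine ⟨s • q + t • r, ?_, ?_, ?_⟩
    · exact convex_pi (fun i _ => convex_convexHull ℝ (A i)) hq hr hs ht hst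
    · simp only [Pi.add_apply, Pi.smul_apply, Finset.sum_add_distrib, ← Finset.smul_sum, hqx, hry]
      rfl
    · simp only [Pi.add_apply, Pi.smul_apply, map_add, map_smul, Finset.sum_add_distrib,
        ← Finset.smul_sum, Prod.snd_add, Prod.smul_snd]
      simp only [smul_eq_mul] at *
      gcongr
  have hint : interior C ×ˢ Set.Ioi Ω ⊆ interior E := by
    apply interior_maximal _ (isOpen_interior.prod isOpen_Ioi)
    rintro ⟨x, g⟩ ⟨hx, hg⟩
    obtain ⟨q, hq, h⟩ := MinkowskiTriple.mem_total.1 (interior_subset hx)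
    exact ⟨q, fun i _ => hq i, h, (hΩ q fun i _ => hq i).trans (le_of_lt hg)⟩
  have hnot : (p, ∑ i, ω i (q i)) ∉ interior E := by
    intro hmem
    have : ∀ᶠ g in nhds (∑ i, ω i (q i)), (p, g) ∈ E := by
      have h1 : Filter.Tendsto (fun g : ℝ => (p, g)) (nhds (∑ i, ω i (q i)))
          (nhds (p, ∑ i, ω i (q i))) := (Continuous.prodMk_right p).tendsto _
      exact h1.eventually (mem_interior_iff_mem_nhds.1 hmem)
    obtain ⟨g, hg, hg'⟩ := ((this.filter_mono nhdsWithin_le_nhds).and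
      (self_mem_nhdsWithin (s := Set.Iio (∑ i, ω i (q i))))).exists
    obtain ⟨r, hr, hrp, hrg⟩ := hg
    have := hqmin ⟨hr, hrp⟩
    simp only [Set.mem_ofPred_eq] at this hg'
    linarith
  obtain ⟨f, hf⟩ := geometric_hahn_banach_open_point hEconv.interior isOpen_interior hnot
  have hne : (interior E).Nonempty :=
    ⟨(p, Ω + 1), hint ⟨hp, by simp⟩⟩
  have hfle : ∀ z ∈ E, f z ≤ f (p, ∑ i, ω i (q i)) := by
    intro z hz
    have h1 : z ∈ closure (interior E) := by
      rw [hEconv.closure_interior_eq_closure_of_nonempty_interior hne]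
      exact subset_closure hz
    have h2 : closure (interior E) ⊆ {z | f z ≤ f (p, ∑ i, ω i (q i))} :=
      closure_minimal (fun z hz => (hf z hz).le) (isClosed_le f.continuous continuous_const)
    exact h2 h1
  set c := f (0, 1) with hc
  set k : (ℝ × ℝ) →L[ℝ] ℝ := f.comp (ContinuousLinearMap.inl ℝ (ℝ × ℝ) ℝ) with hk
  have hfz : ∀ x g, f (x, g) = k x + c * g := by
    intro x g
    have : ((x, g) : (ℝ × ℝ) × ℝ) = (x, 0) + g • (0, 1) := by simp
    rw [this, map_add, map_smul, smul_eq_mul, mul_comm]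
    simp [hk, hc]
  -- The hyperplane is not vertical: `(p, Ω + 1)` is interior to `E`, so `f` is strictly smaller
  -- there than at the least height over `p`.
  have hcneg : c < 0 := by
    have h0 := hf _ (hint ⟨hp, by simp⟩ : (p, Ω + 1) ∈ interior E)
    rw [hfz, hfz] at h0
    have h1 := hΩ q hqQ
    nlinarith
  set l : (ℝ × ℝ) →L[ℝ] ℝ := c⁻¹ • k with hl
  have hlle : ∀ r ∈ Q, ∑ i, (l (q i) + ω i (q i)) ≤ ∑ i, (l (r i) + ω i (r i)) := by
    intro r hr
    have h1 := hfle (∑ i, r i, ∑ i, ω i (r i)) ⟨r, hr, rfl, le_rfl⟩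
    rw [hfz, hfz, ← hqp, map_sum, map_sum] at h1
    simp only [hl, Finset.sum_add_distrib, smul_apply, smul_eq_mul,
      ← Finset.mul_sum]
    have h2 := mul_le_mul_of_nonpos_left h1 (inv_nonpos.2 hcneg.le)
    rw [mul_add, mul_add, inv_mul_cancel_left₀ hcneg.ne, inv_mul_cancel_left₀ hcneg.ne] at h2
    exact h2
  refine ⟨l, MinkowskiTriple.mem_total.2 ⟨q, fun i => ?_, hqp⟩⟩
  rw [mem_lowerFace hA]
  refine ⟨hqQ i trivial, fun y hy => ?_⟩
  -- Minimality of the sum over all triples gives minimality of each summand by varying one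
  -- coordinate.
  have h1 := hlle (Function.update q i y) (by
    intro j _
    by_cases hj : j = i
    · subst hj; simpa using hy
    · simpa [hj] using hqQ j trivial)
  rw [← Finset.add_sum_erase _ _ (Finset.mem_univ i),
    ← Finset.add_sum_erase _ (fun j => l (Function.update q i y j) + ω j (Function.update q i y j))
      (Finset.mem_univ i)] at h1
  have h2 : ∑ j ∈ Finset.univ.erase i,
      (l (Function.update q i y j) + ω j (Function.update q i y j)) =
      ∑ j ∈ Finset.univ.erase i, (l (q j) + ω j (q j)) := by
    apply Finset.sum_congr rfl
    intro j hj
    rw [Function.update_of_ne (Finset.ne_of_mem_erase hj)]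
  rw [h2, Function.update_self] at h1
  linarith

theorem volume_eq_zero_of_affDim_ne_two {X : Set (ℝ × ℝ)} (hX : affDim X ≠ 2) :
    volume X = 0 := by
  rcases X.eq_empty_or_nonempty with rfl | hne
  · simp
  apply measure_mono_null (subset_affineSpan ℝ X)
  apply Measure.addHaar_affineSubspace
  intro h
  apply hX
  have : vectorSpan ℝ X = ⊤ := by
    rw [← direction_affineSpan, h, AffineSubspace.direction_top]
  rw [affDim, this, finrank_top]
  simp

/-- A linear lifting induces a mixed subdivision. -/
theorem exists_isMixedSubdivision (hA : ∀ i, (A i).Finite) (hne : ∀ i, (A i).Nonempty)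
    (hdim : affDim (MinkowskiTriple.total fun i => convexHull ℝ (A i)) = 2)
    (ω : Fin 3 → ((ℝ × ℝ) →ₗ[ℝ] ℝ)) :
    ∃ S : Finset MinkowskiTriple, IsInducedBy A (fun i => ω i) S ∧ IsMixedSubdivision A S := by
  set C := MinkowskiTriple.total fun i => convexHull ℝ (A i) with hC
  have hfin : {R : MinkowskiTriple | ∃ l, R = lowerFace A (fun i => ω i) l}.Finite :=
    (finite_hullTriples hA).subset (by rintro _ ⟨l, rfl⟩; exact lowerFace_mem_hullTriples _ l)
  have hfin2 : {R : MinkowskiTriple | ∃ l, R = lowerFace A (fun i => ω i) l ∧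
      affDim R.total = 2}.Finite := hfin.subset (by rintro R ⟨l, h, -⟩; exact ⟨l, h⟩)
  have hsubC : ∀ l, (lowerFace A (fun i => ω i) l).total ⊆ C := by
    intro l p hp
    obtain ⟨q, hq, rfl⟩ := MinkowskiTriple.mem_total.1 hp
    exact MinkowskiTriple.mem_total.2 ⟨q, fun i => ((mem_lowerFace hA).1 (hq i)).1, rfl⟩
  have hclosed : ∀ l, IsClosed (lowerFace A (fun i => ω i) l).total := by
    intro l
    have h : ∀ i, IsCompact (lowerFace A (fun i => ω i) l i) := fun i =>
      ((hA i).subset fun a ha => ha.1).isCompact_convexHull ℝ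
    exact (((h 0).add (h 1)).add (h 2)).isClosed
  have hCconv : Convex ℝ C := convex_total fun i => convex_convexHull ℝ _
  have hCne : C.Nonempty := by
    choose a ha using hne
    exact ⟨_, MinkowskiTriple.mem_total.2 ⟨a, fun i => subset_convexHull _ _ (ha i), rfl⟩⟩
  refine ⟨hfin2.toFinset, fun R => by simp, fun R hR => ?_, ?_, ?_⟩
  · rw [Set.Finite.mem_toFinset] at hR
    obtain ⟨l, rfl, h2⟩ := hR
    refine ⟨fun i => ⟨_, fun a ha => ha.1, ?_, rfl⟩, h2⟩
    obtain ⟨a, ha, hmin⟩ := Set.exists_min_image (A i) (fun a => l a + ω i a) (hA i) (hne i)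
    exact ⟨a, ha, hmin⟩
  · apply Set.Subset.antisymm
    · simp only [Set.iUnion_subset_iff, Set.Finite.mem_toFinset]
      rintro _ ⟨l, rfl, -⟩
      exact hsubC l
    set U := ⋃ R ∈ hfin2.toFinset, R.total with hU
    have hUc : IsClosed U := by
      apply Set.Finite.isClosed_biUnion (Finset.finite_toSet _)
      intro R hR
      rw [Finset.mem_coe, Set.Finite.mem_toFinset] at hR
      obtain ⟨l, rfl, -⟩ := hR
      exact hclosed l
    -- Interior points missed by the cells lie in finitely many lower faces of smaller dimension, a
    -- null set. The missed part is also open, hence empty.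
    have hnull : volume (interior C \ U) = 0 := by
      set N := {R : MinkowskiTriple | (∃ l, R = lowerFace A (fun i => ω i) l) ∧
        affDim R.total ≠ 2} with hN
      have hNf : N.Finite := hfin.subset fun R hR => hR.1
      refine measure_mono_null (t := ⋃ R ∈ N, R.total) ?_ ?_
      · rintro p ⟨hp, hpU⟩
        obtain ⟨l, hl⟩ := exists_mem_lowerFace hA ω hp
        refine Set.mem_iUnion₂.2 ⟨_, ⟨⟨l, rfl⟩, fun h2 => hpU ?_⟩, hl⟩
        exact Set.mem_iUnion₂.2 ⟨_, hfin2.mem_toFinset.2 ⟨l, rfl, h2⟩, hl⟩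
      · rw [measure_biUnion_null_iff hNf.countable]
        exact fun R hR => volume_eq_zero_of_affDim_ne_two hR.2
    have hemp : interior C \ U = ∅ :=
      ((isOpen_interior.sdiff hUc).measure_eq_zero_iff volume).1 hnull
    have hint : (interior C).Nonempty := by
      rw [hCconv.interior_nonempty_iff_affineSpan_eq_top,
        ← AffineSubspace.direction_eq_top_iff_of_nonempty ((affineSpan_nonempty ℝ).2 hCne),
        direction_affineSpan]
      apply Submodule.eq_top_of_finrank_eq
      rw [show Module.finrank ℝ (ℝ × ℝ) = 2 by simp]
      exact hdim
    calc C ⊆ closure C := subset_closure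
      _ = closure (interior C) :=
        (hCconv.closure_interior_eq_closure_of_nonempty_interior hint).symm
      _ ⊆ U := closure_minimal (Set.sdiff_eq_empty.1 hemp) hUc
  · intro R hR R' hR'
    rw [Set.Finite.mem_toFinset] at hR hR'
    obtain ⟨l, rfl, -⟩ := hR
    obtain ⟨l', rfl, -⟩ := hR'
    exact intersectProperly_lowerFace hA l l'

end LinearLifting

/-! ### Dual graphs of linear liftings and tightness -/

/-- The linear functions `(x, y) ↦ α i * x - w i * y`. -/
def linearLift (α w : Fin 3 → ℝ) (i : Fin 3) : (ℝ × ℝ) →ₗ[ℝ] ℝ :=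
  α i • LinearMap.fst ℝ ℝ ℝ - w i • LinearMap.snd ℝ ℝ ℝ

theorem linearLift_apply (α w : Fin 3 → ℝ) (i : Fin 3) (p : ℝ × ℝ) :
    linearLift α w i p = α i * p.1 - w i * p.2 := by
  simp [linearLift]

/-- The function whose graph separates the functionals that are minimal at the apex of the `i`-th
lifted support from those that are minimal at its base. -/
noncomputable def dualGraph (m M α w : Fin 3 → ℝ) (i : Fin 3) (x : ℝ) : ℝ :=
  w i + min ((x + α i) * m i) ((x + α i) * M i)

theorem clm_apply_eq (l : (ℝ × ℝ) →L[ℝ] ℝ) (p : ℝ × ℝ) :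
    l p = l (1, 0) * p.1 + l (0, 1) * p.2 := by
  have : p = p.1 • ((1, 0) : ℝ × ℝ) + p.2 • ((0, 1) : ℝ × ℝ) := by ext <;> simp
  conv_lhs => rw [this]
  rw [map_add, map_smul, map_smul, smul_eq_mul, smul_eq_mul]; ring

section

variable {B : Fin 3 → Finset ℕ} {m M α w : Fin 3 → ℝ}

/-- The summands of the cells induced by a linear lifting. -/
theorem lowerFace_linearLift_cases (hm : ∀ i, IsLeast (realSupport B i) (m i))
    (hM : ∀ i, IsGreatest (realSupport B i) (M i)) (l : (ℝ × ℝ) →L[ℝ] ℝ) (i : Fin 3) :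
    (l (0, 1) < dualGraph m M α w i (l (1, 0)) ∧
      lowerFace (curveSupports B) (fun i => linearLift α w i) l i = {((0 : ℝ), (1 : ℝ))}) ∨
    ∃ b c, b ≤ c ∧ (0 < l (1, 0) + α i → b = m i ∧ c = m i) ∧
      (l (1, 0) + α i < 0 → b = M i ∧ c = M i) ∧
      ((dualGraph m M α w i (l (1, 0)) < l (0, 1) ∧
        lowerFace (curveSupports B) (fun i => linearLift α w i) l i = baseEdge b c) ∨
      (l (0, 1) = dualGraph m M α w i (l (1, 0)) ∧
        lowerFace (curveSupports B) (fun i => linearLift α w i) l i = apexCone b c)) := by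
  set x := l (1, 0) with hx
  set y := l (0, 1) with hy
  set V := {a ∈ curveSupports B i | ∀ a' ∈ curveSupports B i,
    l a + linearLift α w i a ≤ l a' + linearLift α w i a'} with hV
  have hface : lowerFace (curveSupports B) (fun i => linearLift α w i) l i = convexHull ℝ V := rfl
  -- The apex has value `y - w i` and the base point `z` has value `(x + α i) * z`. Comparing `y - w
  -- i` with the minimum `n` over the base decides between apex and base, and the sign of `x + α i`
  -- decides which end of the base is selected.
  have hval : ∀ p : ℝ × ℝ, l p + linearLift α w i p = (x + α i) * p.1 + (y - w i) * p.2 := by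
    intro p
    rw [clm_apply_eq, linearLift_apply]; ring
  set n := min ((x + α i) * m i) ((x + α i) * M i) with hn
  have hg : dualGraph m M α w i x = w i + n := rfl
  have hnle : ∀ z ∈ realSupport B i, n ≤ (x + α i) * z := by
    intro z hz
    have h1 := (hm i).2 hz
    have h2 := (hM i).2 hz
    rcases le_total 0 (x + α i) with h | h
    · exact (min_le_left _ _).trans (mul_le_mul_of_nonneg_left h1 h)
    · exact (min_le_right _ _).trans (mul_le_mul_of_nonpos_left h2 h)
  obtain ⟨z₀, hz₀, hnz₀⟩ : ∃ z ∈ realSupport B i, (x + α i) * z = n := by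
    rcases min_choice ((x + α i) * m i) ((x + α i) * M i) with h | h
    · exact ⟨_, (hm i).1, by rw [hn, h]⟩
    · exact ⟨_, (hM i).1, by rw [hn, h]⟩
  have hmemA : ∀ p, p ∈ curveSupports B i ↔
      p = (0, 1) ∨ ∃ z ∈ realSupport B i, p = (z, 0) := by
    intro p
    rw [curveSupports_eq]
    simp only [Set.mem_insert_iff, Set.mem_image]
    simp only [eq_comm]
  have hapex : ((0 : ℝ), (1 : ℝ)) ∈ V ↔ y ≤ w i + n := by
    simp only [hV, Set.mem_ofPred_eq, hval, hmemA]
    constructor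
    · intro h
      have := h.2 _ (.inr ⟨z₀, hz₀, rfl⟩)
      simp only at this
      linarith
    · refine fun h => ⟨.inl trivial, ?_⟩
      rintro _ (rfl | ⟨z, hz, rfl⟩)
      · exact le_rfl
      · have := hnle z hz
        simp only
        linarith
  have hbase : ∀ z, (z, (0 : ℝ)) ∈ V ↔
      z ∈ realSupport B i ∧ (x + α i) * z = n ∧ w i + n ≤ y := by
    intro z
    simp only [hV, Set.mem_ofPred_eq, hval, hmemA]
    constructor
    · rintro ⟨h0 | ⟨z', hz', h0⟩, h⟩
      · simp at h0
      · obtain rfl : z = z' := (Prod.mk.inj h0).1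
        have h1 := h _ (.inr ⟨z₀, hz₀, rfl⟩)
        have h2 := h _ (.inl rfl)
        have h3 := hnle z hz'
        simp only at h1 h2
        exact ⟨hz', by linarith, by linarith⟩
    · rintro ⟨h1, h2, h3⟩
      refine ⟨.inr ⟨z, h1, rfl⟩, ?_⟩
      rintro _ (rfl | ⟨z', hz', rfl⟩)
      · simp only; linarith
      · have := hnle z' hz'
        simp only; linarith
  have hVsub : V ⊆ insert ((0 : ℝ), (1 : ℝ)) ((fun b => (b, (0 : ℝ))) '' realSupport B i) := by
    rw [← curveSupports_eq]; exact fun a ha => ha.1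
  have hVne : V.Nonempty := by
    rcases le_total y (w i + n) with h | h
    · exact ⟨_, hapex.2 h⟩
    · exact ⟨_, (hbase z₀).2 ⟨hz₀, hnz₀, h⟩⟩
  rw [hface, hg]
  rcases convexHull_support_cases (finite_realSupport B i) hVsub hVne with
    h | ⟨b, hb, c, hc, hbc, hbV, hcV, -, h⟩
  · left
    refine ⟨?_, h⟩
    by_contra! hlt
    have h1 := subset_convexHull ℝ V ((hbase z₀).2 ⟨hz₀, hnz₀, hlt⟩)
    rw [h] at h1
    simp at h1
  · right
    obtain ⟨-, h1, h3⟩ := (hbase b).1 hbV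
    obtain ⟨-, h2, -⟩ := (hbase c).1 hcV
    refine ⟨b, c, hbc, fun hpos => ?_, fun hneg => ?_, ?_⟩
    · have key : ∀ z ∈ realSupport B i, (x + α i) * z = n → z = m i := by
        intro z hz hzn
        apply le_antisymm _ ((hm i).2 hz)
        have : n ≤ (x + α i) * m i := min_le_left _ _
        rw [← hzn] at this
        exact le_of_mul_le_mul_left this hpos
      exact ⟨key b hb h1, key c hc h2⟩
    · have key : ∀ z ∈ realSupport B i, (x + α i) * z = n → z = M i := by
        intro z hz hzn
        apply le_antisymm ((hM i).2 hz)
        have : n ≤ (x + α i) * M i := min_le_right _ _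
        rw [← hzn] at this
        nlinarith
      exact ⟨key b hb h1, key c hc h2⟩
    · rw [hapex] at h
      rcases h with ⟨h, h'⟩ | ⟨h, h'⟩
      · exact .inl ⟨not_le.1 h, h'⟩
      · exact .inr ⟨le_antisymm h h3, h'⟩

/-- A summand gains a dimension when apex and base are both minimal, that is, on its graph, and
another when several base points are minimal, which requires `x` to be the kink `-α i`. -/
theorem affDim_lowerFace_le (hm : ∀ i, IsLeast (realSupport B i) (m i))
    (hM : ∀ i, IsGreatest (realSupport B i) (M i)) (l : (ℝ × ℝ) →L[ℝ] ℝ) (i : Fin 3) :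
    affDim (lowerFace (curveSupports B) (fun i => linearLift α w i) l i) ≤
      (if l (0, 1) = dualGraph m M α w i (l (1, 0)) then 1 else 0) +
      (if l (1, 0) = - α i then 1 else 0) := by
  rcases lowerFace_linearLift_cases (α := α) (w := w) hm hM l i with
    ⟨-, h⟩ | ⟨b, c, hbc, h1, h2, h⟩
  · rw [h, affDim_singleton]
    exact Nat.zero_le _
  · rcases hbc.eq_or_lt with rfl | hlt
    · rcases h with ⟨-, h⟩ | ⟨h', h⟩
      · rw [h, baseEdge_self, affDim_singleton]
        exact Nat.zero_le _
      · rw [h, affDim_apexCone_self, if_pos h']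
        omega
    · have hz : l (1, 0) = - α i := by
        rcases lt_trichotomy (l (1, 0) + α i) 0 with h' | h' | h'
        · obtain ⟨rfl, rfl⟩ := h2 h'; exact absurd hlt (lt_irrefl _)
        · linarith
        · obtain ⟨rfl, rfl⟩ := h1 h'; exact absurd hlt (lt_irrefl _)
      rw [if_pos hz]
      rcases h with ⟨-, h⟩ | ⟨h', h⟩
      · rw [h, affDim_baseEdge hlt]
        omega
      · rw [h, affDim_apexCone hlt, if_pos h']

theorem affDim_add_le (X Y : Set (ℝ × ℝ)) : affDim (X + Y) ≤ affDim X + affDim Y := by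
  have : vectorSpan ℝ (X + Y) ≤ vectorSpan ℝ X ⊔ vectorSpan ℝ Y := by
    rw [vectorSpan_def ℝ (X + Y), Submodule.span_le]
    rintro _ ⟨_, ⟨x, hx, y, hy, rfl⟩, _, ⟨x', hx', y', hy', rfl⟩, rfl⟩
    have : (x + y) -ᵥ (x' + y') = (x -ᵥ x') + (y -ᵥ y') := by
      simp only [vsub_eq_sub]; abel
    simp only [this]
    exact Submodule.add_mem_sup (vsub_mem_vectorSpan ℝ hx hx') (vsub_mem_vectorSpan ℝ hy hy')
  exact (Submodule.finrank_mono this).trans (Submodule.finrank_add_le_finrank_add_finrank _ _)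

/-- The subdivision induced by a sufficiently generic linear lifting is tight. -/
theorem sum_affDim_lowerFace (hm : ∀ i, IsLeast (realSupport B i) (m i))
    (hM : ∀ i, IsGreatest (realSupport B i) (M i)) (hα : Function.Injective α)
    (h1 : ∀ i, Function.Injective fun j => dualGraph m M α w j (- α i))
    (h2 : ∀ x, ¬ (dualGraph m M α w 0 x = dualGraph m M α w 1 x ∧
      dualGraph m M α w 1 x = dualGraph m M α w 2 x)) (l : (ℝ × ℝ) →L[ℝ] ℝ)
    (hl : affDim (lowerFace (curveSupports B) (fun i => linearLift α w i) l).total = 2) :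
    ∑ i, affDim (lowerFace (curveSupports B) (fun i => linearLift α w i) l i) = 2 := by
  apply le_antisymm
  -- At a kink at most one graph passes through the point and no second kink occurs. Away from the
  -- kinks at most two graphs meet.
  · refine (Finset.sum_le_sum fun i _ => affDim_lowerFace_le hm hM l i).trans ?_
    rw [Finset.sum_add_distrib, ← Finset.card_filter, ← Finset.card_filter]
    by_cases hx : ∃ i, l (1, 0) = - α i
    · obtain ⟨i, hi⟩ := hx
      have c1 : (Finset.univ.filter fun j =>
          l (0, 1) = dualGraph m M α w j (l (1, 0))).card ≤ 1 := by
        rw [Finset.card_le_one]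
        intro a ha b hb
        rw [Finset.mem_filter, hi] at ha hb
        exact h1 i (ha.2.symm.trans hb.2)
      have c2 : (Finset.univ.filter fun j => l (1, 0) = - α j).card ≤ 1 := by
        rw [Finset.card_le_one]
        intro a ha b hb
        rw [Finset.mem_filter] at ha hb
        exact hα (neg_injective (ha.2.symm.trans hb.2))
      omega
    · have c2 : (Finset.univ.filter fun j => l (1, 0) = - α j) = ∅ := by
        rw [Finset.filter_eq_empty_iff]
        exact fun i _ hi => hx ⟨i, hi⟩
      have c1 : (Finset.univ.filter fun j =>
          l (0, 1) = dualGraph m M α w j (l (1, 0))).card < (Finset.univ : Finset (Fin 3)).card := by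
        apply Finset.card_lt_card
        rw [Finset.ssubset_univ_iff]
        intro h
        rw [Finset.filter_eq_self] at h
        refine h2 (l (1, 0)) ⟨?_, ?_⟩
        · rw [← h 0 (Finset.mem_univ _), ← h 1 (Finset.mem_univ _)]
        · rw [← h 1 (Finset.mem_univ _), ← h 2 (Finset.mem_univ _)]
      simp only [Finset.card_univ, Fintype.card_fin] at c1
      rw [c2, Finset.card_empty]
      omega
  · rw [← hl, Fin.sum_univ_three]
    exact (affDim_add_le _ _).trans (Nat.add_le_add_right (affDim_add_le _ _) _)

/-- Three lines whose order at `z` is known meet in a prescribed order to the right of `z`. -/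
theorem three_lines {ap aq ar sp sq sr z x : ℝ} (hz : z < x) (h1 : ar + sr * z < aq + sq * z)
    (h2 : aq + sq * z < ap + sp * z) :
    (ap + sp * x = ar + sr * x → sp < sr) ∧ (ap + sp * x = aq + sq * x → sp < sq) ∧
    (ap + sp * x = ar + sr * x → ap + sp * x < aq + sq * x →
      sp < sq ∧ (ap - aq) * (sr - sp) < (ap - ar) * (sq - sp)) ∧
    (ap + sp * x = aq + sq * x → ap + sp * x < ar + sr * x →
      sp < sr ∧ (ap - ar) * (sq - sp) < (ap - aq) * (sr - sp)) ∧
    (ap + sp * x = ar + sr * x → ap + sp * x = aq + sq * x →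
      (ap - aq) * (sr - sp) = (ap - ar) * (sq - sp)) := by
  have k1 : ap + sp * x ≤ ar + sr * x → sp < sr := by
    intro h; by_contra! hc; nlinarith
  have k2 : ap + sp * x ≤ aq + sq * x → sp < sq := by
    intro h; by_contra! hc; nlinarith
  refine ⟨fun h => k1 h.le, fun h => k2 h.le, fun h h' => ⟨k2 h'.le, ?_⟩,
    fun h h' => ⟨k1 h'.le, ?_⟩, fun h h' => ?_⟩
  · have := k1 h.le
    have e1 : ap - ar = (sr - sp) * x := by linarith
    have e2 : ap - aq < (sq - sp) * x := by linarith
    have := mul_lt_mul_of_pos_right e2 (sub_pos.2 this)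
    rw [e1]; linarith
  · have := k2 h.le
    have e1 : ap - aq = (sq - sp) * x := by linarith
    have e2 : ap - ar < (sr - sp) * x := by linarith
    have := mul_lt_mul_of_pos_right e2 (sub_pos.2 this)
    rw [e1]; linarith
  · have e1 : ap - aq = (sq - sp) * x := by linarith
    have e2 : ap - ar = (sr - sp) * x := by linarith
    rw [e1, e2]; ring

/-- The conditions on a linear lifting under which its exponents are known: the kinks of the dual
graphs are distinct and at distance at most `ε` from `0`, where the graphs are in the order given by
the weights, and the perturbation does not change the order in which three lines meet. -/
structure IsGenericLift (m M α w : Fin 3 → ℝ) (ε : ℝ) (p q r : Fin 3) : Prop where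
  injective : Function.Injective α
  abs_le : ∀ i, |α i| ≤ ε
  low : ∀ x, |x| ≤ ε → dualGraph m M α w r x < dualGraph m M α w q x
  high : ∀ x, |x| ≤ ε → dualGraph m M α w q x < dualGraph m M α w p x
  left : m p < m q → m p < m r →
    0 < ((w p + α p * m p - (w q + α q * m q)) * (m r - m p) -
      (w p + α p * m p - (w r + α r * m r)) * (m q - m p)) *
      ((w p - w q) * (m r - m p) - (w p - w r) * (m q - m p))
  right : M q < M p → M r < M p →
    0 < ((w p + α p * M p - (w q + α q * M q)) * (M p - M r) -
      (w p + α p * M p - (w r + α r * M r)) * (M p - M q)) *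
      ((w p - w q) * (M p - M r) - (w p - w r) * (M p - M q))

variable {ε : ℝ} {p q r : Fin 3}

theorem dualGraph_of_pos (hmM : ∀ i, m i ≤ M i) {x : ℝ} {i : Fin 3} (h : 0 ≤ x + α i) :
    dualGraph m M α w i x = w i + α i * m i + m i * x := by
  rw [dualGraph, min_eq_left (mul_le_mul_of_nonneg_left (hmM i) h)]; ring

theorem dualGraph_of_neg (hmM : ∀ i, m i ≤ M i) {x : ℝ} {i : Fin 3} (h : x + α i ≤ 0) :
    dualGraph m M α w i x = w i + α i * M i + -M i * -x := by
  rw [dualGraph, min_eq_right (mul_le_mul_of_nonpos_left (hmM i) h)]; ring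

theorem IsGenericLift.nonneg (h : IsGenericLift m M α w ε p q r) : 0 ≤ ε :=
  (abs_nonneg _).trans (h.abs_le 0)

/-- Beyond `ε` all graphs are lines of slope `m i` whose order at `ε` is known, so `three_lines`
applies. The field `left` transfers its comparison from the perturbed intercepts to the weights. -/
theorem IsGenericLift.lines_left (h : IsGenericLift m M α w ε p q r) (hmM : ∀ i, m i ≤ M i)
    {x : ℝ} (hx : ε < x) :
    let g := fun i => dualGraph m M α w i x
    (g p = g r → m p < m r) ∧ (g p = g q → m p < m q) ∧
    (g p = g r → g p < g q → m p < m q ∧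
      (w p - w q) * (m r - m p) < (w p - w r) * (m q - m p)) ∧
    (g p = g q → g p < g r → m p < m r ∧
      (w p - w r) * (m q - m p) < (w p - w q) * (m r - m p)) ∧
    ¬ (g p = g r ∧ g p = g q) := by
  intro g
  have hα := fun i => neg_le_of_abs_le (h.abs_le i)
  have hg : ∀ i, g i = w i + α i * m i + m i * x := fun i =>
    dualGraph_of_pos hmM (by linarith [hα i])
  have hε : ∀ i, dualGraph m M α w i ε = w i + α i * m i + m i * ε := fun i =>
    dualGraph_of_pos hmM (by linarith [hα i])
  have hlow := h.low ε (by rw [abs_of_nonneg h.nonneg])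
  have hhigh := h.high ε (by rw [abs_of_nonneg h.nonneg])
  rw [hε, hε] at hlow hhigh
  obtain ⟨t1, t2, t3, t4, t5⟩ := three_lines hx hlow hhigh
  have hl := h.left
  simp only [hg]
  refine ⟨t1, t2, fun e e' => ?_, fun e e' => ?_, fun e => ?_⟩
  · have k := t3 e e'
    refine ⟨k.1, ?_⟩
    have := hl k.1 (t1 e)
    by_contra! hc
    nlinarith
  · have k := t4 e e'
    refine ⟨k.1, ?_⟩
    have := hl (t2 e) k.1
    by_contra! hc
    nlinarith
  · have := hl (t2 e.2) (t1 e.1)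
    rw [t5 e.1 e.2, sub_self, zero_mul] at this
    exact lt_irrefl _ this

theorem IsGenericLift.lines_right (h : IsGenericLift m M α w ε p q r) (hmM : ∀ i, m i ≤ M i)
    {x : ℝ} (hx : x < -ε) :
    let g := fun i => dualGraph m M α w i x
    (g p = g r → M r < M p) ∧ (g p = g q → M q < M p) ∧
    (g p = g r → g p < g q → M q < M p ∧
      (w p - w q) * (M p - M r) < (w p - w r) * (M p - M q)) ∧
    (g p = g q → g p < g r → M r < M p ∧
      (w p - w r) * (M p - M q) < (w p - w q) * (M p - M r)) ∧
    ¬ (g p = g r ∧ g p = g q) := by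
  intro g
  have hα := fun i => le_of_abs_le (h.abs_le i)
  have hg : ∀ i, g i = w i + α i * M i + -M i * -x := fun i =>
    dualGraph_of_neg hmM (by linarith [hα i])
  have hε : ∀ i, dualGraph m M α w i (-ε) = w i + α i * M i + -M i * ε := fun i => by
    rw [dualGraph_of_neg hmM (by linarith [hα i]), neg_neg]
  have hlow := h.low (-ε) (by rw [abs_neg, abs_of_nonneg h.nonneg])
  have hhigh := h.high (-ε) (by rw [abs_neg, abs_of_nonneg h.nonneg])
  rw [hε, hε] at hlow hhigh
  obtain ⟨t1, t2, t3, t4, t5⟩ := three_lines (lt_neg_of_lt_neg hx) hlow hhigh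
  have hl := h.right
  simp only [neg_lt_neg_iff, neg_sub_neg] at t1 t2 t3 t4 t5
  simp only [hg]
  refine ⟨t1, t2, fun e e' => ?_, fun e e' => ?_, fun e => ?_⟩
  · have k := t3 e e'
    refine ⟨k.1, ?_⟩
    have := hl k.1 (t1 e)
    by_contra! hc
    nlinarith
  · have k := t4 e e'
    refine ⟨k.1, ?_⟩
    have := hl (t2 e) k.1
    by_contra! hc
    nlinarith
  · have := hl (t2 e.2) (t1 e.1)
    rw [t5 e.1 e.2, sub_self, zero_mul] at this
    exact lt_irrefl _ this

/-- Near the kinks the graphs are strictly ordered, and farther out a triple point would make the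
determinant in `left` or `right` vanish. -/
theorem IsGenericLift.isTight (h : IsGenericLift m M α w ε p q r) (hpq : p ≠ q) (hpr : p ≠ r)
    (hqr : q ≠ r) (hm : ∀ i, IsLeast (realSupport B i) (m i))
    (hM : ∀ i, IsGreatest (realSupport B i) (M i)) (l : (ℝ × ℝ) →L[ℝ] ℝ)
    (hl : affDim (lowerFace (curveSupports B) (fun i => linearLift α w i) l).total = 2) :
    ∑ i, affDim (lowerFace (curveSupports B) (fun i => linearLift α w i) l i) = 2 := by
  have cov : ∀ i : Fin 3, i = p ∨ i = q ∨ i = r := by intro i; omega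
  have hmM : ∀ i, m i ≤ M i := fun i => (hm i).2 (hM i).1
  have near : ∀ x, |x| ≤ ε → Function.Injective fun j => dualGraph m M α w j x := by
    intro x hx i j hij
    have h1 := h.low x hx
    have h2 := h.high x hx
    simp only at hij
    rcases cov i with rfl | rfl | rfl <;> rcases cov j with rfl | rfl | rfl <;>
      first | rfl | (exfalso; linarith)
  refine sum_affDim_lowerFace hm hM h.injective
    (fun i => near _ (by rw [abs_neg]; exact h.abs_le i)) ?_ l hl
  rintro x ⟨e1, e2⟩
  have eq : ∀ i j, dualGraph m M α w i x = dualGraph m M α w j x := by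
    have : ∀ i, dualGraph m M α w i x = dualGraph m M α w 0 x := by
      intro i
      fin_cases i
      · rfl
      · exact e1.symm
      · exact (e1.trans e2).symm
    exact fun i j => (this i).trans (this j).symm
  rcases le_or_gt |x| ε with hx | hx
  · exact hpq (near x hx (eq p q))
  · rcases lt_abs.1 hx with hx | hx
    · exact (h.lines_left hmM hx).2.2.2.2 ⟨eq p r, eq p q⟩
    · exact (h.lines_right hmM (lt_neg_of_lt_neg hx)).2.2.2.2 ⟨eq p r, eq p q⟩

end

/-! ### Exponents of generic linear liftings -/

section

variable {B : Fin 3 → Finset ℕ} {m M α w : Fin 3 → ℝ} {ε : ℝ} {p q r : Fin 3}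

/-- The cell with the apex as its `t`-th summand and edges from the apex to `(s i, 0)` as the other
summands. -/
def slantCell (t : Fin 3) (s : Fin 3 → ℝ) : MinkowskiTriple :=
  fun i => if i = t then {((0 : ℝ), (1 : ℝ))} else apexCone (s i) (s i)

theorem volume_real_slantCell {t o : Fin 3} (hpt : p ≠ t) (hpo : p ≠ o) (hto : t ≠ o)
    (s : Fin 3 → ℝ) : volume.real (slantCell t s).total = |s o - s p| :=
  volume_real_slant_slant hpo hpt hto.symm (by simp [slantCell, hpt])
    (by simp [slantCell, hto.symm]) (by simp [slantCell])

theorem IsGenericLift.isApexMixed_cases (h : IsGenericLift m M α w ε p q r) {t o : Fin 3}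
    (hpt : p ≠ t) (hto : t ≠ o) (ht : t = q ∨ t = r)
    (hm : ∀ i, IsLeast (realSupport B i) (m i)) (hM : ∀ i, IsGreatest (realSupport B i) (M i))
    {l : (ℝ × ℝ) →L[ℝ] ℝ}
    (hl : IsApexMixed t (lowerFace (curveSupports B) (fun i => linearLift α w i) l)) :
    let g := fun i => dualGraph m M α w i (l (1, 0))
    g p = g o ∧ g p < g t ∧
    ((ε < l (1, 0) ∧
      lowerFace (curveSupports B) (fun i => linearLift α w i) l = slantCell t m) ∨
    (l (1, 0) < -ε ∧
      lowerFace (curveSupports B) (fun i => linearLift α w i) l = slantCell t M)) := by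
  intro g
  have cases := fun i => lowerFace_linearLift_cases (α := α) (w := w) hm hM l i
  set R := lowerFace (curveSupports B) (fun i => linearLift α w i) l with hR
  set x := l (1, 0) with hx
  set y := l (0, 1) with hy
  have hRt : y < g t := by
    rcases cases t with ⟨h1, -⟩ | ⟨b, c, hbc, -, -, ⟨-, h1⟩ | ⟨-, h1⟩⟩
    · exact h1
    · have : (b, (0 : ℝ)) ∈ R t := by rw [h1]; exact ⟨le_rfl, hbc, rfl⟩
      rw [hl.1] at this
      simp at this
    · have : (b, (0 : ℝ)) ∈ R t := by
        rw [h1]; exact ⟨le_rfl, zero_le_one, by simp, by simpa using hbc⟩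
      rw [hl.1] at this
      simp at this
  have hge : ∀ i, i ≠ t → g i ≤ y := by
    intro i hi
    have hd := hl.2 i hi
    rcases cases i with ⟨-, h1⟩ | ⟨b, c, -, -, -, ⟨h1, -⟩ | ⟨h1, -⟩⟩
    · rw [h1, affDim_singleton] at hd
      simp at hd
    · exact h1.le
    · exact h1.ge
  -- The apex condition puts the graph of `p` below that of `t`, contrary to the order near the
  -- kinks. Far from the kinks no base edge is selected, so both segments are slanted.
  have hxε : ε < |x| := by
    by_contra! hc
    have h1 := h.low x hc
    have h2 := h.high x hc
    have h3 := hge p hpt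
    have h4 : g t < g p := by
      rcases ht with rfl | rfl
      · exact h2
      · exact h1.trans h2
    linarith
  have hne : ∀ i, x + α i ≠ 0 := by
    intro i hi
    have : |x| = |α i| := by
      rw [← abs_neg (α i)]; congr 1; linarith
    have := h.abs_le i
    linarith
  have hslant : ∀ i, i ≠ t → g i = y ∧ ((0 < x + α i ∧ R i = apexCone (m i) (m i)) ∨
      (x + α i < 0 ∧ R i = apexCone (M i) (M i))) := by
    intro i hi
    have hd := hl.2 i hi
    rcases cases i with ⟨-, h1⟩ | ⟨b, c, -, k1, k2, h1⟩
    · rw [h1, affDim_singleton] at hd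
      simp at hd
    · have hbc : b = c := by
        rcases lt_or_gt_of_ne (hne i) with h' | h'
        · rw [(k2 h').1, (k2 h').2]
        · rw [(k1 h').1, (k1 h').2]
      subst hbc
      rcases h1 with ⟨-, h1⟩ | ⟨h0, h1⟩
      · rw [h1, baseEdge_self, affDim_singleton] at hd
        simp at hd
      · refine ⟨h0.symm, ?_⟩
        rcases lt_or_gt_of_ne (hne i) with h' | h'
        · exact .inr ⟨h', by rw [h1, (k2 h').1]⟩
        · exact .inl ⟨h', by rw [h1, (k1 h').1]⟩
  have gp := (hslant p hpt).1
  have go := (hslant o hto.symm).1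
  refine ⟨gp.trans go.symm, gp ▸ hRt, ?_⟩
  rcases lt_abs.1 hxε with hx' | hx'
  · refine .inl ⟨hx', ?_⟩
    funext i
    by_cases hi : i = t
    · subst hi
      simp only [slantCell, if_true]
      exact hl.1
    · simp only [slantCell, hi, if_false]
      refine ((hslant i hi).2.resolve_right fun h' => ?_).2
      have := neg_le_of_abs_le (h.abs_le i)
      linarith [h'.1]
  · refine .inr ⟨by linarith, ?_⟩
    funext i
    by_cases hi : i = t
    · subst hi
      simp only [slantCell, if_true]
      exact hl.1
    · simp only [slantCell, hi, if_false]
      refine ((hslant i hi).2.resolve_left fun h' => ?_).2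
      have := le_of_abs_le (h.abs_le i)
      linarith [h'.1]

open Classical in
-- Each side allows one cell only, since its slanted edges are prescribed, and that cell has the
-- area of `volume_real_slantCell`.
theorem IsGenericLift.mixedExponent_le (h : IsGenericLift m M α w ε p q r) {t o : Fin 3}
    (hpt : p ≠ t) (hpo : p ≠ o) (hto : t ≠ o) (ht : t = q ∨ t = r)
    (hm : ∀ i, IsLeast (realSupport B i) (m i)) (hM : ∀ i, IsGreatest (realSupport B i) (M i))
    {S : Finset MinkowskiTriple}
    (hS : IsInducedBy (curveSupports B) (fun i => linearLift α w i) S) :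
    mixedExponent S t ≤
      (if ∃ x, ε < x ∧ dualGraph m M α w p x = dualGraph m M α w o x ∧
        dualGraph m M α w p x < dualGraph m M α w t x then |m o - m p| else 0) +
      (if ∃ x, x < -ε ∧ dualGraph m M α w p x = dualGraph m M α w o x ∧
        dualGraph m M α w p x < dualGraph m M α w t x then |M o - M p| else 0) := by
  set EL := ∃ x, ε < x ∧ dualGraph m M α w p x = dualGraph m M α w o x ∧
    dualGraph m M α w p x < dualGraph m M α w t x with hEL
  set ER := ∃ x, x < -ε ∧ dualGraph m M α w p x = dualGraph m M α w o x ∧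
    dualGraph m M α w p x < dualGraph m M α w t x with hER
  set FL : Finset MinkowskiTriple := if EL then {slantCell t m} else ∅ with hFL
  set FR : Finset MinkowskiTriple := if ER then {slantCell t M} else ∅ with hFR
  have hsub : S.filter (fun R => IsApexMixed t R) ⊆ FL ∪ FR := by
    intro R hR
    obtain ⟨hR, hRt⟩ := Finset.mem_filter.1 hR
    obtain ⟨l, rfl, -⟩ := (hS R).1 hR
    obtain ⟨h1, h2, ⟨h3, h4⟩ | ⟨h3, h4⟩⟩ := h.isApexMixed_cases hpt hto ht hm hM hRt
    · have : EL := ⟨_, h3, h1, h2⟩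
      rw [Finset.mem_union, hFL, if_pos this, Finset.mem_singleton]
      exact .inl h4
    · have : ER := ⟨_, h3, h1, h2⟩
      rw [Finset.mem_union, hFR, if_pos this, Finset.mem_singleton]
      exact .inr h4
  calc mixedExponent S t ≤ ∑ R ∈ FL ∪ FR, volume.real R.total :=
        Finset.sum_le_sum_of_subset_of_nonneg hsub fun _ _ _ => measureReal_nonneg
    _ ≤ ∑ R ∈ FL, volume.real R.total + ∑ R ∈ FR, volume.real R.total := by
        rw [← Finset.sum_union_inter]
        exact le_add_of_nonneg_right (Finset.sum_nonneg fun _ _ => measureReal_nonneg)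
    _ = _ := by
        congr 1
        · by_cases hE : EL
          · rw [hFL, if_pos hE, if_pos hE, Finset.sum_singleton, volume_real_slantCell hpt hpo hto]
          · rw [hFL, if_neg hE, if_neg hE, Finset.sum_empty]
        · by_cases hE : ER
          · rw [hFR, if_pos hE, if_pos hE, Finset.sum_singleton, volume_real_slantCell hpt hpo hto]
          · rw [hFR, if_neg hE, if_neg hE, Finset.sum_empty]

open Classical in
-- The two events exclude each other, and each comes with the inequality that makes its cost the
-- smaller term of the minimum.
theorem endLoss_ge_of_exclusive {P Q u v : ℝ} (hu : 0 ≤ u) (hv : 0 ≤ v) {E F : Prop}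
    (hE : E → 0 < P ∧ 0 < Q ∧ u * Q < v * P) (hF : F → 0 < P ∧ 0 < Q ∧ v * P < u * Q) :
    u * (if E then |Q| else 0) + v * (if F then |P| else 0) ≤ endLoss P Q u v := by
  unfold endLoss
  by_cases h : E
  · obtain ⟨h1, h2, h3⟩ := hE h
    have hF' : ¬ F := fun h' => by
      have := (hF h').2.2
      linarith
    rw [if_pos h, if_neg hF', abs_of_pos h2, max_eq_left h1.le, max_eq_left h2.le,
      min_eq_left h3.le]
    simp
  · rw [if_neg h]
    by_cases h' : F
    · obtain ⟨h1, h2, h3⟩ := hF h'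
      rw [if_pos h', abs_of_pos h1, max_eq_left h1.le, max_eq_left h2.le,
        min_eq_right h3.le]
      simp
    · rw [if_neg h']
      simp only [mul_zero, add_zero]
      positivity

/-- The exponents obtained by a generic linear lifting are extreme. -/
theorem IsGenericLift.le_endLoss (h : IsGenericLift m M α w ε p q r) (hpq : p ≠ q) (hpr : p ≠ r)
    (hqr : q ≠ r) (hw : w r < w q) (hw' : w q < w p)
    (hm : ∀ i, IsLeast (realSupport B i) (m i)) (hM : ∀ i, IsGreatest (realSupport B i) (M i))
    {S : Finset MinkowskiTriple}
    (hS : IsInducedBy (curveSupports B) (fun i => linearLift α w i) S) :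
    (w p - w q) * mixedExponent S q + (w p - w r) * mixedExponent S r ≤
      endLoss (m q - m p) (m r - m p) (w p - w q) (w p - w r) +
      endLoss (M p - M q) (M p - M r) (w p - w q) (w p - w r) := by
  classical
  have hmM : ∀ i, m i ≤ M i := fun i => (hm i).2 (hM i).1
  have hu : 0 ≤ w p - w q := by linarith
  have hv : 0 ≤ w p - w r := by linarith
  have h1 := h.mixedExponent_le hpq hpr hqr (.inl rfl) hm hM hS
  have h2 := h.mixedExponent_le hpr hpq hqr.symm (.inr rfl) hm hM hS
  refine (add_le_add (mul_le_mul_of_nonneg_left h1 hu) (mul_le_mul_of_nonneg_left h2 hv)).trans ?_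
  rw [mul_add, mul_add, add_add_add_comm]
  rw [abs_sub_comm (M r), abs_sub_comm (M q)]
  apply add_le_add
  · apply endLoss_ge_of_exclusive hu hv
    · rintro ⟨x, hx, e1, e2⟩
      have hL := h.lines_left hmM hx
      have h3 := hL.2.2.1 e1 e2
      exact ⟨sub_pos.2 h3.1, sub_pos.2 (hL.1 e1), h3.2⟩
    · rintro ⟨x, hx, e1, e2⟩
      have hL := h.lines_left hmM hx
      have h3 := hL.2.2.2.1 e1 e2
      exact ⟨sub_pos.2 (hL.2.1 e1), sub_pos.2 h3.1, h3.2⟩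
  · apply endLoss_ge_of_exclusive hu hv
    · rintro ⟨x, hx, e1, e2⟩
      have hL := h.lines_right hmM hx
      have h3 := hL.2.2.1 e1 e2
      exact ⟨sub_pos.2 h3.1, sub_pos.2 (hL.1 e1), h3.2⟩
    · rintro ⟨x, hx, e1, e2⟩
      have hL := h.lines_right hmM hx
      have h3 := hL.2.2.2.1 e1 e2
      exact ⟨sub_pos.2 (hL.2.1 e1), sub_pos.2 h3.1, h3.2⟩

theorem abs_min_mul_le {x a b K : ℝ} (ha : |a| ≤ K) (hb : |b| ≤ K) :
    |min (x * a) (x * b)| ≤ |x| * K := by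
  rcases min_choice (x * a) (x * b) with h | h <;> rw [h, abs_mul] <;> gcongr

/-- Small perturbations of generic weights are generic liftings. -/
theorem exists_isGenericLift (m M : Fin 3 → ℝ) (hw : w r < w q) (hw' : w q < w p)
    (hL : m p < m q → m p < m r → (w p - w q) * (m r - m p) - (w p - w r) * (m q - m p) ≠ 0)
    (hR : M q < M p → M r < M p → (w p - w q) * (M p - M r) - (w p - w r) * (M p - M q) ≠ 0) :
    ∃ α ε, IsGenericLift m M α w ε p q r := by
  obtain ⟨K, hK⟩ : ∃ K, ∀ i, |m i| ≤ K ∧ |M i| ≤ K := by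
    refine ⟨∑ i, (|m i| + |M i|), fun i => ?_⟩
    have := Finset.single_le_sum (f := fun i => |m i| + |M i|)
      (fun i _ => by positivity) (Finset.mem_univ i)
    have h1 := abs_nonneg (m i)
    have h2 := abs_nonneg (M i)
    constructor <;> linarith
  have hK0 : 0 ≤ K := (abs_nonneg _).trans (hK 0).1
  set c : Fin 3 → ℝ := fun i => (i : ℝ) / 2 with hc
  have near : ∀ F : ℝ → ℝ, Continuous F → 0 < F 0 → ∀ᶠ ε in nhdsWithin 0 (Set.Ioi 0), 0 < F ε :=
    fun F hF h0 => (hF.continuousAt.eventually (lt_mem_nhds h0)).filter_mono nhdsWithin_le_nhds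
  -- For `|x| ≤ ε` each graph stays within `2 * ε * K` of its weight, so a gap above `4 * ε * K`
  -- preserves the order.
  have e1 := near (fun ε => w q - w r - 4 * ε * K) (by fun_prop) (by simpa using hw)
  have e2 := near (fun ε => w p - w q - 4 * ε * K) (by fun_prop) (by simpa using hw')
  have e3 : ∀ᶠ ε in nhdsWithin (0 : ℝ) (Set.Ioi 0), m p < m q → m p < m r →
      0 < ((w p + ε * c p * m p - (w q + ε * c q * m q)) * (m r - m p) -
        (w p + ε * c p * m p - (w r + ε * c r * m r)) * (m q - m p)) *
        ((w p - w q) * (m r - m p) - (w p - w r) * (m q - m p)) := by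
    by_cases h : m p < m q ∧ m p < m r
    · refine (near (fun ε => ((w p + ε * c p * m p - (w q + ε * c q * m q)) * (m r - m p) -
        (w p + ε * c p * m p - (w r + ε * c r * m r)) * (m q - m p)) *
        ((w p - w q) * (m r - m p) - (w p - w r) * (m q - m p))) (by fun_prop) ?_).mono
        fun ε hε _ _ => hε
      simpa using mul_self_pos.2 (hL h.1 h.2)
    · exact Filter.Eventually.of_forall fun ε h1 h2 => absurd ⟨h1, h2⟩ h
  have e4 : ∀ᶠ ε in nhdsWithin (0 : ℝ) (Set.Ioi 0), M q < M p → M r < M p →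
      0 < ((w p + ε * c p * M p - (w q + ε * c q * M q)) * (M p - M r) -
        (w p + ε * c p * M p - (w r + ε * c r * M r)) * (M p - M q)) *
        ((w p - w q) * (M p - M r) - (w p - w r) * (M p - M q)) := by
    by_cases h : M q < M p ∧ M r < M p
    · refine (near (fun ε => ((w p + ε * c p * M p - (w q + ε * c q * M q)) * (M p - M r) -
        (w p + ε * c p * M p - (w r + ε * c r * M r)) * (M p - M q)) *
        ((w p - w q) * (M p - M r) - (w p - w r) * (M p - M q))) (by fun_prop) ?_).mono
        fun ε hε _ _ => hε
      simpa using mul_self_pos.2 (hR h.1 h.2)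
    · exact Filter.Eventually.of_forall fun ε h1 h2 => absurd ⟨h1, h2⟩ h
  obtain ⟨ε, ⟨⟨⟨h1, h2⟩, h3⟩, h4⟩, h5⟩ :=
    ((((e1.and e2).and e3).and e4).and self_mem_nhdsWithin).exists
  have hε : 0 < ε := h5
  have hcle : ∀ i, |ε * c i| ≤ ε := by
    intro i
    have h0 : 0 ≤ c i := by positivity
    rw [abs_of_nonneg (by positivity)]
    have h6 : c i ≤ 1 := by
      simp only [hc]
      have : ((i : ℕ) : ℝ) ≤ 2 := by exact_mod_cast Nat.lt_succ_iff.1 i.isLt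
      linarith
    nlinarith
  have hg : ∀ i x, |x| ≤ ε → |dualGraph m M (fun i => ε * c i) w i x - w i| ≤ 2 * ε * K := by
    intro i x hx
    rw [dualGraph, add_sub_cancel_left]
    refine (abs_min_mul_le (hK i).1 (hK i).2).trans ?_
    have : |x + ε * c i| ≤ 2 * ε := (abs_add_le _ _).trans (by linarith [hcle i])
    gcongr
  refine ⟨fun i => ε * c i, ε, ?_, hcle, fun x hx => ?_, fun x hx => ?_, h3, h4⟩
  · intro i j hij
    have : c i = c j := mul_left_cancel₀ hε.ne' hij
    simp only [hc] at this
    have : ((i : ℕ) : ℝ) = (j : ℕ) := by linarith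
    exact Fin.ext (by exact_mod_cast this)
  · have k1 := abs_le.1 (hg r x hx)
    have k2 := abs_le.1 (hg q x hx)
    linarith [k1.2, k2.1]
  · have k1 := abs_le.1 (hg q x hx)
    have k2 := abs_le.1 (hg p x hx)
    linarith [k1.2, k2.1]

theorem exists_sorted {w : Fin 3 → ℝ} (hw : Function.Injective w) :
    ∃ p q r, p ≠ q ∧ p ≠ r ∧ q ≠ r ∧ w r < w q ∧ w q < w p := by
  have h01 : w 0 ≠ w 1 := hw.ne (by decide)
  have h02 : w 0 ≠ w 2 := hw.ne (by decide)
  have h12 : w 1 ≠ w 2 := hw.ne (by decide)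
  rcases h01.lt_or_gt with h1 | h1 <;> rcases h02.lt_or_gt with h2 | h2 <;>
    rcases h12.lt_or_gt with h3 | h3
  · exact ⟨2, 1, 0, by decide, by decide, by decide, h1, h3⟩
  · exact ⟨1, 2, 0, by decide, by decide, by decide, h2, h3⟩
  · linarith
  · exact ⟨1, 0, 2, by decide, by decide, by decide, h2, h1⟩
  · exact ⟨2, 0, 1, by decide, by decide, by decide, h1, h2⟩
  · linarith
  · exact ⟨0, 2, 1, by decide, by decide, by decide, h3, h2⟩
  · exact ⟨0, 1, 2, by decide, by decide, by decide, h3, h1⟩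

end

/-! ### Finiteness, the invariant sum and generic weights -/

theorem finite_curveSupports (B : Fin 3 → Finset ℕ) (i : Fin 3) : (curveSupports B i).Finite := by
  rw [curveSupports_eq]
  exact ((finite_realSupport B i).image _).insert _

theorem nonempty_curveSupports (B : Fin 3 → Finset ℕ) (i : Fin 3) :
    (curveSupports B i).Nonempty := ⟨_, .inl rfl⟩

theorem finite_mixedSubdivisions (B : Fin 3 → Finset ℕ) :
    {S | IsTightMixedSubdivision (curveSupports B) S}.Finite := by
  have hF := finite_hullTriples (A := curveSupports B) (finite_curveSupports B)
  refine (hF.toFinset.powerset.finite_toSet).subset fun S hS => ?_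
  rw [Finset.mem_coe, Finset.mem_powerset]
  intro R hR
  rw [Set.Finite.mem_toFinset]
  intro i
  obtain ⟨V, hV, -, h⟩ := (hS.1.1 R hR).1 i
  exact ⟨V, hV, h.symm⟩

/-- Both sums equal the greatest of the `M i` minus the least of the `m i`, the distance between the
end positions of the path. -/
theorem IsTightMixedSubdivision.sum_mixedExponent_eq {B : Fin 3 → Finset ℕ}
    {S S' : Finset MinkowskiTriple} (hS : IsTightMixedSubdivision (curveSupports B) S)
    (hS' : IsTightMixedSubdivision (curveSupports B) S') {m M : Fin 3 → ℝ}
    (hm : ∀ i, IsLeast (realSupport B i) (m i)) (hM : ∀ i, IsGreatest (realSupport B i) (M i)) :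
    ∑ i, mixedExponent S i = ∑ i, mixedExponent S' i := by
  obtain ⟨s, t, h, h1, h2, h3, h4⟩ := hS.exists_path hm hM
  obtain ⟨s', t', h', h1', h2', h3', h4'⟩ := hS'.exists_path hm hM
  rw [h.sum_eq, h'.sum_eq, h1, h3, h1', h3', le_antisymm (h2 s'.a) (h2' s.a),
    le_antisymm (h4 t'.a) (h4' t.a)]

theorem IsTightMixedSubdivision.affDim_eq_two {A : MinkowskiTriple} {S : Finset MinkowskiTriple}
    (hS : IsTightMixedSubdivision A S) (hA : ∀ i, (A i).Nonempty) :
    affDim (MinkowskiTriple.total fun i => convexHull ℝ (A i)) = 2 := by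
  obtain ⟨⟨hcell, hcover, -⟩, -⟩ := hS
  choose a ha using hA
  have hp : ∑ i, a i ∈ MinkowskiTriple.total fun i => convexHull ℝ (A i) :=
    MinkowskiTriple.mem_total.2 ⟨a, fun i => subset_convexHull _ _ (ha i), rfl⟩
  rw [← hcover, Set.mem_iUnion₂] at hp
  obtain ⟨R, hR, -⟩ := hp
  apply le_antisymm
  · have := Submodule.finrank_le
      (vectorSpan ℝ (MinkowskiTriple.total fun i => convexHull ℝ (A i)))
    simpa [affDim] using this
  · rw [← (hcell R hR).2, ← hcover]
    exact Submodule.finrank_mono (vectorSpan_mono ℝ (Set.subset_biUnion_of_mem hR))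

theorem int_eq_zero_of_add_mul_sqrt_two {a b : ℤ} (h : (a : ℝ) + b * √2 = 0) : a = 0 ∧ b = 0 := by
  have hb : b = 0 := by
    by_contra hb
    have h1 : Irrational ((b : ℝ) * √2) := irrational_sqrt_two.intCast_mul hb
    apply h1.ne_int (-a)
    push_cast
    linarith
  subst hb
  simpa using h

/-- The direction in which weights are perturbed. -/
noncomputable def genericDirection : Fin 3 → ℝ := ![0, 1, √2]

theorem genericDirection_ne (k : Fin 3 → ℤ) {p q r : Fin 3} (hpq : p ≠ q) (hpr : p ≠ r)
    (hqr : q ≠ r) (h : k p ≠ k q) :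
    (genericDirection p - genericDirection q) * ((k r : ℝ) - k p) -
      (genericDirection p - genericDirection r) * ((k q : ℝ) - k p) ≠ 0 := by
  set u : Fin 3 → ℤ := ![0, 1, 0]
  set v : Fin 3 → ℤ := ![0, 0, 1]
  have hη : ∀ i, genericDirection i = u i + v i * √2 := by
    intro i
    fin_cases i <;> simp [genericDirection, u, v]
  intro h0
  rw [hη, hη, hη] at h0
  -- The form has the integer coefficients `k r - k q`, `k p - k r`, `k q - k p`, whose sum is zero.
  -- Since `1` and `√2` are independent over the rationals, its vanishing makes two of them zero and
  -- hence all three, contrary to `k p ≠ k q`.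
  have h1 := int_eq_zero_of_add_mul_sqrt_two
    (a := (u p - u q) * (k r - k p) - (u p - u r) * (k q - k p))
    (b := (v p - v q) * (k r - k p) - (v p - v r) * (k q - k p)) (by
      push_cast
      rw [← h0]; ring)
  fin_cases p <;> fin_cases q <;> fin_cases r <;> simp [u, v] at hpq hpr hqr h h1 <;> omega

theorem genericDirection_injective : Function.Injective genericDirection := by
  have h2 : (1 : ℝ) < √2 := by
    rw [Real.lt_sqrt] <;> norm_num
  intro i j hij
  fin_cases i <;> fin_cases j <;> simp [genericDirection] at hij <;> first | rfl | linarith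

theorem eventually_add_mul_ne_zero (a : ℝ) {b : ℝ} (hb : b ≠ 0) :
    ∀ᶠ t in nhdsWithin (0 : ℝ) (Set.Ioi 0), a + t * b ≠ 0 := by
  by_cases ha : a = 0
  · filter_upwards [self_mem_nhdsWithin] with t ht
    rw [ha, zero_add]
    exact mul_ne_zero (ne_of_gt ht) hb
  · have : Continuous fun t : ℝ => a + t * b := by fun_prop
    exact (this.continuousAt.eventually_ne (by simpa using ha)).filter_mono nhdsWithin_le_nhds

/-- The weights obtained by a small perturbation are generic. -/
theorem eventually_generic (w₀ : Fin 3 → ℝ) (k : Fin 3 → ℤ) :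
    ∀ᶠ t in nhdsWithin (0 : ℝ) (Set.Ioi 0), ∀ p q r, p ≠ q → p ≠ r → q ≠ r → k p ≠ k q →
      (w₀ p + t * genericDirection p - (w₀ q + t * genericDirection q)) * ((k r : ℝ) - k p) -
      (w₀ p + t * genericDirection p - (w₀ r + t * genericDirection r)) * ((k q : ℝ) - k p) ≠ 0 := by
  simp only [Filter.eventually_all]
  intro p q r hpq hpr hqr hk
  refine (eventually_add_mul_ne_zero ((w₀ p - w₀ q) * ((k r : ℝ) - k p) -
    (w₀ p - w₀ r) * ((k q : ℝ) - k p)) (genericDirection_ne k hpq hpr hqr hk)).mono fun t ht => ?_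
  convert ht using 1
  ring

theorem eventually_injective (w₀ : Fin 3 → ℝ) :
    ∀ᶠ t in nhdsWithin (0 : ℝ) (Set.Ioi 0),
      Function.Injective fun i => w₀ i + t * genericDirection i := by
  have : ∀ᶠ t in nhdsWithin (0 : ℝ) (Set.Ioi 0), ∀ i j, i ≠ j →
      w₀ i + t * genericDirection i ≠ w₀ j + t * genericDirection j := by
    simp only [Filter.eventually_all]
    intro i j hij
    refine (eventually_add_mul_ne_zero (w₀ i - w₀ j)
      (sub_ne_zero.2 (genericDirection_injective.ne hij))).mono fun t ht h => ht ?_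
    linarith
  exact this.mono fun t ht i j hij => by
    by_contra hne
    exact ht i j hne hij

/-! ### Comparison with linear liftings and conclusion -/

/-- For generic weights, a linear lifting obtains the extreme point. -/
theorem exists_linear_le {B : Fin 3 → Finset ℕ} {m M w : Fin 3 → ℝ}
    (hm : ∀ i, IsLeast (realSupport B i) (m i)) (hM : ∀ i, IsGreatest (realSupport B i) (M i))
    (hw : Function.Injective w)
    (hL : ∀ p q r, p ≠ q → p ≠ r → q ≠ r → m p ≠ m q →
      (w p - w q) * (m r - m p) - (w p - w r) * (m q - m p) ≠ 0)
    (hR : ∀ p q r, p ≠ q → p ≠ r → q ≠ r → M p ≠ M q →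
      (w p - w q) * (M r - M p) - (w p - w r) * (M q - M p) ≠ 0)
    {S : Finset MinkowskiTriple} (hS : IsTightMixedSubdivision (curveSupports B) S) :
    ∃ S', IsTightMixedSubdivision (curveSupports B) S' ∧ IsLinearlyInduced (curveSupports B) S' ∧
      ∑ i, w i * mixedExponent S i ≤ ∑ i, w i * mixedExponent S' i := by
  obtain ⟨p, q, r, hpq, hpr, hqr, hlow, hhigh⟩ := exists_sorted hw
  obtain ⟨α, ε, hα⟩ := exists_isGenericLift (p := p) m M hlow hhigh
    (fun h _ => hL p q r hpq hpr hqr h.ne) (fun h _ h0 => hR p q r hpq hpr hqr h.ne' (by linarith))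
  obtain ⟨S', hind, hmix⟩ := exists_isMixedSubdivision (finite_curveSupports B)
    (nonempty_curveSupports B) (hS.affDim_eq_two (nonempty_curveSupports B)) (linearLift α w)
  have htight : IsTightMixedSubdivision (curveSupports B) S' := by
    refine ⟨hmix, fun R hR => ?_⟩
    obtain ⟨l, rfl, hl⟩ := (hind R).1 hR
    exact hα.isTight hpq hpr hqr hm hM l hl
  refine ⟨S', htight, ⟨_, hind⟩, ?_⟩
  have h1 := hα.le_endLoss hpq hpr hqr hlow hhigh hm hM hind
  obtain ⟨s, t, hpath, hs, hs', ht, ht'⟩ := hS.exists_path hm hM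
  have h2 := hpath.endLoss_add_endLoss_le hpq hpr hqr hs hs' ht ht' (fun i => (hm i).2 (hM i).1)
    (u := w p - w q) (v := w p - w r) (by linarith) (by linarith)
  -- Since the exponents of both subdivisions have the same sum, the larger weighted sum belongs to
  -- the smaller value of `(w p - w q) * e q + (w p - w r) * e r`.
  have h3 := hS.sum_mixedExponent_eq htight hm hM
  rw [sum_eq_of_distinct hpq hpr hqr, sum_eq_of_distinct hpq hpr hqr] at h3
  rw [sum_eq_of_distinct hpq hpr hqr, sum_eq_of_distinct hpq hpr hqr]
  have h4 := congrArg (fun z => w p * z) h3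
  beta_reduce at h4
  linarith

/-- The point obtained by a tight mixed subdivision is a convex combination of points obtained by
linear liftings. -/
theorem IsTightMixedSubdivision.obtainedPoint_mem {B : Fin 3 → Finset ℕ}
    (hB : ∀ i, (B i).Nonempty) {S : Finset MinkowskiTriple}
    (hS : IsTightMixedSubdivision (curveSupports B) S) :
    obtainedPoint S ∈ convexHull ℝ {q | ∃ S, IsTightMixedSubdivision (curveSupports B) S ∧
        IsLinearlyInduced (curveSupports B) S ∧ q = obtainedPoint S} := by
  set 𝒮 : Set (Finset MinkowskiTriple) := {S | IsTightMixedSubdivision (curveSupports B) S ∧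
        IsLinearlyInduced (curveSupports B) S} with h𝒮
  have h𝒮f : 𝒮.Finite := (finite_mixedSubdivisions B).subset fun S hS => hS.1
  have himage : {q | ∃ S, IsTightMixedSubdivision (curveSupports B) S ∧
      IsLinearlyInduced (curveSupports B) S ∧ q = obtainedPoint S} = obtainedPoint '' 𝒮 := by
    ext q
    constructor
    · rintro ⟨S, h1, h2, rfl⟩; exact ⟨S, ⟨h1, h2⟩, rfl⟩
    · rintro ⟨S, ⟨h1, h2⟩, rfl⟩; exact ⟨S, h1, h2, rfl⟩
  rw [himage]
  by_contra hnot
  obtain ⟨f, u, hf, hfu⟩ := geometric_hahn_banach_closed_point (convex_convexHull ℝ _)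
    ((h𝒮f.image obtainedPoint).isCompact_convexHull ℝ).isClosed hnot
  -- The end exponents are taken as integers because the genericity argument rests on the
  -- irrationality of `√2`.
  set kl : Fin 3 → ℤ := fun i => ((B i).min' (hB i) : ℕ) with hkl
  set kh : Fin 3 → ℤ := fun i => ((B i).max' (hB i) : ℕ) with hkh
  have hm : ∀ i, IsLeast (realSupport B i) ((kl i : ℤ) : ℝ) := by
    intro i
    refine ⟨⟨_, (B i).min'_mem (hB i), by simp [hkl]⟩, ?_⟩
    rintro _ ⟨b, hb, rfl⟩
    simp only [hkl, Int.cast_natCast, Nat.cast_le]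
    exact (B i).min'_le b hb
  have hM : ∀ i, IsGreatest (realSupport B i) ((kh i : ℤ) : ℝ) := by
    intro i
    refine ⟨⟨_, (B i).max'_mem (hB i), by simp [hkh]⟩, ?_⟩
    rintro _ ⟨b, hb, rfl⟩
    simp only [hkh, Int.cast_natCast, Nat.cast_le]
    exact (B i).le_max' b hb
  set w₀ : Fin 3 → ℝ := ![f (1, 0), f (0, 1), 0] with hw₀
  have hval : ∀ S, ∑ i, w₀ i * mixedExponent S i = f (obtainedPoint S) := by
    intro S
    rw [clm_apply_eq f, Fin.sum_univ_three]
    simp [hw₀, obtainedPoint]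
  -- Strict separation from finitely many subdivisions survives a small change of the weights. The
  -- third weight, zero at first, may then become nonzero, and this is harmless because all three
  -- exponents are compared.
  have hsep : ∀ᶠ t in nhdsWithin (0 : ℝ) (Set.Ioi 0), ∀ S' ∈ 𝒮,
      ∑ i, (w₀ i + t * genericDirection i) * mixedExponent S' i <
      ∑ i, (w₀ i + t * genericDirection i) * mixedExponent S i := by
    rw [Filter.eventually_all_finite h𝒮f]
    intro S' hS'
    have hc : ∀ S, Continuous fun t : ℝ =>
        ∑ i, (w₀ i + t * genericDirection i) * mixedExponent S i := by
      intro S; fun_prop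
    refine (((hc S').continuousAt (x := 0)).eventually_lt (hc S).continuousAt ?_).filter_mono
      nhdsWithin_le_nhds
    simp only [zero_mul, add_zero, hval]
    exact (hf _ (subset_convexHull _ _ ⟨S', hS', rfl⟩)).trans hfu
  obtain ⟨t, ⟨⟨ht1, ht2⟩, ht3⟩, ht4⟩ := (((hsep.and (eventually_injective w₀)).and
    (eventually_generic w₀ kl)).and (eventually_generic w₀ kh)).exists
  obtain ⟨S', h1, h2, h3⟩ := exists_linear_le hm hM ht2
    (fun p q r a b c d => ht3 p q r a b c fun h => d (by rw [h]))
    (fun p q r a b c d => ht4 p q r a b c fun h => d (by rw [h])) hS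
  exact absurd (ht1 S' ⟨h1, h2⟩) (not_lt.2 h3)

/-- A subdivision induced by a linear lifting uses only endpoints. -/
theorem IsLinearlyInduced.isEndpoint {B : Fin 3 → Finset ℕ} {S : Finset MinkowskiTriple}
    (hS : IsLinearlyInduced (curveSupports B) S) {j : Fin 3} {c : ℕ} (h : IsUsed S j c) :
    IsEndpoint B j c := by
  obtain ⟨ω, hω⟩ := hS
  obtain ⟨R, hR, hc⟩ := h
  obtain ⟨l, rfl, -⟩ := (hω R).1 hR
  have hmem : ∀ b ∈ B j, ((b : ℝ), (0 : ℝ)) ∈ curveSupports B j := fun b hb => .inr ⟨b, hb, rfl⟩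
  have hcB : c ∈ B j := by
    rcases (extremePoints_convexHull_subset hc).1 with h | ⟨b, hb, h⟩
    · simp at h
    · have : (c : ℝ) = b := (Prod.mk.inj h).1
      rwa [Nat.cast_injective this]
  refine ⟨hcB, ?_⟩
  by_contra! hnot
  obtain ⟨⟨b, hb, hbc⟩, d, hd, hcd⟩ := hnot
  have hbc' : (b : ℝ) < c := by exact_mod_cast hbc
  have hcd' : (c : ℝ) < d := by exact_mod_cast hcd
  set f : (ℝ × ℝ) →ₗ[ℝ] ℝ := (l : (ℝ × ℝ) →ₗ[ℝ] ℝ) + ω j with hf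
  have hfx : ∀ x : ℝ, l (x, 0) + ω j (x, 0) = x * f (1, 0) := by
    intro x
    have : ((x, 0) : ℝ × ℝ) = x • (1, 0) := by simp
    rw [this]
    change f (x • ((1, 0) : ℝ × ℝ)) = _
    rw [map_smul, smul_eq_mul]
  have hc' := (mem_lowerFace (finite_curveSupports B)).1 hc.1
  have e1 := hc'.2 _ (subset_convexHull _ _ (hmem b hb))
  have e2 := hc'.2 _ (subset_convexHull _ _ (hmem d hd))
  rw [hfx, hfx] at e1 e2
  -- A minimum at `c`, strictly between `b` and `d`, forces a linear function to be constant on the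
  -- base. Then `b` and `d` are selected too, and `c` is not a vertex.
  have h0 : f (1, 0) = 0 := by
    apply le_antisymm <;> by_contra! hcon <;> nlinarith
  have hin : ∀ x ∈ B j, ((x : ℝ), (0 : ℝ)) ∈
      lowerFace (curveSupports B) (fun i => ω i) l j := by
    intro x hx
    refine (mem_lowerFace (finite_curveSupports B)).2
      ⟨subset_convexHull _ _ (hmem x hx), fun y hy => ?_⟩
    have := hc'.2 y hy
    rwa [hfx, h0, mul_zero] at this ⊢
  have hseg : ((c : ℝ), (0 : ℝ)) ∈ openSegment ℝ ((b : ℝ), (0 : ℝ)) ((d : ℝ), (0 : ℝ)) := by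
    rw [← Prod.image_mk_openSegment_left, openSegment_eq_Ioo (hbc'.trans hcd')]
    exact ⟨c, ⟨hbc', hcd'⟩, rfl⟩
  have := (mem_extremePoints.1 hc).2 _ (hin b hb) _ (hin d hd) hseg
  have := (Prod.mk.inj this.1).1
  linarith

theorem IsZeroFaceOnL.isUsed {S : Finset MinkowskiTriple} {i : Fin 3} {b : ℕ}
    (h : IsZeroFaceOnL S i b) : IsUsed S i b := by
  obtain ⟨R, hR, l, hl⟩ := h
  refine ⟨R, hR, ?_⟩
  have h1 := hl i
  beta_reduce at h1
  rw [if_pos rfl] at h1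
  rw [← isExtreme_singleton, h1]
  exact (ContinuousLinearMap.toExposed.isExposed (l := l) (A := R i)).isExtreme

theorem mainTheorem4 (B : Fin 3 → Finset ℕ) (hB : ∀ i, (B i).Nonempty) :
    (∀ S : Finset MinkowskiTriple, IsTightMixedSubdivision (curveSupports B) S →
      ∀ (i : Fin 3) (b : ℕ), b ∈ B i → ¬ IsEndpoint B i b → IsZeroFaceOnL S i b →
        obtainedPoint S ∈
          convexHull ℝ {q | ∃ S', S' ≠ S ∧ IsReplacement B S i b S' ∧ q = obtainedPoint S'} ∧
        (obtainedPoint S ∈ (implicitPolygon B).extremePoints ℝ →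
          ∃ S', S' ≠ S ∧ IsReplacement B S i b S' ∧ obtainedPoint S' = obtainedPoint S)) ∧
    (∀ S : Finset MinkowskiTriple, IsTightMixedSubdivision (curveSupports B) S →
      obtainedPoint S ∈ implicitPolygon B) ∧
    implicitPolygon B =
      convexHull ℝ {q | ∃ S, IsTightMixedSubdivision (curveSupports B) S ∧
        IsLinearlyInduced (curveSupports B) S ∧ q = obtainedPoint S} := by

  have main := fun S hS => IsTightMixedSubdivision.obtainedPoint_mem hB (S := S) hS
  have hsub : {q | ∃ S, IsTightMixedSubdivision (curveSupports B) S ∧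
        IsLinearlyInduced (curveSupports B) S ∧ q = obtainedPoint S} ⊆
      {q | ∃ S, IsTightMixedSubdivision (curveSupports B) S ∧
        IsRegularSubdivision (curveSupports B) S ∧ q = obtainedPoint S} := by
    rintro _ ⟨S, h1, ⟨ω, h2⟩, rfl⟩
    exact ⟨S, h1, ⟨_, h2⟩, rfl⟩
  have hpoly : ∀ S, IsTightMixedSubdivision (curveSupports B) S →
      obtainedPoint S ∈ implicitPolygon B := fun S hS => convexHull_mono hsub (main S hS)
  refine ⟨fun S hS i b hb hend hface => ?_, hpoly, ?_⟩
  · have hmem : obtainedPoint S ∈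
        convexHull ℝ {q | ∃ S', S' ≠ S ∧ IsReplacement B S i b S' ∧ q = obtainedPoint S'} := by
      refine convexHull_mono ?_ (main S hS)
      -- A linear lifting uses endpoints only, while `S` uses `b` because a zero-dimensional face
      -- has vertices as its summands. So the two subdivisions differ.
      rintro _ ⟨S', h1, h2, rfl⟩
      refine ⟨S', ?_, ⟨h1, fun j c hc => .inl (h2.isEndpoint hc)⟩, rfl⟩
      rintro rfl
      exact hend (h2.isEndpoint hface.isUsed)
    refine ⟨hmem, fun hext => ?_⟩
    have hsub' : convexHull ℝ {q | ∃ S', S' ≠ S ∧ IsReplacement B S i b S' ∧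
        q = obtainedPoint S'} ⊆ implicitPolygon B := by
      refine convexHull_min ?_ (convex_convexHull ℝ _)
      rintro _ ⟨S', -, h, rfl⟩
      exact hpoly S' h.1
    -- An extreme point of the polygon that lies in the smaller hull is extreme there too, and hence
    -- is one of its generators.
    obtain ⟨S', h1, h2, h3⟩ := extremePoints_convexHull_subset
      (inter_extremePoints_subset_extremePoints_of_subset hsub' ⟨hmem, hext⟩)
    exact ⟨S', h1, h2, h3.symm⟩
  · apply Set.Subset.antisymm
    · refine convexHull_min ?_ (convex_convexHull ℝ _)
      rintro _ ⟨S, h1, -, rfl⟩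
      exact main S h1
    · exact convexHull_mono hsub
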